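/- **Setting.** Let $m\ge 1$ and let $\Omega\subset\mathbb C$ be a finite union of pairwise disjoint oriented piecewise $C^1$ simple contours, each of which is closed or extends to infinity at both ends. Distinct contours approach each other at infinity at most polynomially fast: there are $\kappa>0$, $N\in\mathbb N$ with $|u-v|\,(1+|u|)^N\ge\kappa$ for $u,v$ on different contours. For $x,y,t\in\mathbb R^m$ let $$\Delta(z)=\operatorname{diag}\big(e^{t_1z^3+y_1z^2+x_1z},\dots,e^{t_mz^3+y_mz^2+x_mz},1\big).$$ Let $F,G:\Omega\to\mathbb C^{m+1}$ be constant on each connected component of $\Omega$, independent of $(x,y,t)$, with $F_i(u)G_i(u)=0$ for all $u\in\Omega$ and $1\le i\le m+1$. Let $c$ be a non-vanishing scalar function on $\Omega$, which may depend on $(x,y,t)$, and put $f=c\,\Delta F$, $g=c^{-1}\Delta^{-1}G$. Let $\mathcal U\subset\mathbb R^{3m}$ be a set of parameters $(x,y,t)$ whose slice at every fixed $t$ is open in the variables $(x,y)$ (for instance, an open set). Assume that for $(x,y,t)\in\mathcal U$ the entries of $f,g$ are in $L^2(\Omega)\cap L^\infty(\Omega)$, that the integral operator $\mathsf H$ with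 kernel $\mathsf H(u,v)=\frac{f(u)^Tg(v)}{u-v}$ ($u\ne v$), $\mathsf H(u,u)=0$, is bounded on $L^2(\Omega,dz)$ (so that $\mathsf H$ is a strongly cubic integrable operator), and that $1-\mathsf H$ is invertible. Define the $(m+1)\times(m+1)$ matrix $$\Phi_1=\int_\Omega\big((1-\mathsf H)^{-1}f\big)(s)\,g(s)^T\,ds=\begin{pmatrix} q&p\\ r&s\end{pmatrix}$$ with $q,p,r,s$ of sizes $m\times m$, $m\times 1$, $1\times m$, $1\times1$. Write $\mathbf t=\operatorname{diag}(t_j)$, $\mathbf y=\operatorname{diag}(y_j)$, $\mathbf x=\operatorname{diag}(x_j)$, $\partial=\sum_k t_k\partial_{x_k}$, $\partial_x=\sum_k\partial_{x_k}$ and $[A,B]=AB-BA$. **Statement.** On $\mathcal U$ the matrix $\Phi_1$ is twice continuously differentiable in $x$, and the following hold. 1. The functions $q,p,r$ satisfy $$\begin{aligned} &3\partial^2q-2[\partial q,\mathbf y]-3[[q,\mathbf t],\partial q]+3\mathbf t p\,\partial r+3(\partial p)r\mathbf t+2[[q,\mathbf t],[q,\mathbf y]]-2\mathbf t p r\mathbf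 y+2\mathbf y p r\mathbf t+[[q,\mathbf t],\mathbf x]=0,\\ &3\partial^2p+2\mathbf y\partial p-3(\partial q)\mathbf t p-3[q,\mathbf t]\partial p+3\mathbf t p r\mathbf t p-2(\mathbf y q\mathbf t-\mathbf t q\mathbf y)p+\mathbf x\mathbf t p=0,\\ &3\partial^2r-2(\partial r)\mathbf y-3r\mathbf t\,\partial q+3(\partial r)[q,\mathbf t]+3r\mathbf t p r\mathbf t-2r(\mathbf y q\mathbf t-\mathbf t q\mathbf y)+r\mathbf t\mathbf x=0. \end{aligned}$$ 2. At the points of $\mathcal U$ with $t_1=\dots=t_m=\tau$ they satisfy the reduced system $$\begin{aligned} &\partial_xq+pr=0,\\ &3\tau\partial_x^2p+2\mathbf y\partial_xp+6\tau prp-2[\mathbf y,q]p+\mathbf x p=0,\\ &3\tau\partial_x^2r-2(\partial_xr)\mathbf y+6\tau rpr-2r[\mathbf y,q]+r\mathbf x=0. \end{aligned}$$ 3. The reduced system is equivalent, after rescaling, to the Tracy–Widom system for the Airy$_2$ process. Precisely, let $\sigma>0$, $\tau=-\sigma/3$, $y\in\mathbb R^m$, let $q,p,r$ be any $C^2$ matrix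 functions (of the above sizes) on an open set $V\subset\mathbb R^m$, and put $\xi_k=\sigma^{-1/3}x_k+\sigma^{-4/3}y_k^2$, $E=\exp\big(\tfrac1\sigma\mathbf x\mathbf y+\tfrac{2}{3\sigma^2}\mathbf y^3\big)$. If $$p(x)=\mathrm i\sigma^{-1/3}E\,\mathsf P(\xi),\qquad r(x)=\mathrm i\sigma^{-1/3}\mathsf R(\xi)E^{-1},\qquad q(x)=-\sigma^{-1/3}E\,\mathsf Q(\xi)E^{-1}\qquad(x\in V),$$ then $q,p,r$ satisfy the reduced system for all $x\in V$ if and only if, with $\tilde{\mathbf y}=\sigma^{-2/3}\mathbf y$, $\boldsymbol\xi=\operatorname{diag}(\xi_j)$ and $\partial_\xi=\sum_k\partial_{\xi_k}$, $$\partial_\xi\mathsf Q=-[\tilde{\mathbf y},\mathsf Q]-\mathsf P\mathsf R,\qquad \partial_\xi^2\mathsf P=\boldsymbol\xi\mathsf P+2\mathsf P\mathsf R\mathsf P+2[\tilde{\mathbf y},\mathsf Q]\mathsf P,\qquad \partial_\xi^2\mathsf R=\mathsf R\boldsymbol\xi+2\mathsf R\mathsf P\mathsf R+2\mathsf R[\tilde{\mathbf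 y},\mathsf Q]$$ at $\xi=\xi(x)$ for all $x\in V$. -/

import Mathlib

open MeasureTheory Filter Topology
open scoped ENNReal

noncomputable section

/-- A continuous curve `γ : ℝ → ℂ` is a piecewise regular `C¹` curve: away from a locally finite set
of parameters it is `C¹` with non-zero velocity, and at the exceptional parameters the velocity has
non-zero one-sided limits. -/
def IsPiecewiseRegular (γ : ℝ → ℂ) : Prop :=
  Continuous γ ∧ ∃ S : Set ℝ,
    (∀ a b : ℝ, (S ∩ Set.Icc a b).Finite) ∧
    (∀ s, s ∉ S → ContDiffAt ℝ 1 γ s ∧ deriv γ s ≠ 0) ∧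
    (∀ s ∈ S, (∃ v : ℂ, v ≠ 0 ∧ Tendsto (deriv γ) (𝓝[<] s) (𝓝 v)) ∧
      (∃ w : ℂ, w ≠ 0 ∧ Tendsto (deriv γ) (𝓝[>] s) (𝓝 w)))

/-- An oriented simple contour without end points: either a closed (Jordan) contour, parametrized
by a `1`-periodic function that is injective on `[0, 1)`, or a contour that extends to infinity in
both directions, parametrized injectively by the real line. -/
structure SimpleContour where
  /-- the parametrization -/
  param : ℝ → ℂ
  /-- the parameter domain, over which the contour is traversed exactly once -/
  dom : Set ℝ
  regular : IsPiecewiseRegular param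
  closed_or_infinite :
    (dom = Set.Ico 0 1 ∧ Function.Periodic param 1 ∧ Set.InjOn param (Set.Ico 0 1)) ∨
    (dom = Set.univ ∧ Function.Injective param ∧ Tendsto param (cocompact ℝ) (cocompact ℂ))

namespace SimpleContour

/-- The contour as a subset of the plane. -/
def trace (γ : SimpleContour) : Set ℂ := γ.param '' γ.dom

/-- The arc length measure of the contour, as a measure on `ℂ`. -/
def arcLength (γ : SimpleContour) : Measure ℂ :=
  ((volume.restrict γ.dom).withDensity (fun s => ‖deriv γ.param s‖ₑ)).map γ.param

end SimpleContour

section Contours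

variable {ι : Type*}

/-- The union `Ω` of the contours. -/
def omega (Γ : ι → SimpleContour) : Set ℂ := ⋃ a, (Γ a).trace

/-- Distinct contours approach each other at infinity at most polynomially fast. -/
def SeparatedAtInfinity (Γ : ι → SimpleContour) : Prop :=
  ∃ κ : ℝ, 0 < κ ∧ ∃ N : ℕ, ∀ a b : ι, a ≠ b →
    ∀ u ∈ (Γ a).trace, ∀ v ∈ (Γ b).trace, κ ≤ ‖u - v‖ * (1 + ‖u‖) ^ N

variable [Fintype ι]

/-- The arc length measure `|dz|` on `Ω`. -/
def arcMeasure (Γ : ι → SimpleContour) : Measure ℂ := ∑ a, (Γ a).arcLength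

/-- The Hilbert space `L²(Ω, dz)`. -/
abbrev ContourL2 (Γ : ι → SimpleContour) : Type := Lp ℂ 2 (arcMeasure Γ)

/-- The complex line integral `∫_Ω φ(z) dz`. -/
def contourIntegral (Γ : ι → SimpleContour) (φ : ℂ → ℂ) : ℂ :=
  ∑ a, ∫ s in (Γ a).dom, φ ((Γ a).param s) * deriv (Γ a).param s

open Classical in
/-- The class in `L²(Ω, dz)` of a square integrable function. -/
def toL2 (Γ : ι → SimpleContour) (φ : ℂ → ℂ) : ContourL2 Γ :=
  if h : MemLp φ 2 (arcMeasure Γ) then h.toLp φ else 0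

end Contours

/-- The `3m` real parameters `(x, y, t)`. -/
abbrev Params (m : ℕ) : Type := (Fin m → ℝ) × (Fin m → ℝ) × (Fin m → ℝ)

/-- The diagonal entries of `Δ(z) = diag(e^{t₁z³+y₁z²+x₁z}, …, e^{t_mz³+y_mz²+x_mz}, 1)`; the index
`Sum.inr ()` stands for the last index `m + 1`. -/
def cubicDelta {m : ℕ} (P : Params m) (z : ℂ) : Fin m ⊕ Unit → ℂ :=
  Sum.elim
    (fun j => Complex.exp ((P.2.2 j : ℂ) * z ^ 3 + (P.2.1 j : ℂ) * z ^ 2 + (P.1 j : ℂ) * z))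
    (fun _ => 1)

/-- `f(u) = c(u) Δ(u) F(u)`. -/
def cubicF {m : ℕ} (F : ℂ → Fin m ⊕ Unit → ℂ) (c : ℂ → ℂ) (P : Params m) (u : ℂ) :
    Fin m ⊕ Unit → ℂ :=
  fun i => c u * cubicDelta P u i * F u i

/-- `g(u) = c(u)⁻¹ Δ(u)⁻¹ G(u)`. -/
def cubicG {m : ℕ} (G : ℂ → Fin m ⊕ Unit → ℂ) (c : ℂ → ℂ) (P : Params m) (u : ℂ) :
    Fin m ⊕ Unit → ℂ :=
  fun i => (c u)⁻¹ * (cubicDelta P u i)⁻¹ * G u i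

/-- The integrable kernel `f(u)ᵀ g(v) / (u - v)`, with value `0` on the diagonal. -/
def integrableKernel {n : Type*} [Fintype n] (f g : ℂ → n → ℂ) (u v : ℂ) : ℂ :=
  if u = v then 0 else (∑ i, f u i * g v i) / (u - v)

/-- The bounded operator `H` on `L²(Ω, dz)` is strongly cubic integrable at the parameters
`P = (x, y, t)`, with vector functions `F`, `G` and scalar function `c`. -/
structure IsStronglyCubicIntegrable {m : ℕ} {ι : Type*} [Fintype ι] (Γ : ι → SimpleContour)
    (F G : ℂ → Fin m ⊕ Unit → ℂ) (c : ℂ → ℂ) (P : Params m)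
    (H : ContourL2 Γ →L[ℂ] ContourL2 Γ) : Prop where
  /-- `F(u)ᵀ E_i G(u) = 0` -/
  mul_eq_zero : ∀ u ∈ omega Γ, ∀ i, F u i * G u i = 0
  const_on_components : ∀ u ∈ omega Γ, ∀ u' ∈ connectedComponentIn (omega Γ) u,
    F u' = F u ∧ G u' = G u
  c_ne_zero : ∀ u ∈ omega Γ, c u ≠ 0
  f_mem : ∀ i, MemLp (fun u => cubicF F c P u i) 2 (arcMeasure Γ) ∧
    MemLp (fun u => cubicF F c P u i) ∞ (arcMeasure Γ)
  g_mem : ∀ i, MemLp (fun u => cubicG G c P u i) 2 (arcMeasure Γ) ∧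
    MemLp (fun u => cubicG G c P u i) ∞ (arcMeasure Γ)
  /-- `H` is the integral operator with kernel `f(u)ᵀ g(v) / (u - v)` -/
  kernel : ∀ h : ContourL2 Γ, (H h : ℂ → ℂ) =ᵐ[arcMeasure Γ] fun u =>
    contourIntegral Γ (fun v => integrableKernel (cubicF F c P) (cubicG G c P) u v * h v)

/-- The matrix `Φ₁ = ∫_Ω ((1 - H)⁻¹ f)(s) g(s)ᵀ ds`. -/
def phiOne {m : ℕ} {ι : Type*} [Fintype ι] (Γ : ι → SimpleContour)
    (F G : ℂ → Fin m ⊕ Unit → ℂ) (c : ℂ → ℂ) (P : Params m)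
    (H : ContourL2 Γ →L[ℂ] ContourL2 Γ) : Matrix (Fin m ⊕ Unit) (Fin m ⊕ Unit) ℂ :=
  Matrix.of fun i j => contourIntegral Γ (fun s =>
    (Ring.inverse (1 - H) (toL2 Γ (fun u => cubicF F c P u i)) : ℂ → ℂ) s * cubicG G c P s j)

/-- The entrywise derivative `∑ₖ wₖ ∂_{x_k} A` of a matrix function `A` of `x ∈ ℝ^m`. -/
def matD {m : ℕ} {I J : Type*} (w : Fin m → ℝ) (A : (Fin m → ℝ) → Matrix I J ℂ)
    (x : Fin m → ℝ) : Matrix I J ℂ :=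
  Matrix.of fun i j =>
    ∑ k, (w k : ℂ) * lineDeriv ℝ (fun x' => A x' i j) x (Pi.single k 1)

/-- The diagonal matrix with real diagonal `w`. -/
def realDiag {m : ℕ} (w : Fin m → ℝ) : Matrix (Fin m) (Fin m) ℂ :=
  Matrix.diagonal (fun k => (w k : ℂ))

/-- The matrix ODE system for `q`, `p`, `r` at the point `x`, with `∂ = ∑ₖ tₖ ∂_{x_k}`. -/
def MatrixODESystem {m : ℕ} (y t : Fin m → ℝ)
    (q : (Fin m → ℝ) → Matrix (Fin m) (Fin m) ℂ) (p : (Fin m → ℝ) → Matrix (Fin m) Unit ℂ)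
    (r : (Fin m → ℝ) → Matrix Unit (Fin m) ℂ) (x : Fin m → ℝ) : Prop :=
  let T := realDiag t
  let Y := realDiag y
  let X := realDiag x
  let Q := q x
  let P := p x
  let R := r x
  let dQ := matD t q x
  let dP := matD t p x
  let dR := matD t r x
  let ddQ := matD t (matD t q) x
  let ddP := matD t (matD t p) x
  let ddR := matD t (matD t r) x
  ((3 : ℂ) • ddQ - (2 : ℂ) • ⁅dQ, Y⁆ - (3 : ℂ) • ⁅⁅Q, T⁆, dQ⁆ + (3 : ℂ) • (T * P * dR)
      + (3 : ℂ) • (dP * R * T) + (2 : ℂ) • ⁅⁅Q, T⁆, ⁅Q, Y⁆⁆ - (2 : ℂ) • (T * P * R * Y)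
      + (2 : ℂ) • (Y * P * R * T) + ⁅⁅Q, T⁆, X⁆ = 0) ∧
  ((3 : ℂ) • ddP + (2 : ℂ) • (Y * dP) - (3 : ℂ) • (dQ * T * P) - (3 : ℂ) • (⁅Q, T⁆ * dP)
      + (3 : ℂ) • (T * P * R * T * P) - (2 : ℂ) • ((Y * Q * T - T * Q * Y) * P)
      + X * T * P = 0) ∧
  ((3 : ℂ) • ddR - (2 : ℂ) • (dR * Y) - (3 : ℂ) • (R * T * dQ) + (3 : ℂ) • (dR * ⁅Q, T⁆)
      + (3 : ℂ) • (R * T * P * R * T) - (2 : ℂ) • (R * (Y * Q * T - T * Q * Y))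
      + R * T * X = 0)

/-- The reduced system for `t₁ = ⋯ = t_m = τ` at the point `x`, with `∂ₓ = ∑ₖ ∂_{x_k}`. -/
def ReducedODESystem {m : ℕ} (τ : ℝ) (y : Fin m → ℝ)
    (q : (Fin m → ℝ) → Matrix (Fin m) (Fin m) ℂ) (p : (Fin m → ℝ) → Matrix (Fin m) Unit ℂ)
    (r : (Fin m → ℝ) → Matrix Unit (Fin m) ℂ) (x : Fin m → ℝ) : Prop :=
  let Y := realDiag y
  let X := realDiag x
  let Q := q x
  let P := p x
  let R := r x
  let D := fun {I J : Type} (A : (Fin m → ℝ) → Matrix I J ℂ) => matD (fun _ => 1) A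
  (D q x + P * R = 0) ∧
  ((3 * τ : ℂ) • D (D p) x + (2 : ℂ) • (Y * D p x) + (6 * τ : ℂ) • (P * R * P)
      - (2 : ℂ) • (⁅Y, Q⁆ * P) + X * P = 0) ∧
  ((3 * τ : ℂ) • D (D r) x - (2 : ℂ) • (D r x * Y) + (6 * τ : ℂ) • (R * P * R)
      - (2 : ℂ) • (R * ⁅Y, Q⁆) + R * X = 0)

/-- The Tracy–Widom system for the Airy₂ process at the point `ξ`, with `∂_ξ = ∑ₖ ∂_{ξ_k}`. -/
def TracyWidomSystem {m : ℕ} (y : Fin m → ℝ)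
    (q : (Fin m → ℝ) → Matrix (Fin m) (Fin m) ℂ) (p : (Fin m → ℝ) → Matrix (Fin m) Unit ℂ)
    (r : (Fin m → ℝ) → Matrix Unit (Fin m) ℂ) (ξ : Fin m → ℝ) : Prop :=
  let Y := realDiag y
  let Ξ := realDiag ξ
  let Q := q ξ
  let P := p ξ
  let R := r ξ
  let D := fun {I J : Type} (A : (Fin m → ℝ) → Matrix I J ℂ) => matD (fun _ => 1) A
  (D q ξ = -⁅Y, Q⁆ - P * R) ∧
  (D (D p) ξ = Ξ * P + (2 : ℂ) • (P * R * P) + (2 : ℂ) • (⁅Y, Q⁆ * P)) ∧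
  (D (D r) ξ = R * Ξ + (2 : ℂ) • (R * P * R) + (2 : ℂ) • (R * ⁅Y, Q⁆))

/-- The change of variables `ξₖ = xₖ / σ^{1/3} + yₖ² / σ^{4/3}`. -/
def xiMap {m : ℕ} (σ : ℝ) (y x : Fin m → ℝ) : Fin m → ℝ :=
  fun k => x k / σ ^ (1 / 3 : ℝ) + y k ^ 2 / σ ^ (4 / 3 : ℝ)

/-- The diagonal matrix `exp(ε (𝐱𝐲/σ + 2𝐲³/(3σ²)))`, used with `ε = ±1`. -/
def gaugeExp {m : ℕ} (ε σ : ℝ) (y x : Fin m → ℝ) : Matrix (Fin m) (Fin m) ℂ :=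
  realDiag (fun k => Real.exp (ε * (x k * y k / σ + 2 * y k ^ 3 / (3 * σ ^ 2))))

/-- At the point `x`, the functions `q`, `p`, `r` of `x` arise from the functions `Q`, `P`, `R` of
`ξ` by the rescaling that turns the reduced system into the Tracy–Widom system. -/
def IsRescaling {m : ℕ} (σ : ℝ) (y : Fin m → ℝ)
    (q : (Fin m → ℝ) → Matrix (Fin m) (Fin m) ℂ) (p : (Fin m → ℝ) → Matrix (Fin m) Unit ℂ)
    (r : (Fin m → ℝ) → Matrix Unit (Fin m) ℂ)
    (Q : (Fin m → ℝ) → Matrix (Fin m) (Fin m) ℂ) (P : (Fin m → ℝ) → Matrix (Fin m) Unit ℂ)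
    (R : (Fin m → ℝ) → Matrix Unit (Fin m) ℂ) (x : Fin m → ℝ) : Prop :=
  let a : ℂ := ((σ ^ (-(1 / 3) : ℝ) : ℝ) : ℂ)
  p x = (Complex.I * a) • (gaugeExp 1 σ y x * P (xiMap σ y x)) ∧
  r x = (Complex.I * a) • (R (xiMap σ y x) * gaugeExp (-1) σ y x) ∧
  q x = (-a) • (gaugeExp 1 σ y x * Q (xiMap σ y x) * gaugeExp (-1) σ y x)

end

/-! ### Block algebra: eliminating the higher moments. -/

noncomputable section

/-! Since `F` and `G` are constant on each contour and `F_i G_i = 0`, the product `f(u)ᵀ g(v)`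
vanishes when `u` and `v` lie on the same contour. The kernel therefore couples different contours
only, and no singular integrals occur. Put `J = f gᵀ = Δ F Gᵀ Δ⁻¹`, in which `c` cancels, and let
`C` be the Cauchy integral over the contours other than the one carrying the point of evaluation.
Then `(1 - H)⁻¹ f = A f`, where the matrix function `A` solves `A = 1 + C(A J)`, and `Φ₁` is the
moment `U₀` in the sequence `Uₙ = ∫ zⁿ A J dz`. The equation for `A` is posed on bounded continuous
functions, with an operator that does not see `c` and is complex differentiable in `x`;
`exists_solution` and `isUnit_one_sub_kernelOp` transfer the invertibility of `1 - H` from `L²` to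
it.

Convergence rests on `exists_expDecaying`. As `U` is open in `(x, y)`, an off-diagonal entry of `J`
stays integrable and bounded after multiplication by `exp(± η z ± η z²)`, and this forces
exponential decay at infinity. The diagonal entries of `J` are zero.

The differential equations come from uniqueness for `α = C(α J)`, in the manner of a Lax pair. One
has `∂_{x_j} J = z [e_j, J]` and `dJ/dz = [3z² t + 2z y + x, J]`. The functions `linSol` and
`quadSol` are `z A` and `z² A`, corrected by integrals over the contour of the point; they solve the
integral equation with polynomial inhomogeneity. Combinations with the derivatives of `A` whose
inhomogeneous terms cancel must vanish. In this way `moment_derivative` obtains `∂_j Uₙ = [e_j,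
Uₙ₊₁] + [U₀, e_j] Uₙ`, and `moment_identity` an algebraic relation between `U₀`, `U₁`, `U₂`. The
first gives smoothness by bootstrapping. Together they allow `U₁` and `U₂` to be replaced by
derivatives of `U₀`, which leaves the systems for `q`, `p`, `r`.

The equivalence with the Tracy–Widom system is independent of all this: the gauge factor `E`
satisfies `∂ₓ E = σ⁻¹ 𝐲 E`, so conjugation by it completes a square and turns `𝐱` into a multiple of
`ξ`. -/

/-- The block matrix `diag(A, 0)`. -/
def padZero {m : ℕ} (A : Matrix (Fin m) (Fin m) ℂ) : Matrix (Fin m ⊕ Unit) (Fin m ⊕ Unit) ℂ :=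
  Matrix.fromBlocks A 0 0 0

theorem exists_eq_fromBlocks {m : ℕ} (U : Matrix (Fin m ⊕ Unit) (Fin m ⊕ Unit) ℂ) :
    ∃ (q : Matrix (Fin m) (Fin m) ℂ) (p : Matrix (Fin m) Unit ℂ) (r : Matrix Unit (Fin m) ℂ)
      (s : Matrix Unit Unit ℂ), U = Matrix.fromBlocks q p r s :=
  ⟨_, _, _, _, (Matrix.fromBlocks_toBlocks U).symm⟩

theorem fromBlocks_sub' {m : ℕ} (a a' : Matrix (Fin m) (Fin m) ℂ) (b b' : Matrix (Fin m) Unit ℂ)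
    (c c' : Matrix Unit (Fin m) ℂ) (d d' : Matrix Unit Unit ℂ) :
    Matrix.fromBlocks a b c d - Matrix.fromBlocks a' b' c' d'
      = Matrix.fromBlocks (a - a') (b - b') (c - c') (d - d') := by
  ext (i | i) (j | j) <;> rfl

/-- The identity that differentiation along the contours yields for the moments `U₀, U₁, U₂`. -/
def MomentIdentity {m : ℕ} (T Y X : Matrix (Fin m) (Fin m) ℂ)
    (U₀ U₁ U₂ : Matrix (Fin m ⊕ Unit) (Fin m ⊕ Unit) ℂ) : Prop :=
  (3 : ℂ) • ⁅U₂, padZero T⁆ + (2 : ℂ) • ⁅U₁, padZero Y⁆ + ⁅U₀, padZero X⁆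
    = (3 : ℂ) • (⁅U₀, padZero T⁆ * U₁) + (3 : ℂ) • (⁅U₁, padZero T⁆ * U₀)
      + (2 : ℂ) • (⁅U₀, padZero Y⁆ * U₀) - (3 : ℂ) • (⁅U₀, padZero T⁆ * U₀ * U₀)

/-- Applying `[T, ·]` to `[U₂, T]` produces the double commutator in which `U₂` enters `ddU₀`, and
`U₁` enters `dU₀` through `[T, U₁]`. The three equations are thus the 11 block of the moment
identity commuted with `T`, its 12 block multiplied by `T` from the left, and its 21 block
multiplied by `T` from the right. -/
theorem odeSystem_of_momentIdentity {m : ℕ} {T Y X : Matrix (Fin m) (Fin m) ℂ}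
    (hY : T * Y = Y * T) (hX : T * X = X * T)
    {U₀ U₁ U₂ dU₀ dU₁ ddU₀ : Matrix (Fin m ⊕ Unit) (Fin m ⊕ Unit) ℂ}
    (h₀ : dU₀ = ⁅padZero T, U₁⁆ + ⁅U₀, padZero T⁆ * U₀)
    (h₁ : dU₁ = ⁅padZero T, U₂⁆ + ⁅U₀, padZero T⁆ * U₁)
    (h₂ : ddU₀ = ⁅padZero T, dU₁⁆ + ⁅dU₀, padZero T⁆ * U₀ + ⁅U₀, padZero T⁆ * dU₀)
    (key : MomentIdentity T Y X U₀ U₁ U₂)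
    {Q dQ ddQ : Matrix (Fin m) (Fin m) ℂ} {P dP ddP : Matrix (Fin m) Unit ℂ}
    {R dR ddR : Matrix Unit (Fin m) ℂ}
    (hQ : Q = U₀.toBlocks₁₁) (hP : P = U₀.toBlocks₁₂) (hR : R = U₀.toBlocks₂₁)
    (hdQ : dQ = dU₀.toBlocks₁₁) (hdP : dP = dU₀.toBlocks₁₂) (hdR : dR = dU₀.toBlocks₂₁)
    (hddQ : ddQ = ddU₀.toBlocks₁₁) (hddP : ddP = ddU₀.toBlocks₁₂)
    (hddR : ddR = ddU₀.toBlocks₂₁) :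
    ((3 : ℂ) • ddQ - (2 : ℂ) • ⁅dQ, Y⁆ - (3 : ℂ) • ⁅⁅Q, T⁆, dQ⁆ + (3 : ℂ) • (T * P * dR)
      + (3 : ℂ) • (dP * R * T) + (2 : ℂ) • ⁅⁅Q, T⁆, ⁅Q, Y⁆⁆ - (2 : ℂ) • (T * P * R * Y)
      + (2 : ℂ) • (Y * P * R * T) + ⁅⁅Q, T⁆, X⁆ = 0) ∧
    ((3 : ℂ) • ddP + (2 : ℂ) • (Y * dP) - (3 : ℂ) • (dQ * T * P) - (3 : ℂ) • (⁅Q, T⁆ * dP)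
      + (3 : ℂ) • (T * P * R * T * P) - (2 : ℂ) • ((Y * Q * T - T * Q * Y) * P)
      + X * T * P = 0) ∧
    ((3 : ℂ) • ddR - (2 : ℂ) • (dR * Y) - (3 : ℂ) • (R * T * dQ) + (3 : ℂ) • (dR * ⁅Q, T⁆)
      + (3 : ℂ) • (R * T * P * R * T) - (2 : ℂ) • (R * (Y * Q * T - T * Q * Y))
      + R * T * X = 0) := by
  have hY' : ∀ {k : Type} (Z : Matrix (Fin m) k ℂ), T * (Y * Z) = Y * (T * Z) := fun Z => by
    rw [← Matrix.mul_assoc, hY, Matrix.mul_assoc]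
  have hX' : ∀ {k : Type} (Z : Matrix (Fin m) k ℂ), T * (X * Z) = X * (T * Z) := fun Z => by
    rw [← Matrix.mul_assoc, hX, Matrix.mul_assoc]
  subst h₂ h₁ h₀
  obtain ⟨q, p, r, s, rfl⟩ := exists_eq_fromBlocks U₀
  obtain ⟨a, b, c, d, rfl⟩ := exists_eq_fromBlocks U₁
  obtain ⟨α, β, γ, δ, rfl⟩ := exists_eq_fromBlocks U₂
  simp only [MomentIdentity, padZero, Ring.lie_def, Matrix.fromBlocks_multiply, fromBlocks_sub',
    Matrix.fromBlocks_add, Matrix.fromBlocks_smul, Matrix.fromBlocks_inj, Matrix.mul_zero,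
    Matrix.zero_mul, add_zero, zero_add, sub_zero, zero_sub, Matrix.toBlocks_fromBlocks₁₁,
    Matrix.toBlocks_fromBlocks₁₂, Matrix.toBlocks_fromBlocks₂₁] at *
  obtain ⟨k₁₁, k₁₂, k₂₁, -⟩ := key
  refine ⟨?_, ?_, ?_⟩
  · have k := (congrArg (fun Z => T * Z) k₁₁)
    have k' := (congrArg (fun Z => Z * T) k₁₁)
    rw [← sub_eq_zero.mpr (congrArg₂ (· - ·) k' k)]
    simp only [hQ, hP, hR, hdQ, hdP, hdR, hddQ, Matrix.mul_add, Matrix.add_mul,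
      Matrix.mul_sub, Matrix.sub_mul, Matrix.neg_mul, Matrix.mul_neg, Matrix.mul_assoc,
      Matrix.mul_smul, Matrix.smul_mul, hY, hX, hY', hX']
    module
  · have k := (congrArg (fun Z => T * Z) k₁₂)
    rw [← sub_eq_zero.mpr k.symm]
    simp only [hQ, hP, hR, hdQ, hdP, hddP, Matrix.mul_add, Matrix.add_mul,
      Matrix.mul_sub, Matrix.sub_mul, Matrix.neg_mul, Matrix.mul_neg, Matrix.mul_assoc,
      Matrix.mul_smul, hY', hX']
    module
  · have k := (congrArg (fun Z => Z * T) k₂₁)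
    rw [← sub_eq_zero.mpr k]
    simp only [hQ, hP, hR, hdQ, hdR, hddR, Matrix.mul_add, Matrix.add_mul,
      Matrix.mul_sub, Matrix.sub_mul, Matrix.neg_mul, Matrix.mul_neg, Matrix.mul_assoc,
      Matrix.smul_mul, hY, hX]
    module

/-- Here the derivative is taken in the direction `1` instead of `T`, so the 12 and 21 blocks of the
moment identity are used without a factor `T`, and `τ` need not be invertible. The first equation is
the 11 block of `h₀` alone, where `[1, U₁]` drops out. -/
theorem reducedSystem_of_momentIdentity {m : ℕ} {Y X : Matrix (Fin m) (Fin m) ℂ} (τ : ℂ)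
    {U₀ U₁ U₂ dU₀ dU₁ ddU₀ : Matrix (Fin m ⊕ Unit) (Fin m ⊕ Unit) ℂ}
    (h₀ : dU₀ = ⁅padZero (m := m) 1, U₁⁆ + ⁅U₀, padZero (m := m) 1⁆ * U₀)
    (h₁ : dU₁ = ⁅padZero (m := m) 1, U₂⁆ + ⁅U₀, padZero (m := m) 1⁆ * U₁)
    (h₂ : ddU₀ = ⁅padZero (m := m) 1, dU₁⁆ + ⁅dU₀, padZero (m := m) 1⁆ * U₀ + ⁅U₀, padZero (m := m) 1⁆ * dU₀)
    (key : MomentIdentity (τ • 1) Y X U₀ U₁ U₂)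
    {Q dQ : Matrix (Fin m) (Fin m) ℂ} {P dP ddP : Matrix (Fin m) Unit ℂ}
    {R dR ddR : Matrix Unit (Fin m) ℂ}
    (hQ : Q = U₀.toBlocks₁₁) (hP : P = U₀.toBlocks₁₂) (hR : R = U₀.toBlocks₂₁)
    (hdQ : dQ = dU₀.toBlocks₁₁) (hdP : dP = dU₀.toBlocks₁₂) (hdR : dR = dU₀.toBlocks₂₁)
    (hddP : ddP = ddU₀.toBlocks₁₂) (hddR : ddR = ddU₀.toBlocks₂₁) :
    (dQ + P * R = 0) ∧
    ((3 * τ : ℂ) • ddP + (2 : ℂ) • (Y * dP) + (6 * τ : ℂ) • (P * R * P)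
      - (2 : ℂ) • (⁅Y, Q⁆ * P) + X * P = 0) ∧
    ((3 * τ : ℂ) • ddR - (2 : ℂ) • (dR * Y) + (6 * τ : ℂ) • (R * P * R)
      - (2 : ℂ) • (R * ⁅Y, Q⁆) + R * X = 0) := by
  subst h₂ h₁ h₀
  obtain ⟨q, p, r, s, rfl⟩ := exists_eq_fromBlocks U₀
  obtain ⟨a, b, c, d, rfl⟩ := exists_eq_fromBlocks U₁
  obtain ⟨α, β, γ, δ, rfl⟩ := exists_eq_fromBlocks U₂
  simp only [MomentIdentity, padZero, Ring.lie_def, Matrix.fromBlocks_multiply, fromBlocks_sub',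
    Matrix.fromBlocks_add, Matrix.fromBlocks_smul, Matrix.fromBlocks_inj, Matrix.mul_zero,
    Matrix.zero_mul, add_zero, zero_add, sub_zero, zero_sub, Matrix.toBlocks_fromBlocks₁₁,
    Matrix.toBlocks_fromBlocks₁₂, Matrix.toBlocks_fromBlocks₂₁, Matrix.one_mul, Matrix.mul_one,
    Matrix.smul_mul, Matrix.mul_smul, sub_self] at *
  obtain ⟨-, k₁₂, k₂₁, -⟩ := key
  refine ⟨?_, ?_, ?_⟩
  · simp [hP, hR, hdQ]
  · rw [← sub_eq_zero.mpr k₁₂.symm]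
    simp only [hQ, hP, hR, hdP, hddP, Matrix.mul_add, Matrix.add_mul,
      Matrix.sub_mul, Matrix.neg_mul, Matrix.mul_neg, Matrix.mul_assoc,
      Matrix.smul_mul]
    module
  · rw [← sub_eq_zero.mpr k₂₁]
    simp only [hQ, hP, hR, hdR, hddR, Matrix.add_mul,
      Matrix.mul_sub, Matrix.neg_mul, Matrix.mul_neg, Matrix.mul_assoc]
    module
end

/-! ### Calculus along a single contour. -/

noncomputable section

namespace SimpleContour

variable (γ : SimpleContour)

theorem continuous_param : Continuous γ.param := γ.regular.1

theorem measurableSet_dom : MeasurableSet γ.dom := by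
  rcases γ.closed_or_infinite with ⟨h, -⟩ | ⟨h, -⟩ <;> rw [h]
  exacts [measurableSet_Ico, MeasurableSet.univ]

theorem injOn_param : Set.InjOn γ.param γ.dom := by
  rcases γ.closed_or_infinite with ⟨h, -, hi⟩ | ⟨h, hi, -⟩ <;> rw [h]
  exacts [hi, hi.injOn]

theorem param_mem_trace (s : ℝ) : γ.param s ∈ γ.trace := by
  rcases γ.closed_or_infinite with ⟨h, hp, -⟩ | ⟨h, -⟩
  · refine ⟨Int.fract s, ?_, ?_⟩
    · rw [h]
      exact ⟨Int.fract_nonneg s, Int.fract_lt_one s⟩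
    · have := hp.sub_zsmul_eq (x := s) ⌊s⌋
      rwa [zsmul_one] at this
  · exact ⟨s, by rw [h]; trivial, rfl⟩

theorem trace_eq_range : γ.trace = Set.range γ.param :=
  Set.Subset.antisymm (Set.image_subset_range _ _)
    (Set.range_subset_iff.2 γ.param_mem_trace)

theorem isPreconnected_trace : IsPreconnected γ.trace := by
  rw [trace_eq_range]
  exact isPreconnected_range γ.continuous_param

theorem exists_countable_differentiableAt : ∃ S : Set ℝ, S.Countable ∧
    ∀ s ∉ S, DifferentiableAt ℝ γ.param s ∧ deriv γ.param s ≠ 0 := by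
  obtain ⟨-, S, hfin, hreg, -⟩ := γ.regular
  refine ⟨S, ?_, fun s hs => ⟨(hreg s hs).1.differentiableAt one_ne_zero, (hreg s hs).2⟩⟩
  have hS : S = ⋃ n : ℕ, S ∩ Set.Icc (-n : ℝ) n := by
    rw [← Set.inter_iUnion, eq_comm, Set.inter_eq_left]
    intro s _
    obtain ⟨n, hn⟩ := exists_nat_ge |s|
    exact Set.mem_iUnion.2 ⟨n, abs_le.1 hn⟩
  rw [hS]
  exact Set.countable_iUnion fun n => (hfin _ _).countable

theorem ae_deriv_ne_zero : ∀ᵐ s : ℝ, deriv γ.param s ≠ 0 := by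
  obtain ⟨S, hS, h⟩ := γ.exists_countable_differentiableAt
  filter_upwards [hS.ae_notMem volume] with s hs using (h s hs).2

theorem tendsto_cocompact_of_dom_eq_univ (h : γ.dom = Set.univ) :
    Tendsto γ.param (cocompact ℝ) (cocompact ℂ) := by
  rcases γ.closed_or_infinite with ⟨h', -⟩ | ⟨-, -, hp⟩
  · have : (2 : ℝ) ∈ Set.Ico (0 : ℝ) 1 := by rw [← h', h]; trivial
    norm_num at this
  · exact hp

/-- The density `|γ'|` of arc length is non-zero almost everywhere, so null sets for arc length pull
back to null sets of parameters. -/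
theorem ae_of_ae_arcLength {P : ℂ → Prop} (h : ∀ᵐ u ∂γ.arcLength, P u) :
    ∀ᵐ s ∂volume.restrict γ.dom, P (γ.param s) := by
  have h1 := ae_of_ae_map γ.continuous_param.measurable.aemeasurable h
  rw [ae_withDensity_iff (measurable_deriv _).enorm] at h1
  filter_upwards [h1, ae_restrict_of_ae γ.ae_deriv_ne_zero] with s hs hs'
  exact hs (by simpa using hs')

/-- The form `dz` is arc length times the unit tangent `γ' / |γ'|`, a bounded measurable factor. -/
theorem integrableOn_of_integrable_arcLength {E : Type*} [NormedAddCommGroup E] [NormedSpace ℂ E]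
    {φ : ℂ → E} (h : Integrable φ γ.arcLength) :
    IntegrableOn (fun s => deriv γ.param s • φ (γ.param s)) γ.dom := by
  have hm : Measurable fun s => ‖deriv γ.param s‖ₑ := (measurable_deriv _).enorm
  have h1 := h.comp_aemeasurable γ.continuous_param.measurable.aemeasurable
  rw [integrable_withDensity_iff_integrable_smul' hm
    (ae_of_all _ fun s => enorm_lt_top)] at h1
  simp only [toReal_enorm, Function.comp_apply] at h1
  have hm' := h1.aestronglyMeasurable
  refine h1.norm.mono' ?_ (ae_of_all _ fun s => by simp [norm_smul])
  have hq : Measurable fun s => deriv γ.param s * ((‖deriv γ.param s‖⁻¹ : ℝ) : ℂ) := by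
    have := measurable_deriv γ.param
    fun_prop
  refine (hq.aestronglyMeasurable.smul hm').congr (ae_of_all _ fun s => ?_)
  by_cases h0 : deriv γ.param s = 0
  · simp [h0]
  · have h2 : ‖deriv γ.param s‖ ≠ 0 := norm_ne_zero_iff.2 h0
    have h3 : (‖deriv γ.param s‖ • φ (γ.param s)) =
      ((‖deriv γ.param s‖ : ℝ) : ℂ) • φ (γ.param s) := (Complex.coe_smul _ _).symm
    change (deriv γ.param s * ((‖deriv γ.param s‖⁻¹ : ℝ) : ℂ)) •
      (‖deriv γ.param s‖ • φ (γ.param s)) = _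
    rw [h3, smul_smul, mul_assoc, ← Complex.ofReal_mul, inv_mul_cancel₀ h2]
    simp

/-- The fundamental theorem of calculus along a contour without end points. -/
theorem integral_deriv_eq_zero {E : Type*} [NormedAddCommGroup E] [NormedSpace ℂ E]
    [CompleteSpace E] {Φ Φ' : ℂ → E}
    (hd : ∀ s, HasDerivAt Φ (Φ' (γ.param s)) (γ.param s))
    (hi : IntegrableOn (fun s => deriv γ.param s • Φ' (γ.param s)) γ.dom)
    (hlim : γ.dom = Set.univ →
      Tendsto (fun s => Φ (γ.param s)) (cocompact ℝ) (𝓝 0)) :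
    ∫ s in γ.dom, deriv γ.param s • Φ' (γ.param s) = 0 := by
  obtain ⟨S, hS, hreg⟩ := γ.exists_countable_differentiableAt
  have hcont : Continuous fun s => Φ (γ.param s) := continuous_iff_continuousAt.2 fun s =>
    (hd s).continuousAt.comp γ.continuous_param.continuousAt
  -- The corners form a countable set, which the fundamental theorem of calculus tolerates because
  -- `Φ ∘ γ` is continuous.
  have hder : ∀ s ∉ S, HasDerivAt (fun s => Φ (γ.param s))
      (deriv γ.param s • Φ' (γ.param s)) s := fun s hs =>
    (hd s).scomp s (hreg s hs).1.hasDerivAt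
  have hftc : ∀ a b : ℝ, IntervalIntegrable (fun s => deriv γ.param s • Φ' (γ.param s))
      volume a b → ∫ s in a..b, deriv γ.param s • Φ' (γ.param s)
        = Φ (γ.param b) - Φ (γ.param a) := fun a b hab =>
    integral_eq_of_hasDerivAt_off_countable (fun s => Φ (γ.param s)) _ hS hcont.continuousOn
      (fun s hs => hder s hs.2) hab
  rcases γ.closed_or_infinite with ⟨h, hp, -⟩ | ⟨h, -, -⟩
  -- Closed contour: the boundary values at the parameters `0` and `1` agree by periodicity.
  · rw [h] at hi ⊢
    have hii : IntervalIntegrable (fun s => deriv γ.param s • Φ' (γ.param s)) volume 0 1 :=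
      (intervalIntegrable_iff_integrableOn_Ico_of_le zero_le_one).2 hi
    rw [integral_Ico_eq_integral_Ioc, ← intervalIntegral.integral_of_le zero_le_one,
      hftc 0 1 hii, ← zero_add (1 : ℝ), hp 0, sub_self]
  · have h2 := hlim h
    rw [h] at hi ⊢
    rw [integrableOn_univ] at hi
    rw [Measure.restrict_univ]
    -- Infinite contour: exhaust the line by `[-n, n]`; both boundary terms tend to zero by `hlim`.
    have h1 := intervalIntegral_tendsto_integral (l := atTop) (a := fun n : ℝ => -n)
      (b := fun n : ℝ => n) hi tendsto_neg_atTop_atBot tendsto_id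
    rw [cocompact_eq_atBot_atTop, tendsto_sup] at h2
    refine tendsto_nhds_unique h1 ?_
    simp_rw [fun n : ℝ => hftc (-n) n hi.intervalIntegrable]
    simpa using h2.2.sub (h2.1.comp tendsto_neg_atTop_atBot)

end SimpleContour

/-! ### Rapidly integrable functions on a family of contours. -/

section Contours

variable {ι : Type*}

theorem trace_subset_omega (Γ : ι → SimpleContour) (a : ι) : (Γ a).trace ⊆ omega Γ :=
  Set.subset_iUnion (fun a => (Γ a).trace) a

/-- The parameter space of a family of contours. -/
abbrev ContourPts (ι : Type*) : Type _ := Σ _ : ι, ℝ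

/-- The point of the plane with a given parameter. -/
def contourPt (Γ : ι → SimpleContour) (q : ContourPts ι) : ℂ := (Γ q.1).param q.2

@[fun_prop]
theorem continuous_contourPt (Γ : ι → SimpleContour) : Continuous (contourPt Γ) :=
  continuous_sigma fun a => (Γ a).continuous_param

variable {E E' : Type*} [NormedAddCommGroup E] [NormedSpace ℂ E] [NormedAddCommGroup E']
  [NormedSpace ℂ E']

/-- The integral of a function of the parameter along one of the contours. -/
def pathInt (Γ : ι → SimpleContour) (a : ι) (φ : ContourPts ι → E) : E :=
  ∫ s in (Γ a).dom, deriv (Γ a).param s • φ ⟨a, s⟩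

/-- The integral of a function of the parameter along all contours. -/
def totalInt [Fintype ι] (Γ : ι → SimpleContour) (φ : ContourPts ι → E) : E := ∑ a, pathInt Γ a φ

/-- All products with powers of `z` are integrable along the contours. -/
def RapidlyIntegrable (Γ : ι → SimpleContour) (φ : ContourPts ι → E) : Prop :=
  ∀ (n : ℕ) (a : ι), IntegrableOn
    (fun s => (Γ a).param s ^ n • deriv (Γ a).param s • φ ⟨a, s⟩) (Γ a).dom

theorem one_add_pow_le (N : ℕ) {r : ℝ} (hr : 0 ≤ r) : (1 + r) ^ N ≤ 2 ^ N * (1 + r ^ N) := by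
  rcases le_total r 1 with h | h
  · calc (1 + r) ^ N ≤ 2 ^ N := by gcongr; linarith
      _ ≤ 2 ^ N * (1 + r ^ N) := le_mul_of_one_le_right (by positivity) (by simp; positivity)
  · calc (1 + r) ^ N ≤ (2 * r) ^ N := by gcongr; linarith
      _ = 2 ^ N * r ^ N := mul_pow _ _ _
      _ ≤ 2 ^ N * (1 + r ^ N) := by gcongr; linarith

namespace RapidlyIntegrable

variable {Γ : ι → SimpleContour} {φ ψ : ContourPts ι → E}

theorem integrableOn (h : RapidlyIntegrable Γ φ) (a : ι) :
    IntegrableOn (fun s => deriv (Γ a).param s • φ ⟨a, s⟩) (Γ a).dom := by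
  simpa using h 0 a

theorem zero : RapidlyIntegrable Γ (fun _ => (0 : E)) := fun n a => by
  simp

theorem add (h : RapidlyIntegrable Γ φ) (h' : RapidlyIntegrable Γ ψ) :
    RapidlyIntegrable Γ (fun q => φ q + ψ q) := fun n a => by
  simp only [smul_add]
  exact (h n a).add (h' n a)

theorem sub (h : RapidlyIntegrable Γ φ) (h' : RapidlyIntegrable Γ ψ) :
    RapidlyIntegrable Γ (fun q => φ q - ψ q) := fun n a => by
  simp only [smul_sub]
  exact (h n a).sub (h' n a)

theorem sum {κ : Type*} (S : Finset κ) {φ : κ → ContourPts ι → E}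
    (h : ∀ k ∈ S, RapidlyIntegrable Γ (φ k)) :
    RapidlyIntegrable Γ (fun q => ∑ k ∈ S, φ k q) := fun n a => by
  simp only [Finset.smul_sum]
  exact integrable_finsetSum S fun k hk => h k hk n a

theorem const_smul (h : RapidlyIntegrable Γ φ) (c : ℂ) :
    RapidlyIntegrable Γ (fun q => c • φ q) := fun n a => by
  refine (Integrable.smul c (h n a)).congr (ae_of_all _ fun s => ?_)
  simp only [Pi.smul_apply, smul_smul]
  ring_nf

theorem pt_smul (h : RapidlyIntegrable Γ φ) :
    RapidlyIntegrable Γ (fun q => contourPt Γ q • φ q) := fun n a => by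
  refine (h (n + 1) a).congr (ae_of_all _ fun s => ?_)
  simp only [contourPt, smul_smul]
  ring_nf

theorem integrableOn_weight (h : RapidlyIntegrable Γ φ) (N : ℕ) (a : ι) :
    IntegrableOn (fun s => (1 + ‖(Γ a).param s‖) ^ N * ‖deriv (Γ a).param s • φ ⟨a, s⟩‖)
      (Γ a).dom := by
  refine Integrable.mono' (g := fun s => 2 ^ N * (‖deriv (Γ a).param s • φ ⟨a, s⟩‖ +
    ‖(Γ a).param s ^ N • deriv (Γ a).param s • φ ⟨a, s⟩‖)) ?_ ?_ (ae_of_all _ fun s => ?_)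
  · exact ((h.integrableOn a).norm.add (h N a).norm).const_mul _
  · refine AEStronglyMeasurable.mul ?_ (h.integrableOn a).aestronglyMeasurable.norm
    have := (Γ a).continuous_param
    exact Continuous.aestronglyMeasurable (by fun_prop)
  · rw [Real.norm_of_nonneg (by positivity), norm_smul ((Γ a).param s ^ N), norm_pow]
    have := one_add_pow_le N (norm_nonneg ((Γ a).param s))
    calc _ ≤ 2 ^ N * (1 + ‖(Γ a).param s‖ ^ N) * ‖deriv (Γ a).param s • φ ⟨a, s⟩‖ := by gcongr
      _ = _ := by ring

/-- Since every polynomial weight is allowed, the class is closed under domination up to a factor of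
polynomial growth. -/
theorem of_norm_le_weight {N : ℕ} {C : ℝ} (h : RapidlyIntegrable Γ φ) {ψ : ContourPts ι → E'}
    (hm : ∀ a, AEStronglyMeasurable (fun s => deriv (Γ a).param s • ψ ⟨a, s⟩)
      (volume.restrict (Γ a).dom))
    (hle : ∀ q, ‖ψ q‖ ≤ C * (1 + ‖contourPt Γ q‖) ^ N * ‖φ q‖) : RapidlyIntegrable Γ ψ := by
  intro n a
  have hc := (Γ a).continuous_param
  refine Integrable.mono' ((h.integrableOn_weight (n + N) a).const_mul C) ?_
    (ae_of_all _ fun s => ?_)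
  · exact AEStronglyMeasurable.smul (Continuous.aestronglyMeasurable (by fun_prop)) (hm a)
  · have h1 := hle ⟨a, s⟩
    simp only [contourPt] at h1
    have h2 : ‖(Γ a).param s‖ ^ n ≤ (1 + ‖(Γ a).param s‖) ^ n := by gcongr; linarith
    rw [norm_smul, norm_smul, norm_smul, norm_pow]
    calc _ ≤ (1 + ‖(Γ a).param s‖) ^ n * (‖deriv (Γ a).param s‖ *
          (C * (1 + ‖(Γ a).param s‖) ^ N * ‖φ ⟨a, s⟩‖)) := by gcongr
      _ = _ := by rw [pow_add]; ring

end RapidlyIntegrable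

section algebraRapid

variable {𝔸 : Type*} [NormedRing 𝔸] [NormedAlgebra ℂ 𝔸] {Γ : ι → SimpleContour}
  {φ : ContourPts ι → 𝔸}

theorem RapidlyIntegrable.mul_left_of_le (h : RapidlyIntegrable Γ φ) {α : ContourPts ι → 𝔸}
    (hα : Continuous α) {C : ℝ} {N : ℕ} (hle : ∀ q, ‖α q‖ ≤ C * (1 + ‖contourPt Γ q‖) ^ N) :
    RapidlyIntegrable Γ (fun q => α q * φ q) := by
  refine h.of_norm_le_weight (C := C) (N := N) (fun a => ?_) fun q => ?_
  · refine (AEStronglyMeasurable.mul (f := fun s => α ⟨a, s⟩)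
      (hα.comp continuous_sigmaMk).aestronglyMeasurable
      (h.integrableOn a).aestronglyMeasurable).congr (ae_of_all _ fun s => ?_)
    simp
  · exact (norm_mul_le _ _).trans (by gcongr; exact hle q)

theorem RapidlyIntegrable.const_mul (h : RapidlyIntegrable Γ φ) (c : 𝔸) :
    RapidlyIntegrable Γ (fun q => c * φ q) :=
  h.mul_left_of_le (C := ‖c‖) (N := 0) continuous_const fun q => by simp

theorem RapidlyIntegrable.mul_const (h : RapidlyIntegrable Γ φ) (c : 𝔸) :
    RapidlyIntegrable Γ (fun q => φ q * c) := fun n a => by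
  refine (Integrable.mul_const (h n a) c).congr (ae_of_all _ fun s => ?_)
  simp

end algebraRapid

end Contours
end

/-! ### Integral operators with kernels of polynomial growth. -/

noncomputable section

section Kernels

open scoped BoundedContinuousFunction

variable {ι : Type*} {Γ : ι → SimpleContour}
  {E : Type*} [NormedAddCommGroup E] [NormedSpace ℂ E]
  {𝔸 : Type*} [NormedRing 𝔸] [NormedAlgebra ℂ 𝔸]
  {X : Type*} [TopologicalSpace X]

theorem pathInt_congr_ae {φ ψ : ContourPts ι → E} {a : ι}
    (h : ∀ᵐ s ∂volume.restrict (Γ a).dom, φ ⟨a, s⟩ = ψ ⟨a, s⟩) :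
    pathInt Γ a φ = pathInt Γ a ψ :=
  integral_congr_ae (h.mono fun s hs => by simp only [hs])

theorem pathInt_add {φ ψ : ContourPts ι → E} (h : RapidlyIntegrable Γ φ)
    (h' : RapidlyIntegrable Γ ψ) (a : ι) :
    pathInt Γ a (fun q => φ q + ψ q) = pathInt Γ a φ + pathInt Γ a ψ := by
  simp only [pathInt, smul_add]
  exact integral_add (h.integrableOn a) (h'.integrableOn a)

theorem pathInt_sub {φ ψ : ContourPts ι → E} (h : RapidlyIntegrable Γ φ)
    (h' : RapidlyIntegrable Γ ψ) (a : ι) :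
    pathInt Γ a (fun q => φ q - ψ q) = pathInt Γ a φ - pathInt Γ a ψ := by
  simp only [pathInt, smul_sub]
  exact integral_sub (h.integrableOn a) (h'.integrableOn a)

theorem pathInt_const_smul (φ : ContourPts ι → E) (c : ℂ) (a : ι) :
    pathInt Γ a (fun q => c • φ q) = c • pathInt Γ a φ := by
  simp only [pathInt, ← integral_smul, smul_smul, mul_comm c]

theorem pathInt_const_mul [CompleteSpace 𝔸] {φ : ContourPts ι → 𝔸} (h : RapidlyIntegrable Γ φ)
    (c : 𝔸) (a : ι) : pathInt Γ a (fun q => c * φ q) = c * pathInt Γ a φ := by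
  simp only [pathInt]
  rw [← integral_const_mul_of_integrable (h.integrableOn a)]
  simp_rw [mul_smul_comm]

theorem pathInt_mul_const [CompleteSpace 𝔸] {φ : ContourPts ι → 𝔸} (h : RapidlyIntegrable Γ φ)
    (c : 𝔸) (a : ι) : pathInt Γ a (fun q => φ q * c) = pathInt Γ a φ * c := by
  simp only [pathInt, ← smul_mul_assoc]
  exact integral_mul_const_of_integrable (h.integrableOn a)

section total

variable [Fintype ι]

theorem totalInt_congr_ae {φ ψ : ContourPts ι → E}
    (h : ∀ a, ∀ᵐ s ∂volume.restrict (Γ a).dom, φ ⟨a, s⟩ = ψ ⟨a, s⟩) :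
    totalInt Γ φ = totalInt Γ ψ :=
  Finset.sum_congr rfl fun a _ => pathInt_congr_ae (h a)

theorem totalInt_add {φ ψ : ContourPts ι → E} (h : RapidlyIntegrable Γ φ)
    (h' : RapidlyIntegrable Γ ψ) :
    totalInt Γ (fun q => φ q + ψ q) = totalInt Γ φ + totalInt Γ ψ := by
  simp only [totalInt, pathInt_add h h', Finset.sum_add_distrib]

theorem totalInt_sub {φ ψ : ContourPts ι → E} (h : RapidlyIntegrable Γ φ)
    (h' : RapidlyIntegrable Γ ψ) :
    totalInt Γ (fun q => φ q - ψ q) = totalInt Γ φ - totalInt Γ ψ := by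
  simp only [totalInt, pathInt_sub h h', Finset.sum_sub_distrib]

theorem totalInt_const_smul (φ : ContourPts ι → E) (c : ℂ) :
    totalInt Γ (fun q => c • φ q) = c • totalInt Γ φ := by
  simp only [totalInt, pathInt_const_smul, Finset.smul_sum]

theorem totalInt_const_mul [CompleteSpace 𝔸] {φ : ContourPts ι → 𝔸} (h : RapidlyIntegrable Γ φ)
    (c : 𝔸) : totalInt Γ (fun q => c * φ q) = c * totalInt Γ φ := by
  simp only [totalInt, pathInt_const_mul h, Finset.mul_sum]

theorem totalInt_mul_const [CompleteSpace 𝔸] {φ : ContourPts ι → 𝔸} (h : RapidlyIntegrable Γ φ)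
    (c : 𝔸) : totalInt Γ (fun q => φ q * c) = totalInt Γ φ * c := by
  simp only [totalInt, pathInt_mul_const h, Finset.sum_mul]

/-- A weighted `L¹` norm along the contours. -/
def weightNorm (Γ : ι → SimpleContour) (N : ℕ) (φ : ContourPts ι → E) : ℝ :=
  ∑ a, ∫ s in (Γ a).dom, (1 + ‖(Γ a).param s‖) ^ N * ‖deriv (Γ a).param s • φ ⟨a, s⟩‖

theorem weightNorm_nonneg (Γ : ι → SimpleContour) (N : ℕ) (φ : ContourPts ι → E) :
    0 ≤ weightNorm Γ N φ :=
  Finset.sum_nonneg fun _ _ => integral_nonneg fun _ => by positivity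

theorem weightNorm_le_of_norm_le {F : Type*} [NormedAddCommGroup F] [NormedSpace ℂ F] {N : ℕ}
    {φ : ContourPts ι → E} {ψ : ContourPts ι → F} {c : ℝ} (h : RapidlyIntegrable Γ ψ)
    (hle : ∀ q, ‖φ q‖ ≤ c * ‖ψ q‖) : weightNorm Γ N φ ≤ c * weightNorm Γ N ψ := by
  rw [weightNorm, weightNorm, Finset.mul_sum]
  refine Finset.sum_le_sum fun a _ => ?_
  rw [← integral_const_mul]
  refine integral_mono_of_nonneg (ae_of_all _ fun s => by positivity)
    ((h.integrableOn_weight N a).const_mul c) (ae_of_all _ fun s => ?_)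
  simp only [norm_smul]
  calc _ ≤ (1 + ‖(Γ a).param s‖) ^ N * (‖deriv (Γ a).param s‖ * (c * ‖ψ ⟨a, s⟩‖)) := by
        gcongr; exact hle _
    _ = _ := by ring

end total

/-- Scalar kernels of polynomial growth in the variable of integration. -/
structure IsModerateKernel (Γ : ι → SimpleContour) (C : ℝ) (N : ℕ)
    (k : X → ContourPts ι → ℂ) : Prop where
  nonneg : 0 ≤ C
  continuous_left : ∀ q, Continuous fun x => k x q
  continuous_right : ∀ x, Continuous (k x)
  norm_le : ∀ x q, ‖k x q‖ ≤ C * (1 + ‖contourPt Γ q‖) ^ N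

namespace IsModerateKernel

variable {C C' : ℝ} {N N' : ℕ} {k k' : X → ContourPts ι → ℂ}

theorem mul (hk : IsModerateKernel Γ C N k) (hk' : IsModerateKernel Γ C' N' k') :
    IsModerateKernel Γ (C * C') (N + N') (fun x q => k x q * k' x q) where
  nonneg := mul_nonneg hk.nonneg hk'.nonneg
  continuous_left q := (hk.continuous_left q).mul (hk'.continuous_left q)
  continuous_right x := (hk.continuous_right x).mul (hk'.continuous_right x)
  norm_le x q := by
    have h := hk.nonneg
    have h' := hk'.nonneg
    rw [norm_mul]
    calc _ ≤ (C * (1 + ‖contourPt Γ q‖) ^ N) * (C' * (1 + ‖contourPt Γ q‖) ^ N') := by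
          gcongr; exacts [hk.norm_le x q, hk'.norm_le x q]
      _ = _ := by rw [pow_add]; ring

variable {φ : ContourPts ι → E}

theorem rapidlyIntegrable_smul (hk : IsModerateKernel Γ C N k) (hφ : RapidlyIntegrable Γ φ)
    (x : X) : RapidlyIntegrable Γ (fun q => k x q • φ q) := by
  refine hφ.of_norm_le_weight (C := C) (N := N) (fun a => ?_) fun q => ?_
  · refine (AEStronglyMeasurable.smul (f := fun s => k x ⟨a, s⟩)
      ((hk.continuous_right x).comp continuous_sigmaMk).aestronglyMeasurable
      (hφ.integrableOn a).aestronglyMeasurable).congr (ae_of_all _ fun s => ?_)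
    exact smul_comm _ _ _
  · rw [norm_smul]
    gcongr
    exact hk.norm_le x q

theorem norm_deriv_smul_le (hk : IsModerateKernel Γ C N k) (φ : ContourPts ι → E) (x : X) (a : ι)
    (s : ℝ) : ‖deriv (Γ a).param s • k x ⟨a, s⟩ • φ ⟨a, s⟩‖
      ≤ C * ((1 + ‖(Γ a).param s‖) ^ N * ‖deriv (Γ a).param s • φ ⟨a, s⟩‖) := by
  rw [smul_comm, norm_smul, ← mul_assoc]
  gcongr
  exact hk.norm_le x ⟨a, s⟩

variable [Fintype ι]

theorem norm_totalInt_le (hk : IsModerateKernel Γ C N k) (hφ : RapidlyIntegrable Γ φ) (x : X) :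
    ‖totalInt Γ (fun q => k x q • φ q)‖ ≤ C * weightNorm Γ N φ := by
  rw [weightNorm, Finset.mul_sum]
  refine (norm_sum_le _ _).trans (Finset.sum_le_sum fun a _ => ?_)
  rw [← integral_const_mul]
  exact norm_integral_le_of_norm_le ((hφ.integrableOn_weight N a).const_mul C)
    (ae_of_all _ fun s => hk.norm_deriv_smul_le φ x a s)

variable [FirstCountableTopology X]

theorem continuous_totalInt (hk : IsModerateKernel Γ C N k) (hφ : RapidlyIntegrable Γ φ) :
    Continuous fun x => totalInt Γ (fun q => k x q • φ q) := by
  refine continuous_finsetSum _ fun a _ => ?_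
  refine continuous_of_dominated (fun x =>
    ((hk.rapidlyIntegrable_smul hφ x).integrableOn a).aestronglyMeasurable)
    (fun x => ae_of_all _ fun s => hk.norm_deriv_smul_le φ x a s)
    ((hφ.integrableOn_weight N a).const_mul C) (ae_of_all _ fun s => ?_)
  exact ((hk.continuous_left _).smul continuous_const).const_smul _

/-- The integral against a moderate kernel as a bounded continuous function. -/
def integral (hk : IsModerateKernel Γ C N k) (hφ : RapidlyIntegrable Γ φ) : X →ᵇ E :=
  BoundedContinuousFunction.ofNormedAddCommGroup (fun x => totalInt Γ (fun q => k x q • φ q))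
    (hk.continuous_totalInt hφ) (C * weightNorm Γ N φ) (hk.norm_totalInt_le hφ)

@[simp]
theorem integral_apply (hk : IsModerateKernel Γ C N k) (hφ : RapidlyIntegrable Γ φ) (x : X) :
    hk.integral hφ x = totalInt Γ (fun q => k x q • φ q) := rfl

end IsModerateKernel

theorem RapidlyIntegrable.bounded_mul {w : ContourPts ι → 𝔸} (hw : RapidlyIntegrable Γ w)
    (α : ContourPts ι →ᵇ 𝔸) : RapidlyIntegrable Γ (fun q => α q * w q) :=
  hw.mul_left_of_le (C := ‖α‖) (N := 0) α.continuous fun q => by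
    simpa using α.norm_coe_le_norm q

variable {C : ℝ} {N : ℕ} {k : X → ContourPts ι → ℂ} [Fintype ι] [FirstCountableTopology X]

open Classical in
/-- The integral operator with kernel `k x q • w q`, the weight `w` acting from the right. It is
`0` unless the weight is rapidly integrable. -/
def kernelOp (hk : IsModerateKernel Γ C N k) (w : ContourPts ι → 𝔸) :
    (ContourPts ι →ᵇ 𝔸) →L[ℂ] (X →ᵇ 𝔸) :=
  if hw : RapidlyIntegrable Γ w then
    LinearMap.mkContinuous
      { toFun := fun α => hk.integral (hw.bounded_mul α)
        map_add' := fun α β => by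
          ext x
          simp only [IsModerateKernel.integral_apply, BoundedContinuousFunction.coe_add,
            Pi.add_apply, add_mul, smul_add]
          exact totalInt_add (hk.rapidlyIntegrable_smul (hw.bounded_mul α) x)
            (hk.rapidlyIntegrable_smul (hw.bounded_mul β) x)
        map_smul' := fun c α => by
          ext x
          simp only [IsModerateKernel.integral_apply, BoundedContinuousFunction.coe_smul,
            smul_mul_assoc, RingHom.id_apply, smul_comm _ c]
          exact totalInt_const_smul _ _ }
      (C * weightNorm Γ N w) fun α => by
        have h0 := hk.nonneg
        have h1 := weightNorm_nonneg Γ N w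
        refine (BoundedContinuousFunction.norm_le (by positivity)).2 fun x => ?_
        refine (hk.norm_totalInt_le (hw.bounded_mul α) x).trans ?_
        rw [mul_assoc, mul_comm _ ‖α‖]
        gcongr
        refine weightNorm_le_of_norm_le hw fun q => (norm_mul_le _ _).trans ?_
        gcongr
        exact α.norm_coe_le_norm q
  else 0

theorem kernelOp_apply (hk : IsModerateKernel Γ C N k) {w : ContourPts ι → 𝔸}
    (hw : RapidlyIntegrable Γ w) (α : ContourPts ι →ᵇ 𝔸) (x : X) :
    kernelOp hk w α x = totalInt Γ (fun q => k x q • (α q * w q)) := by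
  rw [kernelOp, dif_pos hw]
  rfl

theorem norm_kernelOp_le (hk : IsModerateKernel Γ C N k) {w : ContourPts ι → 𝔸}
    (hw : RapidlyIntegrable Γ w) : ‖kernelOp hk w‖ ≤ C * weightNorm Γ N w := by
  rw [kernelOp, dif_pos hw]
  exact LinearMap.mkContinuous_norm_le _ (mul_nonneg hk.nonneg (weightNorm_nonneg Γ N w)) _

theorem kernelOp_add (hk : IsModerateKernel Γ C N k) {w w' : ContourPts ι → 𝔸}
    (hw : RapidlyIntegrable Γ w) (hw' : RapidlyIntegrable Γ w') :
    kernelOp hk (fun q => w q + w' q) = kernelOp hk w + kernelOp hk w' := by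
  ext α x
  rw [add_apply, BoundedContinuousFunction.add_apply, kernelOp_apply hk hw,
    kernelOp_apply hk hw', kernelOp_apply hk (hw.add hw')]
  simp only [mul_add, smul_add]
  exact totalInt_add (hk.rapidlyIntegrable_smul (hw.bounded_mul α) x)
    (hk.rapidlyIntegrable_smul (hw'.bounded_mul α) x)

theorem kernelOp_smul (hk : IsModerateKernel Γ C N k) {w : ContourPts ι → 𝔸}
    (hw : RapidlyIntegrable Γ w) (c : ℂ) :
    kernelOp hk (fun q => c • w q) = c • kernelOp hk w := by
  ext α x
  rw [smul_apply, BoundedContinuousFunction.smul_apply, kernelOp_apply hk hw,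
    kernelOp_apply hk (hw.const_smul c)]
  simp only [mul_smul_comm, smul_comm _ c]
  exact totalInt_const_smul _ _

theorem kernelOp_sum (hk : IsModerateKernel Γ C N k) {κ : Type*} (S : Finset κ)
    {w : κ → ContourPts ι → 𝔸} (hw : ∀ j ∈ S, RapidlyIntegrable Γ (w j)) :
    kernelOp hk (fun q => ∑ j ∈ S, w j q) = ∑ j ∈ S, kernelOp hk (w j) := by
  classical
  induction S using Finset.induction_on with
  | empty =>
    ext α x
    simp [kernelOp_apply hk RapidlyIntegrable.zero, totalInt, pathInt]
  | insert j S hj ih =>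
    simp only [Finset.sum_insert hj]
    rw [kernelOp_add hk (hw j (Finset.mem_insert_self _ _))
      (RapidlyIntegrable.sum S fun i hi => hw i (Finset.mem_insert_of_mem hi)),
      ih fun i hi => hw i (Finset.mem_insert_of_mem hi)]

/-- Differentiation of `kernelOp` with respect to parameters of the weight. -/
theorem hasFDerivAt_kernelOp (hk : IsModerateKernel Γ C N k) {m : ℕ}
    {w : (Fin m → ℂ) → ContourPts ι → 𝔸} {x₀ : Fin m → ℂ} {w' : Fin m → ContourPts ι → 𝔸}
    {Ψ : ContourPts ι → ℂ} (hw : ∀ᶠ x in 𝓝 x₀, RapidlyIntegrable Γ (w x))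
    (hw' : ∀ j, RapidlyIntegrable Γ (w' j)) (hΨ : RapidlyIntegrable Γ Ψ)
    (hle : ∀ᶠ x in 𝓝 x₀, ∀ q,
      ‖w x q - w x₀ q - ∑ j, (x j - x₀ j) • w' j q‖ ≤ ‖x - x₀‖ ^ 2 * ‖Ψ q‖) :
    HasFDerivAt (fun x => kernelOp hk (w x))
      (∑ j, (ContinuousLinearMap.proj (R := ℂ) j : (Fin m → ℂ) →L[ℂ] ℂ).smulRight
        (kernelOp hk (w' j))) x₀ := by
  have hw₀ := hw.self_of_nhds
  have key : ∀ᶠ x in 𝓝 x₀, ‖kernelOp hk (w x) - kernelOp hk (w x₀) -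
      (∑ j, (ContinuousLinearMap.proj (R := ℂ) j : (Fin m → ℂ) →L[ℂ] ℂ).smulRight
        (kernelOp hk (w' j))) (x - x₀)‖ ≤ (C * weightNorm Γ N Ψ) * ‖‖x - x₀‖ ^ 2‖ := by
    filter_upwards [hw, hle] with x hx hxle
    have hs : RapidlyIntegrable Γ (fun q => ∑ j, (x j - x₀ j) • w' j q) :=
      RapidlyIntegrable.sum _ fun j _ => (hw' j).const_smul _
    -- By linearity in the weight, the Taylor remainder of the operator is the operator of the
    -- Taylor remainder of the weight, whose weighted `L¹` norm is `O(‖x - x₀‖²)`.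
    have heq : kernelOp hk (w x) - kernelOp hk (w x₀) -
        (∑ j, (ContinuousLinearMap.proj (R := ℂ) j : (Fin m → ℂ) →L[ℂ] ℂ).smulRight
          (kernelOp hk (w' j))) (x - x₀)
        = kernelOp hk (fun q => w x q - w x₀ q - ∑ j, (x j - x₀ j) • w' j q) := by
      rw [eq_comm, sub_sub, eq_sub_iff_add_eq]
      have h1 : kernelOp hk (fun q => ∑ j, (x j - x₀ j) • w' j q)
          = (∑ j, (ContinuousLinearMap.proj (R := ℂ) j : (Fin m → ℂ) →L[ℂ] ℂ).smulRight
          (kernelOp hk (w' j))) (x - x₀) := by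
        rw [kernelOp_sum hk _ fun j _ => (hw' j).const_smul _, sum_apply]
        refine Finset.sum_congr rfl fun j _ => ?_
        rw [kernelOp_smul hk (hw' j)]
        rfl
      rw [← h1, ← kernelOp_add hk hw₀ hs, ← kernelOp_add hk ((hx.sub hw₀).sub hs) (hw₀.add hs)]
      congr 1
      ext q
      abel
    rw [heq]
    have h0 := hk.nonneg
    refine (norm_kernelOp_le hk ((hx.sub hw₀).sub hs)).trans ?_
    rw [Real.norm_of_nonneg (by positivity), mul_assoc, mul_comm _ (‖x - x₀‖ ^ 2)]
    gcongr
    exact weightNorm_le_of_norm_le hΨ hxle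
  have hlim : Tendsto (fun x : Fin m → ℂ => x - x₀) (𝓝 x₀) (𝓝 0) :=
    tendsto_sub_nhds_zero_iff.2 tendsto_id
  have ho : (fun x : Fin m → ℂ => ‖x - x₀‖ ^ 2) =o[𝓝 x₀] fun x => x - x₀ :=
    (Asymptotics.isLittleO_norm_pow_id one_lt_two).comp_tendsto hlim
  refine HasFDerivAt.of_isLittleO (𝕜 := ℂ) (E := Fin m → ℂ)
    (F := (ContourPts ι →ᵇ 𝔸) →L[ℂ] (X →ᵇ 𝔸)) (f := fun x => kernelOp hk (w x)) ?_
  exact (Asymptotics.IsBigO.of_bound _ key).trans_isLittleO ho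

end Kernels
end

/-! ### The Cauchy kernel between different contours. -/

noncomputable section

section Cauchy

open scoped BoundedContinuousFunction

variable {ι : Type*} {Γ : ι → SimpleContour}

theorem SeparatedAtInfinity.exists_le_norm_sub (hsep : SeparatedAtInfinity Γ) (x : ContourPts ι) :
    ∃ ε : ℝ, 0 < ε ∧ ∀ q : ContourPts ι, x.1 ≠ q.1 → ε ≤ ‖contourPt Γ x - contourPt Γ q‖ := by
  obtain ⟨κ, hκ, N, h⟩ := hsep
  have hpos : 0 < (1 + ‖contourPt Γ x‖) ^ N := by positivity
  refine ⟨κ / (1 + ‖contourPt Γ x‖) ^ N, by positivity, fun q hq => ?_⟩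
  rw [div_le_iff₀ hpos]
  exact h _ _ hq _ ((Γ _).param_mem_trace _) _ ((Γ _).param_mem_trace _)

theorem SeparatedAtInfinity.contourPt_sub_ne_zero (hsep : SeparatedAtInfinity Γ)
    {x q : ContourPts ι} (h : x.1 ≠ q.1) : contourPt Γ x - contourPt Γ q ≠ 0 := by
  obtain ⟨ε, hε, hle⟩ := hsep.exists_le_norm_sub x
  exact norm_pos_iff.1 (hε.trans_le (hle q h))

/-- The separation condition holds for both orders of the pair, so the polynomial weight may be put
on the variable of integration. The bound is then uniform in `x`, which is what makes Cauchy
integrals of rapidly integrable functions bounded. -/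
theorem SeparatedAtInfinity.exists_norm_inv_le (hsep : SeparatedAtInfinity Γ) :
    ∃ C : ℝ, 0 ≤ C ∧ ∃ N : ℕ, ∀ x q : ContourPts ι, x.1 ≠ q.1 →
      ‖(contourPt Γ x - contourPt Γ q)⁻¹‖ ≤ C * (1 + ‖contourPt Γ q‖) ^ N := by
  have hsep' := hsep
  obtain ⟨κ, hκ, N, h⟩ := hsep
  refine ⟨κ⁻¹, by positivity, N, fun x q hq => ?_⟩
  have h1 := h _ _ hq.symm _ ((Γ _).param_mem_trace q.2) _ ((Γ _).param_mem_trace x.2)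
  have h2 : 0 < ‖contourPt Γ x - contourPt Γ q‖ :=
    norm_pos_iff.2 (hsep'.contourPt_sub_ne_zero hq)
  rw [norm_inv, inv_le_iff_one_le_mul₀ h2, mul_assoc, mul_comm κ⁻¹,
    ← div_eq_mul_inv, one_le_div hκ]
  refine h1.trans_eq ?_
  rw [norm_sub_rev, mul_comm]
  rfl

open Classical in
/-- The Cauchy kernel, switched off on the contour with index `a`. -/
def cauchyKer (Γ : ι → SimpleContour) (a : ι) (u : ℂ) (q : ContourPts ι) : ℂ :=
  if a = q.1 then 0 else (u - contourPt Γ q)⁻¹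

theorem SeparatedAtInfinity.exists_isModerateKernel (hsep : SeparatedAtInfinity Γ) :
    ∃ (C : ℝ) (N : ℕ), IsModerateKernel Γ C N
      (fun x q : ContourPts ι => cauchyKer Γ x.1 (contourPt Γ x) q) := by
  obtain ⟨C, hC, N, h⟩ := hsep.exists_norm_inv_le
  refine ⟨C, N, hC, fun q => continuous_sigma fun a => ?_,
    fun x => continuous_sigma fun b => ?_, fun x q => ?_⟩
  · by_cases hab : a = q.1
    · simp only [cauchyKer, hab, if_true]
      exact continuous_const
    · simp only [cauchyKer, hab, if_false]
      exact Continuous.inv₀ (((continuous_contourPt Γ).comp continuous_sigmaMk).sub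
        continuous_const) fun s => hsep.contourPt_sub_ne_zero (x := ⟨a, s⟩) hab
  · by_cases hab : x.1 = b
    · simp only [cauchyKer, hab, if_true]
      exact continuous_const
    · simp only [cauchyKer, hab, if_false]
      exact Continuous.inv₀ (continuous_const.sub
        ((continuous_contourPt Γ).comp continuous_sigmaMk))
        fun s => hsep.contourPt_sub_ne_zero (q := ⟨b, s⟩) hab
  · by_cases hab : x.1 = q.1
    · simp only [cauchyKer, hab, if_true, norm_zero]
      positivity
    · simp only [cauchyKer, hab, if_false]
      exact h x q hab

variable {E : Type*} [NormedAddCommGroup E] [NormedSpace ℂ E]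

/-- The Cauchy integral over all contours but the one with index `a`. -/
def cauchyInt [Fintype ι] (Γ : ι → SimpleContour) (φ : ContourPts ι → E) (a : ι) (u : ℂ) : E :=
  totalInt Γ (fun q => cauchyKer Γ a u q • φ q)

/-- The Cauchy integral of the other contours at a point of the contours. -/
def cauchyAt [Fintype ι] (Γ : ι → SimpleContour) (φ : ContourPts ι → E) (x : ContourPts ι) : E :=
  cauchyInt Γ φ x.1 (contourPt Γ x)

variable {𝔸 : Type*} [NormedRing 𝔸] [NormedAlgebra ℂ 𝔸]

section linear

variable {φ ψ : ContourPts ι → E}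

theorem RapidlyIntegrable.cauchyKer_smul (hsep : SeparatedAtInfinity Γ)
    (hφ : RapidlyIntegrable Γ φ) (x : ContourPts ι) :
    RapidlyIntegrable Γ (fun q => cauchyKer Γ x.1 (contourPt Γ x) q • φ q) := by
  obtain ⟨C, N, hk⟩ := hsep.exists_isModerateKernel
  exact hk.rapidlyIntegrable_smul hφ x

variable [Fintype ι]

theorem cauchyAt_add (hsep : SeparatedAtInfinity Γ) (hφ : RapidlyIntegrable Γ φ)
    (hψ : RapidlyIntegrable Γ ψ) (x : ContourPts ι) :
    cauchyAt Γ (fun q => φ q + ψ q) x = cauchyAt Γ φ x + cauchyAt Γ ψ x := by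
  simp only [cauchyAt, cauchyInt, smul_add]
  exact totalInt_add (hφ.cauchyKer_smul hsep x) (hψ.cauchyKer_smul hsep x)

theorem cauchyAt_sub (hsep : SeparatedAtInfinity Γ) (hφ : RapidlyIntegrable Γ φ)
    (hψ : RapidlyIntegrable Γ ψ) (x : ContourPts ι) :
    cauchyAt Γ (fun q => φ q - ψ q) x = cauchyAt Γ φ x - cauchyAt Γ ψ x := by
  simp only [cauchyAt, cauchyInt, smul_sub]
  exact totalInt_sub (hφ.cauchyKer_smul hsep x) (hψ.cauchyKer_smul hsep x)

theorem cauchyAt_const_mul [CompleteSpace 𝔸] (hsep : SeparatedAtInfinity Γ)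
    {φ : ContourPts ι → 𝔸} (hφ : RapidlyIntegrable Γ φ) (c : 𝔸) (x : ContourPts ι) :
    cauchyAt Γ (fun q => c * φ q) x = c * cauchyAt Γ φ x := by
  simp only [cauchyAt, cauchyInt, ← mul_smul_comm]
  exact totalInt_const_mul (hφ.cauchyKer_smul hsep x) c

theorem cauchyAt_mul_const [CompleteSpace 𝔸] (hsep : SeparatedAtInfinity Γ)
    {φ : ContourPts ι → 𝔸} (hφ : RapidlyIntegrable Γ φ) (c : 𝔸) (x : ContourPts ι) :
    cauchyAt Γ (fun q => φ q * c) x = cauchyAt Γ φ x * c := by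
  simp only [cauchyAt, cauchyInt, ← smul_mul_assoc]
  exact totalInt_mul_const (hφ.cauchyKer_smul hsep x) c

/-- From `v / (u - v) = u / (u - v) - 1`. The constant `-1` is integrated only over the contours
different from that of `x`; the last summand compensates for the one left out. -/
theorem cauchyAt_pt_smul (hsep : SeparatedAtInfinity Γ) (hφ : RapidlyIntegrable Γ φ)
    (x : ContourPts ι) : cauchyAt Γ (fun q => contourPt Γ q • φ q) x
      = contourPt Γ x • cauchyAt Γ φ x - totalInt Γ φ + pathInt Γ x.1 φ := by
  classical
  have h1 : ∀ b, pathInt Γ b (fun q => cauchyKer Γ x.1 (contourPt Γ x) q • contourPt Γ q • φ q)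
      = contourPt Γ x • pathInt Γ b (fun q => cauchyKer Γ x.1 (contourPt Γ x) q • φ q)
        - (if b = x.1 then 0 else pathInt Γ b φ) := by
    intro b
    by_cases hb : x.1 = b
    · subst hb
      simp [pathInt, cauchyKer]
    · rw [if_neg (Ne.symm hb), ← pathInt_const_smul,
        ← pathInt_sub ((hφ.cauchyKer_smul hsep x).const_smul _) hφ]
      refine pathInt_congr_ae (ae_of_all _ fun s => ?_)
      have h0 := hsep.contourPt_sub_ne_zero (x := x) (q := ⟨b, s⟩) hb
      simp only [cauchyKer, hb, if_false, smul_smul]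
      rw [eq_sub_iff_add_eq]
      nth_rewrite 2 [← one_smul ℂ (φ _)]
      rw [← add_smul]
      congr 1
      field_simp
      ring
  simp only [cauchyAt, cauchyInt, totalInt]
  rw [Finset.sum_congr rfl fun b _ => h1 b, Finset.sum_sub_distrib, Finset.smul_sum, sub_add]
  congr 1
  rw [eq_sub_iff_add_eq, ← Finset.sum_erase_add _ _ (Finset.mem_univ x.1), if_pos rfl, add_zero,
    ← Finset.sum_erase_add (a := x.1) _ _ (Finset.mem_univ x.1)]
  congr 1
  exact Finset.sum_congr rfl fun b hb => if_neg (Finset.ne_of_mem_erase hb)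

end linear

theorem hasDerivAt_cauchyInt [Fintype ι] (hsep : SeparatedAtInfinity Γ) {φ : ContourPts ι → E}
    (hφ : RapidlyIntegrable Γ φ) (x : ContourPts ι) :
    HasDerivAt (cauchyInt Γ φ x.1) (-totalInt Γ (fun q =>
      (cauchyKer Γ x.1 (contourPt Γ x) q * cauchyKer Γ x.1 (contourPt Γ x) q) • φ q))
      (contourPt Γ x) := by
  obtain ⟨ε, hε, hle⟩ := hsep.exists_le_norm_sub x
  rw [totalInt, ← Finset.sum_neg_distrib]
  refine HasDerivAt.fun_sum fun b _ => ?_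
  by_cases hb : x.1 = b
  · subst hb
    simpa [pathInt, cauchyKer] using hasDerivAt_const (contourPt Γ x) (0 : E)
  · simp only [pathInt, cauchyKer, hb, if_false]
    rw [← integral_neg]
    have hc := (Γ b).continuous_param
    -- A disc of half the distance stays away from the other contours, so the differentiated kernel
    -- is bounded by `(ε / 2)⁻²` uniformly in `u`.
    have hfar : ∀ u ∈ Metric.ball (contourPt Γ x) (ε / 2), ∀ s,
        ε / 2 ≤ ‖u - (Γ b).param s‖ := by
      intro u hu s
      have h1 := hle ⟨b, s⟩ hb
      have h2 := norm_sub_le_norm_sub_add_norm_sub (contourPt Γ x) u (contourPt Γ ⟨b, s⟩)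
      rw [Metric.mem_ball, dist_comm, dist_eq_norm] at hu
      change _ ≤ ‖u - contourPt Γ ⟨b, s⟩‖
      linarith
    have hmeas : ∀ u : ℂ, AEStronglyMeasurable (fun s : ℝ => (u - (Γ b).param s)⁻¹)
        (volume.restrict (Γ b).dom) := fun u =>
      (Measurable.inv (by have := hc.measurable; fun_prop)).aestronglyMeasurable
    have hφm := (hφ.integrableOn b).aestronglyMeasurable
    refine (hasDerivAt_integral_of_dominated_loc_of_deriv_le
      (F := fun u s => deriv (Γ b).param s • (u - contourPt Γ ⟨b, s⟩)⁻¹ • φ ⟨b, s⟩)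
      (F' := fun u s => -(deriv (Γ b).param s • ((u - contourPt Γ ⟨b, s⟩)⁻¹ *
        (u - contourPt Γ ⟨b, s⟩)⁻¹) • φ ⟨b, s⟩))
      (bound := fun s => ((ε / 2)⁻¹ * (ε / 2)⁻¹) * ‖deriv (Γ b).param s • φ ⟨b, s⟩‖)
      (Metric.ball_mem_nhds _ (half_pos hε)) ?_ ?_ ?_ ?_ ?_ ?_).2
    · refine Eventually.of_forall fun u => ?_
      simp_rw [smul_comm (deriv (Γ b).param _)]
      exact (hmeas u).smul hφm
    · have := (hφ.cauchyKer_smul hsep x).integrableOn b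
      simp only [cauchyKer, hb, if_false] at this
      exact this
    · simp_rw [smul_comm (deriv (Γ b).param _)]
      exact (((hmeas _).mul (hmeas _)).smul hφm).neg
    · refine ae_of_all _ fun s u hu => ?_
      have h1 := hfar u hu s
      rw [smul_comm, norm_neg, norm_smul, norm_mul, norm_inv]
      have h3 : ‖u - contourPt Γ ⟨b, s⟩‖⁻¹ ≤ (ε / 2)⁻¹ := inv_anti₀ (half_pos hε) h1
      gcongr
    · exact (hφ.integrableOn b).norm.const_mul _
    · refine ae_of_all _ fun s u hu => ?_
      have h0 : u - contourPt Γ ⟨b, s⟩ ≠ 0 :=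
        norm_pos_iff.1 ((half_pos hε).trans_le (hfar u hu s))
      have h1 := (((hasDerivAt_id u).sub_const (contourPt Γ ⟨b, s⟩)).fun_inv h0).smul_const (φ ⟨b, s⟩)
      have h2 := h1.const_smul (deriv (Γ b).param s)
      refine h2.congr_deriv ?_
      rw [← smul_neg, ← neg_smul]
      congr 2
      simp only [id_eq]
      field_simp

/-- Integration by parts in a Cauchy integral. -/
theorem cauchyAt_deriv [Fintype ι] [CompleteSpace E] (hsep : SeparatedAtInfinity Γ) {Φ Φ' : ι → ℂ → E}
    (hd : ∀ q : ContourPts ι, HasDerivAt (Φ q.1) (Φ' q.1 (contourPt Γ q)) (contourPt Γ q))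
    (hΦ : RapidlyIntegrable Γ fun q => Φ q.1 (contourPt Γ q))
    (hΦ' : RapidlyIntegrable Γ fun q => Φ' q.1 (contourPt Γ q))
    (hlim : ∀ a, (Γ a).dom = Set.univ →
      Tendsto (fun s => Φ a ((Γ a).param s)) (cocompact ℝ) (𝓝 0)) (x : ContourPts ι) :
    cauchyAt Γ (fun q => Φ' q.1 (contourPt Γ q)) x
      = -totalInt Γ (fun q => (cauchyKer Γ x.1 (contourPt Γ x) q *
        cauchyKer Γ x.1 (contourPt Γ x) q) • Φ q.1 (contourPt Γ q)) := by
  obtain ⟨ε, hε, hle⟩ := hsep.exists_le_norm_sub x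
  obtain ⟨C, N, hk⟩ := hsep.exists_isModerateKernel
  have hr1 := hk.rapidlyIntegrable_smul hΦ' x
  have hr2 := (hk.mul hk).rapidlyIntegrable_smul hΦ x
  rw [eq_neg_iff_add_eq_zero, cauchyAt, cauchyInt, ← totalInt_add hr1 hr2]
  refine Finset.sum_eq_zero fun b _ => ?_
  by_cases hb : x.1 = b
  · simp [pathInt, cauchyKer, hb]
  · have hi := (hr1.add hr2).integrableOn b
    simp only [pathInt, cauchyKer, hb, if_false] at hi ⊢
    -- The integrand is the total derivative in `v` of `(x - v)⁻¹ Φ(v)`, whose boundary values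
    -- vanish.
    refine (Γ b).integral_deriv_eq_zero (Φ := fun v => (contourPt Γ x - v)⁻¹ • Φ b v)
      (Φ' := fun v => (contourPt Γ x - v)⁻¹ • Φ' b v +
        ((contourPt Γ x - v)⁻¹ * (contourPt Γ x - v)⁻¹) • Φ b v) (fun s => ?_) hi fun h => ?_
    · have h0 : contourPt Γ x - (Γ b).param s ≠ 0 :=
        hsep.contourPt_sub_ne_zero (x := x) (q := ⟨b, s⟩) hb
      have h1 := ((hasDerivAt_id ((Γ b).param s)).const_sub (contourPt Γ x)).fun_inv h0
      have h2 := h1.fun_smul (hd ⟨b, s⟩)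
      refine h2.congr_deriv ?_
      simp only [id_eq, contourPt]
      congr 2
      field_simp
    · refine squeeze_zero_norm (a := fun s => ε⁻¹ * ‖Φ b ((Γ b).param s)‖) (fun s => ?_) ?_
      · rw [norm_smul, norm_inv]
        gcongr
        exact hle ⟨b, s⟩ hb
      · simpa using (hlim b h).norm.const_mul ε⁻¹

end Cauchy
end

/-! ### Uniqueness, the Lax equation and the moment identity. -/

noncomputable section

section Lax

open scoped BoundedContinuousFunction

variable {ι : Type*} [Fintype ι] {Γ : ι → SimpleContour} {𝔸 : Type*} [NormedRing 𝔸]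
  [NormedAlgebra ℂ 𝔸] {J : ContourPts ι → 𝔸} {A : ContourPts ι →ᵇ 𝔸}

/-- No bound on `α` is assumed: the equation itself exhibits `α` as a Cauchy integral of a rapidly
integrable function, hence as a bounded continuous function, and then invertibility applies. This is
needed because the lemma is used for combinations that involve `z A` and `z² A`. -/
theorem eq_zero_of_eq_cauchyAt {C : ℝ} {N : ℕ}
    (hk : IsModerateKernel Γ C N (fun x q : ContourPts ι => cauchyKer Γ x.1 (contourPt Γ x) q))
    (hJ : RapidlyIntegrable Γ J) (hu : IsUnit (1 - kernelOp hk J)) {α : ContourPts ι → 𝔸}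
    (hα : RapidlyIntegrable Γ fun q => α q * J q)
    (h : ∀ x, α x = cauchyAt Γ (fun q => α q * J q) x) (x : ContourPts ι) : α x = 0 := by
  have hb : ∀ x, hk.integral hα x = α x := fun x => (h x).symm
  have h1 : (1 - kernelOp hk J) (hk.integral hα) = 0 := by
    ext x
    change hk.integral hα x - kernelOp hk J (hk.integral hα) x = 0
    rw [kernelOp_apply hk hJ]
    simp only [hb]
    exact sub_eq_zero.2 (h x)
  obtain ⟨u, hu⟩ := hu
  have h2 : hk.integral hα = 0 := by
    have h3 : (u.inv * u.val) (hk.integral hα) = u.inv 0 := by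
      rw [← h1, ← hu]
      rfl
    rwa [u.inv_val, map_zero] at h3
  rw [← hb, h2]
  rfl

/-- The moments `∮ zⁿ A J dz`. -/
def moment (Γ : ι → SimpleContour) (A J : ContourPts ι → 𝔸) (n : ℕ) : 𝔸 :=
  totalInt Γ (fun q => contourPt Γ q ^ n • (A q * J q))

/-- The solution of the integral equation with inhomogeneous term `z + U₀`. -/
def linSol (Γ : ι → SimpleContour) (A J : ContourPts ι → 𝔸) (x : ContourPts ι) : 𝔸 :=
  contourPt Γ x • A x + pathInt Γ x.1 (fun q => A q * J q)

/-- The solution of the integral equation with inhomogeneous term `z² + z U₀ + U₁`. -/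
def quadSol (Γ : ι → SimpleContour) (A J : ContourPts ι → 𝔸) (x : ContourPts ι) : 𝔸 :=
  contourPt Γ x • linSol Γ A J x + pathInt Γ x.1 (fun q => contourPt Γ q • (A q * J q))

/-- The element `e` is annihilated when multiplied from both sides by values of `J` on the same
contour. -/
def SandwichZero (J : ContourPts ι → 𝔸) (e : 𝔸) : Prop :=
  ∀ p q : ContourPts ι, p.1 = q.1 → J p * e * J q = 0

section sandwich

variable [CompleteSpace 𝔸] (hJ : RapidlyIntegrable Γ J)
include hJ

-- The integral runs over the contour of `q`, so each value of its integrand, multiplied by `e * J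
-- q`, contains a product `J p * e * J q` on one contour. This is why the correction terms in
-- `linSol` and `quadSol` are invisible after multiplication by `J`.
omit [Fintype ι] in
theorem pathInt_mul_sandwich {e : 𝔸} (he : SandwichZero J e) (q : ContourPts ι) :
    pathInt Γ q.1 (fun p => A p * J p) * e * J q = 0 := by
  rw [← pathInt_mul_const (hJ.bounded_mul A),
    ← pathInt_mul_const ((hJ.bounded_mul A).mul_const e)]
  have h : ∀ s, A ⟨q.1, s⟩ * J ⟨q.1, s⟩ * e * J q = 0 := fun s => by
    rw [mul_assoc (A _), mul_assoc (A _), he ⟨q.1, s⟩ q rfl, mul_zero]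
  simp [pathInt, h]

omit [Fintype ι] in
theorem pathInt_pt_mul_sandwich {e : 𝔸} (he : SandwichZero J e) (q : ContourPts ι) :
    pathInt Γ q.1 (fun p => contourPt Γ p • (A p * J p)) * e * J q = 0 := by
  rw [← pathInt_mul_const (hJ.bounded_mul A).pt_smul,
    ← pathInt_mul_const ((hJ.bounded_mul A).pt_smul.mul_const e)]
  have h : ∀ s, A ⟨q.1, s⟩ * J ⟨q.1, s⟩ * e * J q = 0 := fun s => by
    rw [mul_assoc (A _), mul_assoc (A _), he ⟨q.1, s⟩ q rfl, mul_zero]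
  simp [pathInt, h]

omit [Fintype ι] in
theorem linSol_mul_sandwich {e : 𝔸} (he : SandwichZero J e) (q : ContourPts ι) :
    linSol Γ A J q * e * J q = contourPt Γ q • (A q * e * J q) := by
  rw [linSol, add_mul, add_mul, pathInt_mul_sandwich hJ he, add_zero, smul_mul_assoc,
    smul_mul_assoc]

omit [Fintype ι] in
theorem quadSol_mul_sandwich {e : 𝔸} (he : SandwichZero J e) (q : ContourPts ι) :
    quadSol Γ A J q * e * J q = contourPt Γ q ^ 2 • (A q * e * J q) := by
  rw [quadSol, add_mul, add_mul, pathInt_pt_mul_sandwich hJ he, add_zero, smul_mul_assoc,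
    smul_mul_assoc, linSol_mul_sandwich hJ he, smul_smul, pow_two]

variable (h1 : SandwichZero J 1)
include h1

omit [Fintype ι] in
theorem linSol_mul (q : ContourPts ι) :
    linSol Γ A J q * J q = contourPt Γ q • (A q * J q) := by
  simpa using linSol_mul_sandwich hJ h1 q

omit [Fintype ι] in
theorem quadSol_mul (q : ContourPts ι) :
    quadSol Γ A J q * J q = contourPt Γ q ^ 2 • (A q * J q) := by
  simpa using quadSol_mul_sandwich hJ h1 q

variable (hsep : SeparatedAtInfinity Γ) (hA : ∀ x, A x = 1 + cauchyAt Γ (fun q => A q * J q) x)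
include hsep hA

/-- Multiplying the equation for `A` by `z` and moving `z` under the Cauchy integral by
`cauchyAt_pt_smul` costs `U₀` minus the integral over the contour of `x`; `linSol` absorbs the
latter. -/
theorem linSol_eq (x : ContourPts ι) : linSol Γ A J x
    = contourPt Γ x • 1 + moment Γ A J 0 + cauchyAt Γ (fun q => linSol Γ A J q * J q) x := by
  simp only [linSol_mul hJ h1]
  rw [cauchyAt_pt_smul hsep (hJ.bounded_mul A), linSol]
  nth_rewrite 1 [hA x]
  simp only [moment, pow_zero, one_smul, smul_add]
  abel

theorem quadSol_eq (x : ContourPts ι) : quadSol Γ A J x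
    = contourPt Γ x ^ 2 • 1 + contourPt Γ x • moment Γ A J 0 + moment Γ A J 1
      + cauchyAt Γ (fun q => quadSol Γ A J q * J q) x := by
  have h2 : ∀ q, quadSol Γ A J q * J q = contourPt Γ q • (linSol Γ A J q * J q) := fun q => by
    rw [quadSol_mul hJ h1, linSol_mul hJ h1, smul_smul, pow_two]
  have h3 : RapidlyIntegrable Γ fun q => linSol Γ A J q * J q := by
    simp only [linSol_mul hJ h1]
    exact (hJ.bounded_mul A).pt_smul
  simp only [h2]
  rw [cauchyAt_pt_smul hsep h3, quadSol]
  nth_rewrite 1 [linSol_eq hJ h1 hsep hA x]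
  simp only [linSol_mul hJ h1, moment, pow_one, smul_add, smul_smul, pow_two]
  abel

variable (huniq : ∀ α : ContourPts ι → 𝔸, RapidlyIntegrable Γ (fun q => α q * J q) →
  (∀ x, α x = cauchyAt Γ (fun q => α q * J q) x) → ∀ x, α x = 0)
include huniq

/-- The Lax equation for the derivative with respect to a parameter on which `J` depends through
`J' = z [e, J]`. -/
theorem lax_parameter {e : 𝔸} (he : SandwichZero J e) {A' : ContourPts ι →ᵇ 𝔸}
    (hA' : ∀ x, A' x = cauchyAt Γ (fun q => A' q * J q) x
      + cauchyAt Γ (fun q => A q * (contourPt Γ q • (e * J q - J q * e))) x)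
    (x : ContourPts ι) :
    A' x = e * linSol Γ A J x - linSol Γ A J x * e
      + (moment Γ A J 0 * e - e * moment Γ A J 0) * A x := by
  set U := moment Γ A J 0 with hU
  have r0 := hJ.bounded_mul A
  have r0' := hJ.bounded_mul A'
  have r1 : RapidlyIntegrable Γ fun q => contourPt Γ q • (A q * J q) := r0.pt_smul
  have r2 : RapidlyIntegrable Γ fun q => contourPt Γ q • (A q * e * J q) := by
    simpa only [mul_assoc] using ((hJ.const_mul e).bounded_mul A).pt_smul
  have hmul : ∀ q, (A' q + linSol Γ A J q * e - e * linSol Γ A J q - (U * e - e * U) * A q) * J q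
      = A' q * J q + contourPt Γ q • (A q * e * J q) - e * (contourPt Γ q • (A q * J q))
        - (U * e - e * U) * (A q * J q) := fun q => by
    rw [sub_mul, sub_mul, add_mul, linSol_mul_sandwich hJ he, mul_assoc e, linSol_mul hJ h1,
      mul_assoc _ (A q)]
  have hr := (r0'.add r2).sub (r1.const_mul e)
  have hr' := r0.const_mul (U * e - e * U)
  -- The inhomogeneous terms of `linSol * e` and `e * linSol` are `(z + U₀) e` and `e (z + U₀)`.
  -- Their difference `U₀ e - e U₀` is cancelled by the constant multiple of `A`.
  have key := huniq
    (fun q => A' q + linSol Γ A J q * e - e * linSol Γ A J q - (U * e - e * U) * A q)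
    (by simp only [hmul]; exact hr.sub hr') (fun x => by
      simp only [hmul]
      rw [cauchyAt_sub hsep hr hr', cauchyAt_sub hsep (r0'.add r2) (r1.const_mul e),
        cauchyAt_add hsep r0' r2, cauchyAt_const_mul hsep r1, cauchyAt_const_mul hsep r0]
      have e1 := hA' x
      have e2 : ∀ q, A q * (contourPt Γ q • (e * J q - J q * e))
          = contourPt Γ q • (A q * e * J q) - contourPt Γ q • (A q * J q) * e := fun q => by
        rw [mul_smul_comm, mul_sub, smul_sub, smul_mul_assoc, mul_assoc, mul_assoc]
      simp only [e2] at e1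
      rw [cauchyAt_sub hsep r2 (r1.mul_const e), cauchyAt_mul_const hsep r1] at e1
      have e3 := linSol_eq hJ h1 hsep hA x
      simp only [linSol_mul hJ h1, ← hU] at e3
      replace e3 := sub_eq_of_eq_add' e3
      have e4 : cauchyAt Γ (fun q => A q * J q) x = A x - 1 :=
        (sub_eq_of_eq_add' (hA x)).symm
      rw [← e3] at e1 ⊢
      rw [e4, e1]
      simp only [mul_sub, sub_mul, mul_add, add_mul, smul_mul_assoc, mul_smul_comm, mul_one,
        one_mul, mul_assoc]
      abel) x
  rw [← sub_eq_zero, ← key]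
  abel

/-- The Lax equation is multiplied by `zⁿ J` from the right and integrated. The term `linSol * e *
J` equals `z A e J`, so it cancels against the part of the second integral coming from `A * (z e
J)`; what survives is expressed in moments. -/
theorem moment_derivative {e : 𝔸} (he : SandwichZero J e) {A' : ContourPts ι →ᵇ 𝔸}
    (hA' : ∀ x, A' x = cauchyAt Γ (fun q => A' q * J q) x
      + cauchyAt Γ (fun q => A q * (contourPt Γ q • (e * J q - J q * e))) x) (n : ℕ) :
    totalInt Γ (fun q => contourPt Γ q ^ n • (A' q * J q))
      + totalInt Γ (fun q => contourPt Γ q ^ n • (A q * (contourPt Γ q • (e * J q - J q * e))))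
    = e * moment Γ A J (n + 1) - moment Γ A J (n + 1) * e
      + (moment Γ A J 0 * e - e * moment Γ A J 0) * moment Γ A J n := by
  have hpow : ∀ (n : ℕ) {φ : ContourPts ι → 𝔸}, RapidlyIntegrable Γ φ →
      RapidlyIntegrable Γ fun q => contourPt Γ q ^ n • φ q := fun n φ hφ => by
    induction n with
    | zero => simpa using hφ
    | succ n ih => simpa only [pow_succ', mul_smul] using ih.pt_smul
  have r0 := hJ.bounded_mul A
  rw [← totalInt_add (hpow n (hJ.bounded_mul A')) (hpow n
      ((((hJ.const_mul e).sub (hJ.mul_const e)).pt_smul).bounded_mul A)),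
    moment, moment, moment, ← totalInt_const_mul (hpow _ r0), ← totalInt_mul_const (hpow _ r0),
    ← totalInt_const_mul (hpow _ r0), ← totalInt_sub ((hpow _ r0).const_mul e)
      ((hpow _ r0).mul_const e),
    ← totalInt_add (((hpow _ r0).const_mul e).sub ((hpow _ r0).mul_const e))
      ((hpow _ r0).const_mul _)]
  refine totalInt_congr_ae fun a => ae_of_all _ fun s => ?_
  generalize (⟨a, s⟩ : ContourPts ι) = q
  rw [lax_parameter hJ h1 hsep hA huniq he hA' q, add_mul, sub_mul, mul_assoc e,
    linSol_mul_sandwich hJ he, linSol_mul hJ h1]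
  simp only [moment, smul_add, smul_sub, mul_sub, mul_smul_comm, smul_mul_assoc, smul_smul,
    pow_succ, mul_assoc]
  abel

/-- The identity obtained from differentiation along the contours, where `J' = [θ, J]` with
`θ = 3 z² t + 2 z y + x`. -/
theorem moment_identity {t y x : 𝔸} (ht : SandwichZero J t) (hy : SandwichZero J y)
    {J' : ContourPts ι → 𝔸} {A' : ContourPts ι →ᵇ 𝔸}
    (hJ' : ∀ q, J' q = ((3 * contourPt Γ q ^ 2) • t + (2 * contourPt Γ q) • y + x) * J q
      - J q * ((3 * contourPt Γ q ^ 2) • t + (2 * contourPt Γ q) • y + x))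
    (hA' : ∀ q, A' q = cauchyAt Γ (fun q => A' q * J q + A q * J' q) q)
    (hint : totalInt Γ (fun q => A' q * J q + A q * J' q) = 0) :
    (3 : ℂ) • ⁅moment Γ A J 2, t⁆ + (2 : ℂ) • ⁅moment Γ A J 1, y⁆ + ⁅moment Γ A J 0, x⁆
    = (3 : ℂ) • (⁅moment Γ A J 0, t⁆ * moment Γ A J 1)
      + (3 : ℂ) • (⁅moment Γ A J 1, t⁆ * moment Γ A J 0)
      + (2 : ℂ) • (⁅moment Γ A J 0, y⁆ * moment Γ A J 0)
      - (3 : ℂ) • (⁅moment Γ A J 0, t⁆ * moment Γ A J 0 * moment Γ A J 0) := by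
  set U₀ := moment Γ A J 0 with hU₀
  set U₁ := moment Γ A J 1 with hU₁
  set U₂ := moment Γ A J 2 with hU₂
  -- `K₁` and `K₀` are determined by matching powers of `z` in the inhomogeneous terms below: `K₁`
  -- removes the linear term, and `K₀` removes the constant term left after `K₁ * linSol` has
  -- contributed `K₁ U₀`.
  set K₁ : 𝔸 := (3 : ℂ) • ⁅U₀, t⁆ with hK₁
  set K₀ : 𝔸 := (3 : ℂ) • ⁅U₁, t⁆ + (2 : ℂ) • ⁅U₀, y⁆ - (3 : ℂ) • (⁅U₀, t⁆ * U₀) with hK₀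
  have rA := hJ.bounded_mul A
  have rA' := hJ.bounded_mul A'
  have rz : RapidlyIntegrable Γ fun q => contourPt Γ q • (A q * J q) := rA.pt_smul
  have rzz : RapidlyIntegrable Γ fun q => contourPt Γ q ^ 2 • (A q * J q) := by
    simpa only [pow_two, mul_smul] using rz.pt_smul
  have re : ∀ e : 𝔸, RapidlyIntegrable Γ fun q => A q * e * J q := fun e => by
    simpa only [mul_assoc] using (hJ.const_mul e).bounded_mul A
  -- the right multiple `A θ J - A' J - A J' = A J θ`
  set B : ContourPts ι → 𝔸 := fun q => (3 : ℂ) • ((contourPt Γ q ^ 2 • (A q * J q)) * t)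
    + (2 : ℂ) • ((contourPt Γ q • (A q * J q)) * y) + A q * J q * x with hB
  have rB : RapidlyIntegrable Γ B :=
    (((rzz.mul_const t).const_smul 3).add ((rz.mul_const y).const_smul 2)).add (rA.mul_const x)
  set D : ContourPts ι → 𝔸 := fun q => A' q * J q + A q * J' q with hD
  have hDB : ∀ q, D q + B q = A' q * J q + (3 : ℂ) • (contourPt Γ q ^ 2 • (A q * t * J q))
      + (2 : ℂ) • (contourPt Γ q • (A q * y * J q)) + A q * x * J q := fun q => by
    simp only [hD, hB, hJ', mul_sub, mul_add, add_mul, smul_mul_assoc, mul_smul_comm, mul_assoc,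
      mul_smul]
    abel
  have rDB : RapidlyIntegrable Γ fun q => D q + B q := by
    simp only [hDB]
    refine ((rA'.add (RapidlyIntegrable.const_smul ?_ 3)).add
      (((re y).pt_smul).const_smul 2)).add (re x)
    simpa only [pow_two, mul_smul] using (re t).pt_smul.pt_smul
  have rD : RapidlyIntegrable Γ D := by simpa using rDB.sub rB
  -- the combination that solves the homogeneous equation
  set L : ContourPts ι → 𝔸 := fun q => (3 : ℂ) • (t * quadSol Γ A J q)
    + (2 : ℂ) • (y * linSol Γ A J q) + x * A q + K₁ * linSol Γ A J q + K₀ * A q with hL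
  set α : ContourPts ι → 𝔸 := fun q => A' q + (3 : ℂ) • (quadSol Γ A J q * t)
    + (2 : ℂ) • (linSol Γ A J q * y) + A q * x - L q with hα
  set LJ : ContourPts ι → 𝔸 := fun q => (3 : ℂ) • (t * (contourPt Γ q ^ 2 • (A q * J q)))
    + (2 : ℂ) • (y * (contourPt Γ q • (A q * J q))) + x * (A q * J q)
    + K₁ * (contourPt Γ q • (A q * J q)) + K₀ * (A q * J q) with hLJ
  have hLmul : ∀ q, L q * J q = LJ q := fun q => by
    simp only [hL, hLJ, add_mul, smul_mul_assoc, mul_assoc, quadSol_mul hJ h1, linSol_mul hJ h1]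
  have rt := (rzz.const_mul t).const_smul 3
  have ry := (rz.const_mul y).const_smul 2
  have rx := rA.const_mul x
  have r1 := rz.const_mul K₁
  have r0 := rA.const_mul K₀
  have rLJ : RapidlyIntegrable Γ LJ := (((rt.add ry).add rx).add r1).add r0
  have hαmul : ∀ q, α q * J q = (D q + B q) - LJ q := fun q => by
    rw [hDB]
    simp only [hα, sub_mul, hLmul, add_mul, smul_mul_assoc, quadSol_mul_sandwich hJ ht,
      linSol_mul_sandwich hJ hy]
  have smulC : ∀ (c : ℂ) (φ : ContourPts ι → 𝔸) (q : ContourPts ι),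
      cauchyAt Γ (fun q => c • φ q) q = c • cauchyAt Γ φ q := fun c φ q => by
    simp only [cauchyAt, cauchyInt, smul_comm _ c, totalInt_const_smul]
  -- The polynomial parts `z² + z U₀ + U₁`, `z + U₀` and `1` of the three solutions cancel in `α`,
  -- so `α` solves the homogeneous equation.
  have hzero : ∀ q, α q = 0 := by
    refine huniq α (by simp only [hαmul]; exact rDB.sub rLJ) fun q => ?_
    simp only [hαmul]
    rw [cauchyAt_sub hsep rDB rLJ, cauchyAt_add hsep rD rB, ← hA' q, hB,
      cauchyAt_add hsep (((rzz.mul_const t).const_smul 3).add ((rz.mul_const y).const_smul 2))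
        (rA.mul_const x),
      cauchyAt_add hsep ((rzz.mul_const t).const_smul 3) ((rz.mul_const y).const_smul 2),
      smulC, smulC, cauchyAt_mul_const hsep rzz, cauchyAt_mul_const hsep rz,
      cauchyAt_mul_const hsep rA, hLJ, cauchyAt_add hsep (((rt.add ry).add rx).add r1) r0,
      cauchyAt_add hsep ((rt.add ry).add rx) r1, cauchyAt_add hsep (rt.add ry) rx,
      cauchyAt_add hsep rt ry, smulC, smulC, cauchyAt_const_mul hsep rzz,
      cauchyAt_const_mul hsep rz, cauchyAt_const_mul hsep rA, cauchyAt_const_mul hsep rz,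
      cauchyAt_const_mul hsep rA]
    have e1 := linSol_eq hJ h1 hsep hA q
    simp only [linSol_mul hJ h1, ← hU₀] at e1
    have e2 := quadSol_eq hJ h1 hsep hA q
    simp only [quadSol_mul hJ h1, ← hU₀, ← hU₁] at e2
    replace e1 := sub_eq_of_eq_add' e1
    replace e2 := sub_eq_of_eq_add' e2
    rw [← e1, ← e2, (sub_eq_of_eq_add' (hA q)).symm]
    simp only [hα, hL, hK₁, hK₀, Ring.lie_def, mul_sub, sub_mul, mul_add, add_mul, smul_sub,
      smul_add, smul_mul_assoc, mul_smul_comm, mul_one, one_mul, mul_assoc, smul_smul]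
    module
  -- Integrating `α J = 0` gives the identity: the total derivative `D` integrates to zero, and both
  -- remaining terms are combinations of moments.
  have hfin : totalInt Γ B = totalInt Γ LJ := by
    have h2 : totalInt Γ (fun q => (D q + B q) - LJ q) = 0 := by
      simp only [← hαmul, hzero, zero_mul]
      simp [totalInt, pathInt]
    rwa [totalInt_sub rDB rLJ, totalInt_add rD rB, hint, zero_add, sub_eq_zero] at h2
  rw [hB, totalInt_add (((rzz.mul_const t).const_smul 3).add ((rz.mul_const y).const_smul 2))
      (rA.mul_const x),
    totalInt_add ((rzz.mul_const t).const_smul 3) ((rz.mul_const y).const_smul 2),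
    totalInt_const_smul, totalInt_const_smul, totalInt_mul_const rzz, totalInt_mul_const rz,
    totalInt_mul_const rA, hLJ, totalInt_add (((rt.add ry).add rx).add r1) r0,
    totalInt_add ((rt.add ry).add rx) r1, totalInt_add (rt.add ry) rx,
    totalInt_add rt ry, totalInt_const_smul, totalInt_const_smul, totalInt_const_mul rzz,
    totalInt_const_mul rz, totalInt_const_mul rA, totalInt_const_mul rz,
    totalInt_const_mul rA] at hfin
  have m0 : totalInt Γ (fun q => A q * J q) = U₀ := by simp [hU₀, moment]
  have m1 : totalInt Γ (fun q => contourPt Γ q • (A q * J q)) = U₁ := by simp [hU₁, moment]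
  have m2 : totalInt Γ (fun q => contourPt Γ q ^ 2 • (A q * J q)) = U₂ := rfl
  rw [m0, m1, m2] at hfin
  simp only [hK₁, hK₀, Ring.lie_def, sub_mul, add_mul, smul_sub, smul_mul_assoc,
    mul_assoc] at hfin ⊢
  rw [← sub_eq_zero, ← sub_eq_zero.2 hfin]
  module

end sandwich

end Lax
end

/-! ### The matrix `J`: sandwich property, derivatives and decay. -/

noncomputable section

attribute [local instance] Matrix.linftyOpNormedRing Matrix.linftyOpNormedAlgebra

section MatrixNorm

variable {n : Type*} [Fintype n] [DecidableEq n]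

theorem matrix_norm_le_sum (M : Matrix n n ℂ) : ‖M‖ ≤ ∑ i, ∑ j, ‖M i j‖ := by
  have h : (Finset.univ.sup fun i => ∑ j, ‖M i j‖₊) ≤ ∑ i, ∑ j, ‖M i j‖₊ :=
    Finset.sup_le fun i _ => Finset.single_le_sum (f := fun i => ∑ j, ‖M i j‖₊)
      (fun _ _ => zero_le) (Finset.mem_univ i)
  rw [Matrix.linfty_opNorm_def]
  simpa [NNReal.coe_sum] using NNReal.coe_le_coe.2 h

theorem hasDerivAt_matrix {f : ℂ → Matrix n n ℂ} {f' : Matrix n n ℂ} {z : ℂ}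
    (h : ∀ i j, HasDerivAt (fun w => f w i j) (f' i j) z) : HasDerivAt f f' z := by
  have h1 : ∀ M : Matrix n n ℂ, M = ∑ i, ∑ j, M i j • Matrix.single i j (1 : ℂ) := fun M => by
    conv_lhs => rw [Matrix.matrix_eq_sum_single M]
    simp [Matrix.smul_single]
  rw [h1 f', show f = fun w => ∑ i, ∑ j, f w i j • Matrix.single i j (1 : ℂ) from
    funext fun w => h1 (f w)]
  exact HasDerivAt.fun_sum fun i _ => HasDerivAt.fun_sum fun j _ => (h i j).smul_const _

end MatrixNorm

section Jump

variable {m : ℕ} {ι : Type*}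

/-- The exponents of `Δ`, with complex `x`. -/
def phase (x : Fin m → ℂ) (y t : Fin m → ℝ) (z : ℂ) : Fin m ⊕ Unit → ℂ :=
  Sum.elim (fun j => (t j : ℂ) * z ^ 3 + (y j : ℂ) * z ^ 2 + x j * z) (fun _ => 0)

/-- The matrix `Δ F Gᵀ Δ⁻¹` on the contour with index `a`. -/
def jump (F G : ι → Fin m ⊕ Unit → ℂ) (x : Fin m → ℂ) (y t : Fin m → ℝ) (a : ι) (z : ℂ) :
    Matrix (Fin m ⊕ Unit) (Fin m ⊕ Unit) ℂ :=
  Matrix.of fun l k => Complex.exp (phase x y t z l - phase x y t z k) * (F a l * G a k)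

/-- The matrix `jump` at the points of the contours. -/
def jumpAt (Γ : ι → SimpleContour) (F G : ι → Fin m ⊕ Unit → ℂ) (x : Fin m → ℂ)
    (y t : Fin m → ℝ) (q : ContourPts ι) : Matrix (Fin m ⊕ Unit) (Fin m ⊕ Unit) ℂ :=
  jump F G x y t q.1 (contourPt Γ q)

/-- The diagonal matrix `diag(v, 0)`. -/
def padDiag (v : Fin m → ℂ) : Matrix (Fin m ⊕ Unit) (Fin m ⊕ Unit) ℂ :=
  Matrix.diagonal (Sum.elim v fun _ => 0)

theorem padZero_realDiag (v : Fin m → ℝ) : padZero (realDiag v) = padDiag fun k => (v k : ℂ) := by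
  rw [padZero, realDiag, padDiag, ← Matrix.fromBlocks_diagonal]
  congr 1

variable {Γ : ι → SimpleContour} {F G : ι → Fin m ⊕ Unit → ℂ} {x x₀ : Fin m → ℂ}
  {y t : Fin m → ℝ}

/-- `J` has rank one with constant vectors up to exponentials, and the inner sum pairs `G_j` with
`F_j` of the same contour, so every summand contains `F_j G_j = 0`. -/
theorem jumpAt_sandwichZero (hFG : ∀ a i, F a i * G a i = 0) (d : Fin m ⊕ Unit → ℂ) :
    SandwichZero (jumpAt Γ F G x y t) (Matrix.diagonal d) := by
  intro p q hpq
  ext l k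
  rw [Matrix.mul_apply]
  refine Finset.sum_eq_zero fun j _ => ?_
  rw [Matrix.mul_diagonal]
  simp only [jumpAt, jump, Matrix.of_apply, hpq]
  linear_combination (Complex.exp (phase x y t (contourPt Γ p) l - phase x y t (contourPt Γ p) j) *
    F q.1 l * d j * Complex.exp (phase x y t (contourPt Γ q) j - phase x y t (contourPt Γ q) k) *
    G q.1 k) * hFG q.1 j

theorem hasDerivAt_phase (z : ℂ) (l : Fin m ⊕ Unit) :
    HasDerivAt (fun w => phase x y t w l) (3 * z ^ 2 * (Sum.elim (fun k => (t k : ℂ))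
      (fun _ => 0) l : ℂ) + 2 * z * (Sum.elim (fun k => (y k : ℂ)) (fun _ => 0) l : ℂ)
      + Sum.elim x (fun _ => 0) l) z := by
  rcases l with j | j
  · simp only [phase, Sum.elim_inl]
    refine ((((hasDerivAt_pow 3 z).const_mul (t j : ℂ)).add
      ((hasDerivAt_pow 2 z).const_mul (y j : ℂ))).add
      ((hasDerivAt_id z).const_mul (x j))).congr_deriv ?_
    push_cast
    ring
  · simpa [phase] using hasDerivAt_const z (0 : ℂ)

/-- The derivative of `jump` along the contours. -/
def jumpDeriv (F G : ι → Fin m ⊕ Unit → ℂ) (x : Fin m → ℂ) (y t : Fin m → ℝ) (a : ι) (z : ℂ) :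
    Matrix (Fin m ⊕ Unit) (Fin m ⊕ Unit) ℂ :=
  ((3 * z ^ 2) • padDiag (fun k => (t k : ℂ)) + (2 * z) • padDiag (fun k => (y k : ℂ)) + padDiag x)
      * jump F G x y t a z
    - jump F G x y t a z * ((3 * z ^ 2) • padDiag (fun k => (t k : ℂ))
      + (2 * z) • padDiag (fun k => (y k : ℂ)) + padDiag x)

theorem hasDerivAt_jump (a : ι) (z : ℂ) :
    HasDerivAt (jump F G x y t a) (jumpDeriv F G x y t a z) z := by
  refine hasDerivAt_matrix fun l k => ?_
  have h := (((hasDerivAt_phase (x := x) (y := y) (t := t) z l).sub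
    (hasDerivAt_phase (x := x) (y := y) (t := t) z k)).cexp).mul_const (F a l * G a k)
  refine h.congr_deriv ?_
  simp only [jumpDeriv, padDiag, jump, add_mul, mul_add, smul_mul_assoc, mul_smul_comm,
    Matrix.sub_apply, Matrix.add_apply, Matrix.smul_apply, Matrix.diagonal_mul,
    Matrix.mul_diagonal, Matrix.of_apply, smul_eq_mul, Pi.sub_apply]
  ring

theorem continuous_jumpAt : Continuous (jumpAt Γ F G x y t) :=
  continuous_sigma fun a =>
    (continuous_iff_continuousAt.2 fun z => (hasDerivAt_jump a z).continuousAt).comp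
      (Γ a).continuous_param

/-- The sum of the moduli of the entries of `jumpAt`. -/
def jumpSize (Γ : ι → SimpleContour) (F G : ι → Fin m ⊕ Unit → ℂ) (x : Fin m → ℂ)
    (y t : Fin m → ℝ) (q : ContourPts ι) : ℝ :=
  ∑ l, ∑ k, ‖jumpAt Γ F G x y t q l k‖

theorem continuous_jumpSize : Continuous (jumpSize Γ F G x y t) := by
  refine continuous_finsetSum _ fun l _ => continuous_finsetSum _ fun k _ => ?_
  simp only [jumpAt, jump, Matrix.of_apply]
  refine (Continuous.mul ?_ ?_).norm
  · have hph : ∀ l, Continuous fun z => phase x y t z l := fun l =>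
      continuous_iff_continuousAt.2 fun z => (hasDerivAt_phase z l).continuousAt
    exact Complex.continuous_exp.comp
      (((hph l).comp (continuous_contourPt Γ)).sub ((hph k).comp (continuous_contourPt Γ)))
  · exact continuous_sigma fun a =>
      (continuous_const : Continuous fun _ : ℝ => F a l * G a k)

theorem jumpSize_nonneg (q : ContourPts ι) : 0 ≤ jumpSize Γ F G x y t q :=
  Finset.sum_nonneg fun _ _ => Finset.sum_nonneg fun _ _ => norm_nonneg _

/-- One term of the series of `exp(δ r)` bounds `rⁿ`, so powers are absorbed by doubling the
exponential rate. -/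
theorem pow_mul_exp_le {δ : ℝ} (hδ : 0 < δ) (n : ℕ) {r : ℝ} (hr : 0 ≤ r) :
    r ^ n * Real.exp (δ * r) ≤ (n.factorial / δ ^ n) * Real.exp (2 * δ * r) := by
  have h1 := Real.pow_div_factorial_le_exp (δ * r) (by positivity) n
  have h2 : r ^ n ≤ (n.factorial / δ ^ n) * Real.exp (δ * r) := by
    rw [div_mul_eq_mul_div, le_div_iff₀ (by positivity)]
    rw [div_le_iff₀ (by positivity), mul_pow] at h1
    linarith
  calc _ ≤ (n.factorial / δ ^ n) * Real.exp (δ * r) * Real.exp (δ * r) := by gcongr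
    _ = _ := by rw [mul_assoc, ← Real.exp_add]; ring_nf

/-- Exponential decay along the contours. -/
def ExpDecaying (Γ : ι → SimpleContour) (δ : ℝ) (j : ContourPts ι → ℝ) : Prop :=
  (∀ a, IntegrableOn (fun s => Real.exp (δ * ‖(Γ a).param s‖) *
    (‖deriv (Γ a).param s‖ * j ⟨a, s⟩)) (Γ a).dom) ∧
  ∀ a, (Γ a).dom = Set.univ → ∃ C, ∀ s, Real.exp (δ * ‖(Γ a).param s‖) * j ⟨a, s⟩ ≤ C

theorem ExpDecaying.rapidlyIntegrable {E : Type*} [NormedAddCommGroup E] [NormedSpace ℂ E]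
    {δ : ℝ} (hδ : 0 < δ) {j : ContourPts ι → ℝ} (hj : ExpDecaying Γ (2 * δ) j)
    (hj0 : ∀ q, 0 ≤ j q) {ψ : ContourPts ι → E} (hψ : Continuous ψ) {C : ℝ}
    (hle : ∀ q, ‖ψ q‖ ≤ C * Real.exp (δ * ‖contourPt Γ q‖) * j q) : RapidlyIntegrable Γ ψ := by
  intro n a
  have hc := (Γ a).continuous_param
  have hψc : Continuous fun s : ℝ => ψ ⟨a, s⟩ := hψ.comp continuous_sigmaMk
  refine Integrable.mono' (((hj.1 a).const_mul (n.factorial / δ ^ n)).const_mul |C|)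
    (AEStronglyMeasurable.smul (Continuous.aestronglyMeasurable (by fun_prop))
      ((measurable_deriv _).aestronglyMeasurable.smul hψc.aestronglyMeasurable))
    (ae_of_all _ fun s => ?_)
  have h1 := pow_mul_exp_le hδ n (norm_nonneg ((Γ a).param s))
  have h2 := hle ⟨a, s⟩
  have h0 := hj0 ⟨a, s⟩
  simp only [contourPt] at h2
  rw [norm_smul, norm_smul, norm_pow]
  calc _ ≤ ‖(Γ a).param s‖ ^ n * (‖deriv (Γ a).param s‖ *
        (|C| * Real.exp (δ * ‖(Γ a).param s‖) * j ⟨a, s⟩)) := by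
        gcongr
        refine h2.trans ?_
        gcongr
        exact le_abs_self C
    _ = |C| * (‖(Γ a).param s‖ ^ n * Real.exp (δ * ‖(Γ a).param s‖)) *
        (‖deriv (Γ a).param s‖ * j ⟨a, s⟩) := by ring
    _ ≤ |C| * ((n.factorial / δ ^ n) * Real.exp (2 * δ * ‖(Γ a).param s‖)) *
        (‖deriv (Γ a).param s‖ * j ⟨a, s⟩) := by gcongr
    _ = _ := by ring

/-- An integrable function need not tend to zero; here the pointwise part of `ExpDecaying` is used,
together with the fact that the contour leaves every compact set. It supplies the vanishing boundary
terms. -/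
theorem ExpDecaying.tendsto_zero {E : Type*} [NormedAddCommGroup E] {δ : ℝ} (hδ : 0 < δ)
    {j : ContourPts ι → ℝ} (hj : ExpDecaying Γ δ j) {a : ι} (ha : (Γ a).dom = Set.univ)
    {ψ : ℝ → E} {C : ℝ} (hle : ∀ s, ‖ψ s‖ ≤ C * j ⟨a, s⟩) (hC : 0 ≤ C) :
    Tendsto ψ (cocompact ℝ) (𝓝 0) := by
  obtain ⟨B, hB⟩ := hj.2 a ha
  have h1 : Tendsto (fun s => δ * ‖(Γ a).param s‖) (cocompact ℝ) atTop :=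
    ((tendsto_norm_cocompact_atTop).comp
      ((Γ a).tendsto_cocompact_of_dom_eq_univ ha)).const_mul_atTop hδ
  have h2 := (Real.tendsto_exp_neg_atTop_nhds_zero.comp h1).const_mul (C * B)
  rw [mul_zero] at h2
  refine squeeze_zero_norm (fun s => (hle s).trans ?_) h2
  rw [mul_assoc]
  gcongr
  rw [Function.comp_apply, Real.exp_neg, ← div_eq_mul_inv, le_div_iff₀ (Real.exp_pos _), mul_comm]
  exact hB s

theorem phase_sub (z : ℂ) (l : Fin m ⊕ Unit) :
    phase x y t z l = phase x₀ y t z l + z * Sum.elim (x - x₀) (fun _ => 0) l := by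
  rcases l with j | j <;> simp [phase]
  ring

theorem norm_elim_le (h : Fin m → ℂ) (l : Fin m ⊕ Unit) :
    ‖(Sum.elim h (fun _ => 0) l : ℂ)‖ ≤ ‖h‖ := by
  rcases l with j | j
  · exact norm_le_pi_norm h j
  · simp

theorem norm_elim_sub_le (h : Fin m → ℂ) (l k : Fin m ⊕ Unit) :
    ‖(Sum.elim h (fun _ => 0) l - Sum.elim h (fun _ => 0) k : ℂ)‖ ≤ 2 * ‖h‖ := by
  have h1 := norm_elim_le h l
  have h2 := norm_elim_le h k
  linarith [norm_sub_le (Sum.elim h (fun _ => 0) l : ℂ) (Sum.elim h (fun _ => 0) k)]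

theorem jumpAt_apply_eq (q : ContourPts ι) (l k : Fin m ⊕ Unit) :
    jumpAt Γ F G x y t q l k = jumpAt Γ F G x₀ y t q l k * Complex.exp (contourPt Γ q *
      (Sum.elim (x - x₀) (fun _ => 0) l - Sum.elim (x - x₀) (fun _ => 0) k)) := by
  simp only [jumpAt, jump, Matrix.of_apply, phase_sub (x := x) (x₀ := x₀)]
  rw [mul_right_comm, ← Complex.exp_add]
  ring_nf

/-- A change of `x`, also into the complex domain, multiplies each entry by at most `exp(2 ‖x - x₀‖
|z|)`, which uses up no more than half of the available decay. -/
theorem rapidlyIntegrable_jumpAt {δ : ℝ} (hδ : 0 < δ)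
    (hj : ExpDecaying Γ (2 * δ) (jumpSize Γ F G x₀ y t)) (hx : 2 * ‖x - x₀‖ ≤ δ) :
    RapidlyIntegrable Γ (jumpAt Γ F G x y t) := by
  refine hj.rapidlyIntegrable hδ jumpSize_nonneg continuous_jumpAt (C := 1) fun q => ?_
  refine (matrix_norm_le_sum _).trans ?_
  rw [jumpSize, Finset.mul_sum]
  refine Finset.sum_le_sum fun l _ => ?_
  rw [Finset.mul_sum]
  refine Finset.sum_le_sum fun k _ => ?_
  rw [jumpAt_apply_eq (x := x) (x₀ := x₀), norm_mul, mul_comm, one_mul]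
  gcongr
  refine (Complex.norm_exp_le_exp_norm _).trans (Real.exp_le_exp.2 ?_)
  rw [norm_mul, mul_comm]
  gcongr
  exact (norm_elim_sub_le _ _ _).trans hx

/-- The derivative of `jumpAt` with respect to `x_j`. -/
def jumpParamDeriv (Γ : ι → SimpleContour) (F G : ι → Fin m ⊕ Unit → ℂ) (x : Fin m → ℂ)
    (y t : Fin m → ℝ) (j : Fin m) (q : ContourPts ι) : Matrix (Fin m ⊕ Unit) (Fin m ⊕ Unit) ℂ :=
  contourPt Γ q • (padDiag (Pi.single j 1) * jumpAt Γ F G x y t q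
    - jumpAt Γ F G x y t q * padDiag (Pi.single j 1))

theorem sum_smul_jumpParamDeriv (h : Fin m → ℂ) (q : ContourPts ι) (l k : Fin m ⊕ Unit) :
    (∑ j, h j • jumpParamDeriv Γ F G x y t j q) l k = jumpAt Γ F G x y t q l k *
      (contourPt Γ q * (Sum.elim h (fun _ => 0) l - Sum.elim h (fun _ => 0) k)) := by
  have h1 : ∀ l : Fin m ⊕ Unit,
      ∑ j, h j * (Sum.elim (Pi.single j (1 : ℂ)) (fun _ => 0) l : ℂ) = Sum.elim h (fun _ => 0) l := by
    rintro (l | l) <;> simp [Pi.single_apply]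
  rw [Matrix.sum_apply]
  simp only [jumpParamDeriv, padDiag, Matrix.smul_apply, Matrix.sub_apply, Matrix.diagonal_mul,
    Matrix.mul_diagonal, smul_eq_mul, ← h1]
  rw [← Finset.sum_sub_distrib, Finset.mul_sum, Finset.mul_sum]
  exact Finset.sum_congr rfl fun j _ => by ring

theorem rapidlyIntegrable_jumpParamDeriv (hJ : RapidlyIntegrable Γ (jumpAt Γ F G x y t))
    (j : Fin m) : RapidlyIntegrable Γ (jumpParamDeriv Γ F G x y t j) :=
  ((hJ.const_mul _).sub (hJ.mul_const _)).pt_smul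

variable [Fintype ι] {X : Type*} [TopologicalSpace X] [FirstCountableTopology X]

open scoped BoundedContinuousFunction in
theorem hasFDerivAt_kernelOp_jumpAt {C : ℝ} {N : ℕ} {k : X → ContourPts ι → ℂ}
    (hk : IsModerateKernel Γ C N k) {δ : ℝ} (hδ : 0 < δ)
    (hj : ExpDecaying Γ (2 * δ) (jumpSize Γ F G x₀ y t)) :
    HasFDerivAt (𝕜 := ℂ) (E := Fin m → ℂ)
      (F := (ContourPts ι →ᵇ Matrix (Fin m ⊕ Unit) (Fin m ⊕ Unit) ℂ) →L[ℂ]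
        (X →ᵇ Matrix (Fin m ⊕ Unit) (Fin m ⊕ Unit) ℂ))
      (fun x => kernelOp hk (jumpAt Γ F G x y t))
      (∑ j, (ContinuousLinearMap.proj (R := ℂ) j : (Fin m → ℂ) →L[ℂ] ℂ).smulRight
        (kernelOp hk (jumpParamDeriv Γ F G x₀ y t j))) x₀ := by
  have hnear : ∀ᶠ x in 𝓝 x₀, 2 * ‖x - x₀‖ < δ / 2 := by
    have : Tendsto (fun x => 2 * ‖x - x₀‖) (𝓝 x₀) (𝓝 0) := by
      have h : Continuous fun x => 2 * ‖x - x₀‖ := by fun_prop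
      simpa using h.tendsto x₀
    exact this.eventually_lt_const (by positivity)
  -- The `4` comes from `(2 ‖x - x₀‖)²`; the rest is the cost of absorbing `|z|²` into `exp(δ |z| /
  -- 2)`. The outcome grows like `exp(δ |z|)`, half of the assumed rate.
  set B : ℝ := 4 * ((2 : ℕ).factorial / (δ / 2) ^ 2) with hB
  have hB0 : 0 ≤ B := by positivity
  have hΨc : Continuous fun q => ((B * Real.exp (δ * ‖contourPt Γ q‖) *
      jumpSize Γ F G x₀ y t q : ℝ) : ℂ) := by
    have := continuous_jumpSize (Γ := Γ) (F := F) (G := G) (x := x₀) (y := y) (t := t)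
    fun_prop
  refine hasFDerivAt_kernelOp hk (Ψ := fun q => ((B * Real.exp (δ * ‖contourPt Γ q‖) *
      jumpSize Γ F G x₀ y t q : ℝ) : ℂ)) ?_ ?_ ?_ ?_
  · filter_upwards [hnear] with x hx
    exact rapidlyIntegrable_jumpAt hδ hj (by linarith)
  · exact fun j => rapidlyIntegrable_jumpParamDeriv
      (rapidlyIntegrable_jumpAt hδ hj (by simpa using hδ.le)) j
  · refine hj.rapidlyIntegrable hδ jumpSize_nonneg hΨc (C := B) fun q => ?_
    have := jumpSize_nonneg (Γ := Γ) (F := F) (G := G) (x := x₀) (y := y) (t := t) q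
    rw [Complex.norm_real, Real.norm_of_nonneg (by positivity)]
  · filter_upwards [hnear] with x hx q
    have h0 := jumpSize_nonneg (Γ := Γ) (F := F) (G := G) (x := x₀) (y := y) (t := t) q
    rw [Complex.norm_real, Real.norm_of_nonneg (by positivity)]
    refine (matrix_norm_le_sum _).trans ?_
    rw [jumpSize, Finset.mul_sum, Finset.mul_sum]
    refine Finset.sum_le_sum fun l _ => ?_
    rw [Finset.mul_sum, Finset.mul_sum]
    refine Finset.sum_le_sum fun i _ => ?_
    rw [Matrix.sub_apply, Matrix.sub_apply]
    have h1 := sum_smul_jumpParamDeriv (Γ := Γ) (F := F) (G := G) (x := x₀) (y := y) (t := t)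
      (x - x₀) q l i
    simp only [Pi.sub_apply] at h1
    rw [h1, jumpAt_apply_eq (x := x) (x₀ := x₀)]
    set ζ := contourPt Γ q * (Sum.elim (x - x₀) (fun _ => 0) l - Sum.elim (x - x₀) (fun _ => 0) i)
      with hζ
    -- Second order Taylor remainder of the exponential by which the entry changes.
    have h2 := Complex.norm_exp_sub_sum_le_norm_mul_exp ζ 2
    simp only [Finset.sum_range_succ, Finset.sum_range_zero, pow_zero, pow_one,
      Nat.factorial_zero, Nat.factorial_one, Nat.cast_one, div_one, zero_add] at h2
    have h3 : ‖ζ‖ ≤ ‖contourPt Γ q‖ * (2 * ‖x - x₀‖) := by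
      rw [hζ, norm_mul]
      gcongr
      exact norm_elim_sub_le _ _ _
    have h4 : ‖ζ‖ ≤ δ / 2 * ‖contourPt Γ q‖ := by
      rw [mul_comm (δ / 2)]
      exact h3.trans (by gcongr)
    have h5 := pow_mul_exp_le (half_pos hδ) 2 (norm_nonneg (contourPt Γ q))
    have h6 : jumpAt Γ F G x₀ y t q l i * Complex.exp ζ - jumpAt Γ F G x₀ y t q l i
        - jumpAt Γ F G x₀ y t q l i * ζ
        = jumpAt Γ F G x₀ y t q l i * (Complex.exp ζ - (1 + ζ)) := by ring
    rw [h6, norm_mul]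
    calc _ ≤ ‖jumpAt Γ F G x₀ y t q l i‖ * ((‖contourPt Γ q‖ * (2 * ‖x - x₀‖)) ^ 2 *
          Real.exp (δ / 2 * ‖contourPt Γ q‖)) := by
          gcongr
          refine h2.trans ?_
          gcongr
      _ = ‖jumpAt Γ F G x₀ y t q l i‖ * (4 * ‖x - x₀‖ ^ 2) * (‖contourPt Γ q‖ ^ 2 *
          Real.exp (δ / 2 * ‖contourPt Γ q‖)) := by ring
      _ ≤ ‖jumpAt Γ F G x₀ y t q l i‖ * (4 * ‖x - x₀‖ ^ 2) * ((2 : ℕ).factorial / (δ / 2) ^ 2 *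
          Real.exp (2 * (δ / 2) * ‖contourPt Γ q‖)) := by gcongr
      _ = _ := by
          rw [hB, mul_div_cancel₀ δ two_ne_zero]
          ring

end Jump
end

/-! ### Decay from square integrability on an open parameter set. -/

noncomputable section

attribute [local instance] Matrix.linftyOpNormedRing Matrix.linftyOpNormedAlgebra

section Restrict

variable {ι : Type*} [Fintype ι] {Γ : ι → SimpleContour}

theorem arcLength_le_arcMeasure (a : ι) : (Γ a).arcLength ≤ arcMeasure Γ :=
  Finset.single_le_sum (f := fun a => (Γ a).arcLength) (fun _ _ => Measure.zero_le _)
    (Finset.mem_univ a)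

theorem ae_param_of_ae_arcMeasure {P : ℂ → Prop} (h : ∀ᵐ u ∂arcMeasure Γ, P u) (a : ι) :
    ∀ᵐ s ∂volume.restrict (Γ a).dom, P (contourPt Γ ⟨a, s⟩) :=
  (Γ a).ae_of_ae_arcLength (ae_mono (arcLength_le_arcMeasure a) h)

theorem integrableOn_of_integrable_arcMeasure {E : Type*} [NormedAddCommGroup E] [NormedSpace ℂ E]
    {φ : ℂ → E} (h : Integrable φ (arcMeasure Γ)) (a : ι) :
    IntegrableOn (fun s => deriv (Γ a).param s • φ ((Γ a).param s)) (Γ a).dom :=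
  (Γ a).integrableOn_of_integrable_arcLength (h.mono_measure (arcLength_le_arcMeasure a))

theorem contourIntegral_eq_totalInt (φ : ℂ → ℂ) :
    contourIntegral Γ φ = totalInt Γ (fun q => φ (contourPt Γ q)) := by
  simp only [contourIntegral, totalInt, pathInt, contourPt, smul_eq_mul, mul_comm]

end Restrict

section StronglyCubic

variable {m : ℕ} {ι : Type*} [Fintype ι] {Γ : ι → SimpleContour}
  {F G : ℂ → Fin m ⊕ Unit → ℂ} {c : ℂ → ℂ} {P : Params m}
  {H : ContourL2 Γ →L[ℂ] ContourL2 Γ}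

/-- The constant values of a function on the contours. -/
def contourValue (Γ : ι → SimpleContour) (F : ℂ → Fin m ⊕ Unit → ℂ) (a : ι) :
    Fin m ⊕ Unit → ℂ := F ((Γ a).param 0)

namespace IsStronglyCubicIntegrable

variable (h : IsStronglyCubicIntegrable Γ F G c P H)
include h

theorem eq_contourValue (q : ContourPts ι) : F (contourPt Γ q) = contourValue Γ F q.1 ∧
    G (contourPt Γ q) = contourValue Γ G q.1 := by
  have h0 := (Γ q.1).param_mem_trace 0
  have h1 := (Γ q.1).isPreconnected_trace.subset_connectedComponentIn h0
    (trace_subset_omega Γ q.1) ((Γ q.1).param_mem_trace q.2)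
  exact h.const_on_components _ (trace_subset_omega Γ q.1 h0) _ h1

theorem contourValue_mul_eq_zero (a : ι) (i : Fin m ⊕ Unit) :
    contourValue Γ F a i * contourValue Γ G a i = 0 :=
  h.mul_eq_zero _ (trace_subset_omega Γ a ((Γ a).param_mem_trace 0)) i

theorem mul_eq_jumpAt (q : ContourPts ι) (l k : Fin m ⊕ Unit) :
    cubicF F c P (contourPt Γ q) l * cubicG G c P (contourPt Γ q) k
      = jumpAt Γ (contourValue Γ F) (contourValue Γ G) (fun j => (P.1 j : ℂ)) P.2.1 P.2.2 q l k := by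
  have hc := h.c_ne_zero _ (trace_subset_omega Γ q.1 ((Γ q.1).param_mem_trace q.2))
  change c (contourPt Γ q) ≠ 0 at hc
  have hΔ : ∀ i, cubicDelta P (contourPt Γ q) i = Complex.exp
      (phase (fun j => (P.1 j : ℂ)) P.2.1 P.2.2 (contourPt Γ q) i) := by
    rintro (i | i) <;> simp [cubicDelta, phase]
  simp only [cubicF, cubicG, hΔ, jumpAt, jump, Matrix.of_apply, (h.eq_contourValue q).1,
    (h.eq_contourValue q).2, Complex.exp_sub]
  field_simp

theorem integrableOn_jumpAt (a : ι) (l k : Fin m ⊕ Unit) :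
    IntegrableOn (fun s => deriv (Γ a).param s • jumpAt Γ (contourValue Γ F) (contourValue Γ G)
      (fun j => (P.1 j : ℂ)) P.2.1 P.2.2 ⟨a, s⟩ l k) (Γ a).dom := by
  have h1 := integrableOn_of_integrable_arcMeasure
    ((h.f_mem l).1.integrable_mul (h.g_mem k).1) a
  refine h1.congr (ae_of_all _ fun s => ?_)
  simp only [← h.mul_eq_jumpAt]
  rfl

/-- The hypothesis on `f` and `g` bounds the product almost everywhere. Continuity of `J` in the
parameter and density of sets of full measure extend the bound to every parameter of an infinite
contour. -/
theorem exists_norm_jumpAt_le {a : ι} (ha : (Γ a).dom = Set.univ) (l k : Fin m ⊕ Unit) :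
    ∃ C, ∀ s, ‖jumpAt Γ (contourValue Γ F) (contourValue Γ G)
      (fun j => (P.1 j : ℂ)) P.2.1 P.2.2 ⟨a, s⟩ l k‖ ≤ C := by
  have hb : ∀ {φ : ℂ → ℂ}, MemLp φ ∞ (arcMeasure Γ) →
      ∃ C : ℝ, 0 ≤ C ∧ ∀ᵐ s : ℝ, ‖φ (contourPt Γ ⟨a, s⟩)‖ ≤ C := fun {φ} hφ => by
    refine ⟨(eLpNorm φ ∞ (arcMeasure Γ)).toReal, ENNReal.toReal_nonneg, ?_⟩
    have h1 := ae_param_of_ae_arcMeasure (ae_le_eLpNormEssSup (f := φ) (μ := arcMeasure Γ)) a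
    rw [ha, Measure.restrict_univ] at h1
    filter_upwards [h1] with s hs
    rw [← eLpNorm_exponent_top] at hs
    have := ENNReal.toReal_mono hφ.2.ne hs
    simpa using this
  obtain ⟨C, hC, h1⟩ := hb (h.f_mem l).2
  obtain ⟨C', hC', h2⟩ := hb (h.g_mem k).2
  refine ⟨C * C', fun s => ?_⟩
  have hae : ∀ᵐ s : ℝ, ‖jumpAt Γ (contourValue Γ F) (contourValue Γ G)
      (fun j => (P.1 j : ℂ)) P.2.1 P.2.2 ⟨a, s⟩ l k‖ ≤ C * C' := by
    filter_upwards [h1, h2] with s hs hs'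
    rw [← h.mul_eq_jumpAt, norm_mul]
    gcongr
  have hcont : Continuous fun s : ℝ => ‖jumpAt Γ (contourValue Γ F) (contourValue Γ G)
      (fun j => (P.1 j : ℂ)) P.2.1 P.2.2 ⟨a, s⟩ l k‖ := by
    refine Continuous.norm ?_
    have h1 := (continuous_jumpAt (Γ := Γ) (F := contourValue Γ F) (G := contourValue Γ G)
      (x := fun j => (P.1 j : ℂ)) (y := P.2.1) (t := P.2.2)).comp
      (continuous_sigmaMk (σ := fun _ : ι => ℝ) (i := a))
    exact (LinearMap.toContinuousLinearMap
      (Matrix.entryLinearMap ℂ ℂ l k)).continuous.comp h1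
  have hd := (Measure.dense_of_ae hae).closure_eq
  rw [IsClosed.closure_eq (isClosed_le hcont continuous_const)] at hd
  exact (Set.ext_iff.1 hd s).2 trivial

end IsStronglyCubicIntegrable

/-- The real part of `z` alone gives no control in vertical directions, where `Re z²` takes over:
`(Im z)² = (Re z)² - Re z²`. Summing over the four choices of signs replaces the absolute values. -/
theorem exp_norm_le_sum {ε : ℝ} (hε : 0 ≤ ε) (z : ℂ) : Real.exp (ε / 2 * ‖z‖) ≤
    Real.exp (ε / 2) * ∑ b : Bool × Bool, Real.exp (ε * ((if b.1 then 1 else -1) * z.re +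
      (if b.2 then 1 else -1) * (z ^ 2).re)) := by
  have hz : ‖z‖ ≤ 2 * |z.re| + 1 + |(z ^ 2).re| := by
    have h1 : (z ^ 2).re = z.re ^ 2 - z.im ^ 2 := by simp [pow_two]
    have h2 : |z.im| ≤ |z.re| + 1 + |(z ^ 2).re| := by
      have h3 : z.im ^ 2 ≤ |z.re| ^ 2 + |(z ^ 2).re| := by
        rw [h1, sq_abs]
        linarith [neg_abs_le (z.re ^ 2 - z.im ^ 2)]
      refine abs_le_of_sq_le_sq ?_ (by positivity)
      nlinarith [abs_nonneg z.re, abs_nonneg (z ^ 2).re]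
    linarith [Complex.norm_le_abs_re_add_abs_im z]
  have hsg : ∀ r : ℝ, ∃ b : Bool, (if b then 1 else -1) * r = |r| := fun r => by
    rcases le_total 0 r with hr | hr
    · exact ⟨true, by simp [abs_of_nonneg hr]⟩
    · exact ⟨false, by simp [abs_of_nonpos hr]⟩
  obtain ⟨b₁, hb₁⟩ := hsg z.re
  obtain ⟨b₂, hb₂⟩ := hsg (z ^ 2).re
  calc Real.exp (ε / 2 * ‖z‖) ≤ Real.exp (ε / 2 + ε * (|z.re| + |(z ^ 2).re|)) := by
        refine Real.exp_le_exp.2 ?_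
        nlinarith [abs_nonneg (z ^ 2).re]
    _ = Real.exp (ε / 2) * Real.exp (ε * (|z.re| + |(z ^ 2).re|)) := Real.exp_add _ _
    _ ≤ _ := by
        gcongr
        rw [← hb₁, ← hb₂]
        exact Finset.single_le_sum (f := fun b : Bool × Bool => Real.exp (ε *
          ((if b.1 then 1 else -1) * z.re + (if b.2 then 1 else -1) * (z ^ 2).re)))
          (fun _ _ => (Real.exp_pos _).le) (Finset.mem_univ (b₁, b₂))

end StronglyCubic

section Decay

variable {m : ℕ} {ι : Type*} [Fintype ι] {Γ : ι → SimpleContour}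
  {F G : ℂ → Fin m ⊕ Unit → ℂ} {c : Params m → ℂ → ℂ}
  {H : Params m → (ContourL2 Γ →L[ℂ] ContourL2 Γ)} {U : Set (Params m)}

/-- Integrability and boundedness of `J` are known at every parameter of a neighbourhood in `(x,
y)`. A small shift there multiplies an off-diagonal entry by `exp(± η z ± η z²)`, and four such
shifts dominate `exp(η |z| / 2)`. -/
theorem exists_expDecaying
    (hU : ∀ t : Fin m → ℝ, IsOpen {w : (Fin m → ℝ) × (Fin m → ℝ) | (w.1, w.2, t) ∈ U})
    (hH : ∀ P ∈ U, IsStronglyCubicIntegrable Γ F G (c P) P (H P))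
    {x y t : Fin m → ℝ} (hP : (x, y, t) ∈ U) :
    ∃ δ : ℝ, 0 < δ ∧ ExpDecaying Γ (2 * δ) (jumpSize Γ (contourValue Γ F) (contourValue Γ G)
      (fun j => (x j : ℂ)) y t) := by
  obtain ⟨ε, hε, hball⟩ := Metric.isOpen_iff.1 (hU t) (x, y) hP
  set η := ε / 2 with hη
  have hη0 : 0 < η := half_pos hε
  have hmem : ∀ d₁ d₂ : Fin m → ℝ, ‖d₁‖ ≤ η → ‖d₂‖ ≤ η → (x + d₁, y + d₂, t) ∈ U := by
    intro d₁ d₂ h₁ h₂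
    refine hball (a := (x + d₁, y + d₂)) (Metric.mem_ball.2 ?_)
    rw [Prod.dist_eq, max_lt_iff]
    constructor
    · change dist (x + d₁) x < ε
      rw [dist_eq_norm, add_sub_cancel_left]; linarith
    · change dist (y + d₂) y < ε
      rw [dist_eq_norm, add_sub_cancel_left]; linarith
  set J : (Fin m → ℝ) → (Fin m → ℝ) → ContourPts ι → Matrix (Fin m ⊕ Unit) (Fin m ⊕ Unit) ℂ :=
    fun x y => jumpAt Γ (contourValue Γ F) (contourValue Γ G) (fun j => (x j : ℂ)) y t with hJ
  -- one can shift the exponent of an off-diagonal entry by `± η z ± η z²`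
  have hshift : ∀ l k : Fin m ⊕ Unit, l ≠ k → ∀ s₁ s₂ : ℝ, |s₁| ≤ η → |s₂| ≤ η →
      ∃ d₁ d₂ : Fin m → ℝ, ‖d₁‖ ≤ η ∧ ‖d₂‖ ≤ η ∧ ∀ q, J (x + d₁) (y + d₂) q l k =
        J x y q l k * Complex.exp (s₁ * contourPt Γ q + s₂ * contourPt Γ q ^ 2) := by
    have hn : ∀ (i : Fin m) (s : ℝ), |s| ≤ η → ‖(Pi.single i s : Fin m → ℝ)‖ ≤ η :=
      fun i s hs => by rwa [Pi.norm_single, Real.norm_eq_abs]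
    -- Entry `(l, k)` contains the difference of the exponents with indices `l` and `k`, so only one
    -- of them may be shifted. The last exponent is zero and carries no parameters; if it is the one
    -- at `l`, index `k` is shifted with the opposite sign.
    rintro (i | i) k hlk s₁ s₂ h₁ h₂
    · refine ⟨Pi.single i s₁, Pi.single i s₂, hn _ _ h₁, hn _ _ h₂, fun q => ?_⟩
      simp only [hJ, jumpAt, jump, Matrix.of_apply]
      rw [mul_right_comm, ← Complex.exp_add]
      congr 2
      rcases k with k | k
      · have : k ≠ i := fun h => hlk (by rw [h])
        simp [phase, this]
        ring
      · simp [phase]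
        ring
    · rcases k with k | k
      · refine ⟨Pi.single k (-s₁), Pi.single k (-s₂), hn _ _ (by rwa [abs_neg]),
          hn _ _ (by rwa [abs_neg]), fun q => ?_⟩
        simp only [hJ, jumpAt, jump, Matrix.of_apply]
        rw [mul_right_comm, ← Complex.exp_add]
        congr 2
        simp [phase]
        ring
      · exact absurd rfl hlk
  have hdom : ∀ l k : Fin m ⊕ Unit, ∃ d : Bool × Bool → (Fin m → ℝ) × (Fin m → ℝ),
      (∀ b, (x + (d b).1, y + (d b).2, t) ∈ U) ∧ ∀ q,
        Real.exp (η / 2 * ‖contourPt Γ q‖) * ‖J x y q l k‖ ≤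
          Real.exp (η / 2) * ∑ b, ‖J (x + (d b).1) (y + (d b).2) q l k‖ := by
    intro l k
    by_cases hlk : l = k
    · refine ⟨fun _ => 0, fun b => by simpa using hP, fun q => ?_⟩
      have h0 : J x y q l k = 0 := by
        simp only [hJ, jumpAt, jump, Matrix.of_apply, hlk, (hH _ hP).contourValue_mul_eq_zero,
          mul_zero]
      rw [h0, norm_zero, mul_zero]
      positivity
    · have h1 : ∀ b : Bool, |(if b then 1 else -1) * η| ≤ η := fun b => by
        cases b <;> simp [abs_of_pos hη0]
      choose d₁ d₂ hd₁ hd₂ hd using fun b : Bool × Bool =>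
        hshift l k hlk ((if b.1 then 1 else -1) * η) ((if b.2 then 1 else -1) * η)
          (h1 b.1) (h1 b.2)
      refine ⟨fun b => (d₁ b, d₂ b), fun b => hmem _ _ (hd₁ b) (hd₂ b), fun q => ?_⟩
      simp only [hd, norm_mul, ← Finset.mul_sum]
      rw [mul_left_comm, mul_comm]
      gcongr
      refine (exp_norm_le_sum hη0.le _).trans_eq ?_
      congr 1
      refine Finset.sum_congr rfl fun b _ => ?_
      rw [Complex.norm_exp, Complex.add_re, Complex.re_ofReal_mul, Complex.re_ofReal_mul]
      ring_nf
  choose d hdU hd using hdom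
  have hsize : ∀ q, Real.exp (2 * (η / 4) * ‖contourPt Γ q‖) * jumpSize Γ (contourValue Γ F)
      (contourValue Γ G) (fun j => (x j : ℂ)) y t q ≤ ∑ l, ∑ k, Real.exp (η / 2) *
        ∑ b, ‖J (x + (d l k b).1) (y + (d l k b).2) q l k‖ := by
    intro q
    rw [jumpSize, Finset.mul_sum]
    refine Finset.sum_le_sum fun l _ => ?_
    rw [Finset.mul_sum]
    refine Finset.sum_le_sum fun k _ => ?_
    rw [show 2 * (η / 4) = η / 2 by ring]
    exact hd l k q
  -- The rate `2 * (η / 4)` is the exponent `η / 2` of `exp_norm_le_sum`.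
  refine ⟨η / 4, by positivity, fun a => ?_, fun a ha => ?_⟩
  · have hc := (Γ a).continuous_param
    have hjc : Continuous fun s : ℝ => jumpSize Γ (contourValue Γ F)
        (contourValue Γ G) (fun j => (x j : ℂ)) y t ⟨a, s⟩ :=
      continuous_jumpSize.comp continuous_sigmaMk
    have hint : IntegrableOn (fun s => ∑ l, ∑ k, Real.exp (η / 2) * ∑ b,
        ‖deriv (Γ a).param s • J (x + (d l k b).1) (y + (d l k b).2) ⟨a, s⟩ l k‖) (Γ a).dom := by
      refine integrable_finsetSum _ fun l _ => integrable_finsetSum _ fun k _ =>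
        Integrable.const_mul (integrable_finsetSum _ fun b _ => ?_) _
      exact ((hH _ (hdU l k b)).integrableOn_jumpAt a l k).norm
    refine Integrable.mono' hint (AEStronglyMeasurable.mul
      (Continuous.aestronglyMeasurable (by fun_prop)) (AEStronglyMeasurable.mul
        (measurable_deriv _).norm.aestronglyMeasurable hjc.aestronglyMeasurable))
      (ae_of_all _ fun s => ?_)
    have h0 := jumpSize_nonneg (Γ := Γ) (F := contourValue Γ F) (G := contourValue Γ G)
      (x := fun j => (x j : ℂ)) (y := y) (t := t) ⟨a, s⟩
    rw [Real.norm_of_nonneg (by positivity), mul_left_comm]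
    simp only [norm_smul]
    calc _ ≤ ‖deriv (Γ a).param s‖ * ∑ l, ∑ k, Real.exp (η / 2) *
          ∑ b, ‖J (x + (d l k b).1) (y + (d l k b).2) ⟨a, s⟩ l k‖ := by
          gcongr
          exact hsize ⟨a, s⟩
      _ = _ := by
          rw [Finset.mul_sum]
          refine Finset.sum_congr rfl fun l _ => ?_
          rw [Finset.mul_sum]
          refine Finset.sum_congr rfl fun k _ => ?_
          rw [mul_left_comm, Finset.mul_sum]
  · choose C hC using fun l k b => (hH _ (hdU l k b)).exists_norm_jumpAt_le ha l k
    refine ⟨∑ l, ∑ k, Real.exp (η / 2) * ∑ b, C l k b, fun s => (hsize ⟨a, s⟩).trans ?_⟩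
    gcongr with l _ k _ b _
    exact hC l k b s

end Decay
end

/-! ### From `L²` to bounded continuous functions. -/

noncomputable section

attribute [local instance] Matrix.linftyOpNormedRing Matrix.linftyOpNormedAlgebra

section Lift

variable {ι : Type*} [Fintype ι] {Γ : ι → SimpleContour}

/-- Functions of the parameter extend measurably to the plane. -/
theorem exists_measurable_lift (hdisj : Pairwise fun a b => Disjoint (Γ a).trace (Γ b).trace)
    {α : ContourPts ι → ℂ} (hα : Continuous α) {C : ℝ} (hC : 0 ≤ C) (hle : ∀ q, ‖α q‖ ≤ C) :
    ∃ ψ : ℂ → ℂ, Measurable ψ ∧ (∀ u, ‖ψ u‖ ≤ C) ∧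
      ∀ a, ∀ s ∈ (Γ a).dom, ψ (contourPt Γ ⟨a, s⟩) = α ⟨a, s⟩ := by
  classical
  set e : ∀ a, (Γ a).dom → ℂ := fun a s => (Γ a).param s with he
  have hinj : ∀ a, Function.Injective (e a) := fun a s s' h =>
    Subtype.ext ((Γ a).injOn_param s.2 s'.2 h)
  -- An injective measurable map from a standard Borel space is a measurable embedding
  -- (Lusin–Souslin), so the inverse parametrization is measurable.
  have hemb : ∀ a, MeasurableEmbedding (e a) := fun a => by
    have := (Γ a).measurableSet_dom.standardBorel
    exact ((Γ a).continuous_param.measurable.comp measurable_subtype_coe).measurableEmbedding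
      (hinj a)
  set ψ : ι → ℂ → ℂ := fun a => Function.extend (e a) (fun s => α ⟨a, s⟩) 0 with hψ
  have hval : ∀ a, ∀ s : (Γ a).dom, ψ a (e a s) = α ⟨a, s⟩ := fun a s =>
    (hinj a).extend_apply _ _ _
  have hout : ∀ a u, u ∉ (Γ a).trace → ψ a u = 0 := fun a u hu =>
    Function.extend_apply' _ _ _ fun ⟨s, hs⟩ => hu ⟨s, s.2, hs⟩
  have hsum : ∀ a, ∀ s ∈ (Γ a).dom, ∑ b, ψ b ((Γ a).param s) = α ⟨a, s⟩ := fun a s hs => by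
    rw [Finset.sum_eq_single a (fun b _ hb => hout b _ fun h => ?_) (by simp)]
    · exact hval a ⟨s, hs⟩
    · exact Set.disjoint_left.1 (hdisj hb) h ((Γ a).param_mem_trace s)
  refine ⟨fun u => ∑ a, ψ a u, ?_, fun u => ?_, hsum⟩
  · refine Finset.measurable_sum _ fun a _ => (hemb a).measurable_extend ?_ measurable_zero
    exact (hα.comp (continuous_sigmaMk (σ := fun _ : ι => ℝ) (i := a))).measurable.comp
      measurable_subtype_coe
  · by_cases hu : ∃ a, u ∈ (Γ a).trace
    · obtain ⟨a, s, hs, rfl⟩ := hu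
      exact (congrArg norm (hsum a s hs)).trans_le (hle _)
    · push Not at hu
      refine (congrArg norm (Finset.sum_eq_zero fun a _ => hout a u (hu a))).trans_le ?_
      simpa using hC

theorem ae_arcMeasure_of_ae_param {P : ℂ → Prop} (hP : MeasurableSet {u | P u})
    (h : ∀ a, ∀ᵐ s ∂volume.restrict (Γ a).dom, P (contourPt Γ ⟨a, s⟩)) :
    ∀ᵐ u ∂arcMeasure Γ, P u := by
  rw [arcMeasure, ae_finsetSum_measure_iff]
  intro a _
  rw [SimpleContour.arcLength, ae_map_iff (Γ a).continuous_param.measurable.aemeasurable hP,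
    ae_withDensity_iff (measurable_deriv _).enorm]
  exact (h a).mono fun s hs _ => hs

end Lift

section IntegrableOnly

variable {ι : Type*} {Γ : ι → SimpleContour}

theorem integrableOn_cauchyKer_smul (hsep : SeparatedAtInfinity Γ) {φ : ContourPts ι → ℂ} {b : ι}
    (hφ : IntegrableOn (fun s => deriv (Γ b).param s • φ ⟨b, s⟩) (Γ b).dom) (x : ContourPts ι) :
    IntegrableOn (fun s => deriv (Γ b).param s •
      (cauchyKer Γ x.1 (contourPt Γ x) ⟨b, s⟩ • φ ⟨b, s⟩)) (Γ b).dom := by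
  obtain ⟨C, N, hk⟩ := hsep.exists_isModerateKernel
  obtain ⟨ε, hε, hle⟩ := hsep.exists_le_norm_sub x
  refine Integrable.mono' (hφ.norm.const_mul ε⁻¹) ?_ (ae_of_all _ fun s => ?_)
  · simp_rw [smul_comm (deriv (Γ b).param _)]
    exact ((hk.continuous_right x).comp continuous_sigmaMk).aestronglyMeasurable.smul
      hφ.aestronglyMeasurable
  · rw [smul_comm, norm_smul]
    gcongr
    by_cases hb : x.1 = b
    · simp only [cauchyKer, hb, if_true, norm_zero]
      positivity
    · simp only [cauchyKer, hb, if_false, norm_inv]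
      exact inv_anti₀ hε (hle ⟨b, s⟩ hb)

/-- With an integrand that is merely integrable, the weight has to be put on the point of
evaluation: the Cauchy integral is then only known to grow polynomially. -/
theorem exists_norm_cauchyAt_le [Fintype ι] (hsep : SeparatedAtInfinity Γ)
    {φ : ContourPts ι → ℂ}
    (hφ : ∀ b, IntegrableOn (fun s => deriv (Γ b).param s • φ ⟨b, s⟩) (Γ b).dom) :
    ∃ C : ℝ, 0 ≤ C ∧ ∃ N : ℕ, (∀ x, ‖cauchyAt Γ φ x‖ ≤ C * (1 + ‖contourPt Γ x‖) ^ N) := by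
  obtain ⟨C, hC, N, hle⟩ := hsep.exists_norm_inv_le
  refine ⟨C * ∑ b, ∫ s in (Γ b).dom, ‖deriv (Γ b).param s • φ ⟨b, s⟩‖,
    mul_nonneg hC (Finset.sum_nonneg fun b _ => integral_nonneg fun s => norm_nonneg _), N,
    fun x => ?_⟩
  rw [mul_right_comm, Finset.mul_sum]
  refine (norm_sum_le _ _).trans (Finset.sum_le_sum fun b _ => ?_)
  rw [← integral_const_mul]
  refine norm_integral_le_of_norm_le ((hφ b).norm.const_mul _) (ae_of_all _ fun s => ?_)
  rw [smul_comm, norm_smul]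
  gcongr
  by_cases hb : x.1 = b
  · simp only [cauchyKer, hb, if_true, norm_zero]
    positivity
  · simp only [cauchyKer, hb, if_false]
    have h1 := hle ⟨b, s⟩ x (Ne.symm hb)
    rwa [norm_inv, norm_sub_rev, ← norm_inv] at h1

end IntegrableOnly

section MatrixEntries

variable {n : Type*} [Fintype n] [DecidableEq n] {ι : Type*} {Γ : ι → SimpleContour}

theorem aestronglyMeasurable_matrix {X : Type*} [MeasurableSpace X] {μ : Measure X}
    {φ : X → Matrix n n ℂ} (h : ∀ i j, AEStronglyMeasurable (fun x => φ x i j) μ) :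
    AEStronglyMeasurable φ μ := by
  have h1 : φ = fun x => ∑ i, ∑ j, φ x i j • Matrix.single i j (1 : ℂ) := funext fun x => by
    conv_lhs => rw [Matrix.matrix_eq_sum_single (φ x)]
    simp [Matrix.smul_single]
  rw [h1]
  exact Finset.aestronglyMeasurable_fun_sum _ fun i _ =>
    Finset.aestronglyMeasurable_fun_sum _ fun j _ => (h i j).smul_const _

theorem norm_entry_le (M : Matrix n n ℂ) (i j : n) : ‖M i j‖ ≤ ‖M‖ := by
  rw [Matrix.linfty_opNorm_def, ← coe_nnnorm, NNReal.coe_le_coe]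
  exact (Finset.single_le_sum (f := fun j => ‖M i j‖₊) (fun _ _ => zero_le)
    (Finset.mem_univ j)).trans (Finset.le_sup (f := fun i => ∑ j, ‖M i j‖₊) (Finset.mem_univ i))

variable [Fintype ι] {φ : ContourPts ι → Matrix n n ℂ}

theorem totalInt_entry (hφ : RapidlyIntegrable Γ φ) (i j : n) :
    totalInt Γ φ i j = totalInt Γ (fun q => φ q i j) := by
  have : CompleteSpace (Matrix n n ℂ) := FiniteDimensional.complete ℂ _
  have h1 := fun a => ContinuousLinearMap.integral_comp_comm
    (LinearMap.toContinuousLinearMap (Matrix.entryLinearMap ℂ ℂ i j)) (hφ.integrableOn a)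
  rw [totalInt, Matrix.sum_apply]
  exact Finset.sum_congr rfl fun a _ => (h1 a).symm

theorem cauchyAt_entry (hsep : SeparatedAtInfinity Γ) (hφ : RapidlyIntegrable Γ φ) (i j : n)
    (x : ContourPts ι) : cauchyAt Γ φ x i j = cauchyAt Γ (fun q => φ q i j) x :=
  totalInt_entry (hφ.cauchyKer_smul hsep x) i j

end MatrixEntries

section Solve

open scoped BoundedContinuousFunction

variable {m : ℕ} {ι : Type*} [Fintype ι] {Γ : ι → SimpleContour}
  {F G : ℂ → Fin m ⊕ Unit → ℂ} {c : ℂ → ℂ} {P : Params m}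
  {H : ContourL2 Γ →L[ℂ] ContourL2 Γ}

theorem cauchyAt_congr_ae {φ ψ : ContourPts ι → ℂ}
    (h : ∀ a, ∀ᵐ s ∂volume.restrict (Γ a).dom, φ ⟨a, s⟩ = ψ ⟨a, s⟩) (x : ContourPts ι) :
    cauchyAt Γ φ x = cauchyAt Γ ψ x :=
  totalInt_congr_ae fun a => (h a).mono fun s hs => by simp only [hs]

namespace IsStronglyCubicIntegrable

variable (h : IsStronglyCubicIntegrable Γ F G c P H)
include h

theorem integrableOn_mul (v : ContourL2 Γ) (k : Fin m ⊕ Unit) (b : ι) :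
    IntegrableOn (fun s => deriv (Γ b).param s • (v (contourPt Γ ⟨b, s⟩) *
      cubicG G c P (contourPt Γ ⟨b, s⟩) k)) (Γ b).dom :=
  integrableOn_of_integrable_arcMeasure ((Lp.memLp v).integrable_mul (h.g_mem k).1) b

/-- On the contour of the evaluation point the numerator `f(u)ᵀ g(v)` vanishes, so `H` factors as
`f` times the Cauchy integral of `v gᵀ` over the other contours. -/
theorem apply_ae (hsep : SeparatedAtInfinity Γ) (v : ContourL2 Γ) (a : ι) :
    ∀ᵐ s ∂volume.restrict (Γ a).dom, (H v : ℂ → ℂ) (contourPt Γ ⟨a, s⟩)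
      = ∑ k, cubicF F c P (contourPt Γ ⟨a, s⟩) k * cauchyAt Γ (fun q => v (contourPt Γ q) *
        cubicG G c P (contourPt Γ q) k) ⟨a, s⟩ := by
  filter_upwards [ae_param_of_ae_arcMeasure (h.kernel v) a] with s hs
  rw [hs, contourIntegral_eq_totalInt]
  simp only [cauchyAt, cauchyInt, totalInt, Finset.mul_sum]
  rw [Finset.sum_comm]
  refine Finset.sum_congr rfl fun b _ => ?_
  set x : ContourPts ι := ⟨a, s⟩ with hx
  have hb : ∀ s', integrableKernel (cubicF F c P) (cubicG G c P) (contourPt Γ x)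
      (contourPt Γ ⟨b, s'⟩) * v (contourPt Γ ⟨b, s'⟩) = ∑ k, cubicF F c P (contourPt Γ x) k *
        (cauchyKer Γ a (contourPt Γ x) ⟨b, s'⟩ * (v (contourPt Γ ⟨b, s'⟩) *
          cubicG G c P (contourPt Γ ⟨b, s'⟩) k)) := by
    intro s'
    by_cases hab : a = b
    · have h0 : ∀ i, cubicF F c P (contourPt Γ x) i * cubicG G c P (contourPt Γ ⟨b, s'⟩) i = 0 :=
        fun i => by
          have h1 := h.contourValue_mul_eq_zero a i
          subst hab
          simp only [hx, cubicF, cubicG, (h.eq_contourValue ⟨a, s⟩).1, (h.eq_contourValue ⟨a, s'⟩).2]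
          linear_combination (c (contourPt Γ ⟨a, s⟩) * cubicDelta P (contourPt Γ ⟨a, s⟩) i *
            (c (contourPt Γ ⟨a, s'⟩))⁻¹ * (cubicDelta P (contourPt Γ ⟨a, s'⟩) i)⁻¹) * h1
      simp [integrableKernel, cauchyKer, h0, hab]
    · have h0 := hsep.contourPt_sub_ne_zero (x := x) (q := ⟨b, s'⟩) hab
      rw [integrableKernel, if_neg (sub_ne_zero.1 h0), Finset.sum_div, Finset.sum_mul]
      refine Finset.sum_congr rfl fun k _ => ?_
      simp only [cauchyKer, hab, if_false]
      field_simp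
  simp only [pathInt, hb, Finset.smul_sum]
  rw [integral_finsetSum]
  · refine Finset.sum_congr rfl fun k _ => ?_
    simp only [smul_eq_mul, mul_left_comm _ (cubicF F c P (contourPt Γ x) k)]
    exact integral_const_mul _ _
  · intro k _
    refine ((integrableOn_cauchyKer_smul hsep (φ := fun q => v (contourPt Γ q) *
      cubicG G c P (contourPt Γ q) k) (h.integrableOn_mul v k b) x).const_mul
      (cubicF F c P (contourPt Γ x) k)).congr (ae_of_all _ fun s' => ?_)
    simp only [smul_eq_mul]
    ring

theorem memLp_sum {ψ : Fin m ⊕ Unit → ℂ → ℂ} (hψ : ∀ k, Measurable (ψ k)) {C : ℝ}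
    (hle : ∀ k u, ‖ψ k u‖ ≤ C) :
    MemLp (fun u => ∑ k, ψ k u * cubicF F c P u k) 2 (arcMeasure Γ) := by
  refine memLp_finsetSum _ fun k _ => (h.f_mem k).1.of_le_mul (c := C)
    ((hψ k).aestronglyMeasurable.mul (h.f_mem k).1.aestronglyMeasurable) (ae_of_all _ fun u => ?_)
  rw [norm_mul]
  gcongr
  exact hle k u

theorem sum_mul_eq (α : Matrix (Fin m ⊕ Unit) (Fin m ⊕ Unit) ℂ) (q : ContourPts ι)
    (i k : Fin m ⊕ Unit) : (α * jumpAt Γ (contourValue Γ F) (contourValue Γ G)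
      (fun j => (P.1 j : ℂ)) P.2.1 P.2.2 q) i k
    = (∑ l, α i l * cubicF F c P (contourPt Γ q) l) * cubicG G c P (contourPt Γ q) k := by
  rw [Matrix.mul_apply, Finset.sum_mul]
  exact Finset.sum_congr rfl fun l _ => by rw [← h.mul_eq_jumpAt, mul_assoc]

variable {C : ℝ} {N : ℕ}
  (hk : IsModerateKernel Γ C N (fun x q : ContourPts ι => cauchyKer Γ x.1 (contourPt Γ x) q))

/-- The candidate is `β + C(v gᵀ)`, where the rows of `v` solve `v = β f + H v` in `L²`. By
`apply_ae` this matrix, applied to `f`, returns `v`; hence its product with `J = f gᵀ` is `v gᵀ`.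
The functions `ψ` are versions of the entries of `β` defined on the plane, where `L²` lives. -/
theorem exists_solution (hsep : SeparatedAtInfinity Γ) (hinv : IsUnit (1 - H))
    (hJ : RapidlyIntegrable Γ (jumpAt Γ (contourValue Γ F) (contourValue Γ G)
      (fun j => (P.1 j : ℂ)) P.2.1 P.2.2))
    (β : ContourPts ι →ᵇ Matrix (Fin m ⊕ Unit) (Fin m ⊕ Unit) ℂ)
    {ψ : Fin m ⊕ Unit → Fin m ⊕ Unit → ℂ → ℂ} (hψm : ∀ i k, Measurable (ψ i k)) {B : ℝ}
    (hψB : ∀ i k u, ‖ψ i k u‖ ≤ B)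
    (hψ : ∀ i k a, ∀ s ∈ (Γ a).dom, ψ i k (contourPt Γ ⟨a, s⟩) = β ⟨a, s⟩ i k) :
    ∃ α : ContourPts ι →ᵇ Matrix (Fin m ⊕ Unit) (Fin m ⊕ Unit) ℂ,
      (1 - kernelOp hk (jumpAt Γ (contourValue Γ F) (contourValue Γ G)
        (fun j => (P.1 j : ℂ)) P.2.1 P.2.2)) α = β ∧
      ∀ i k a, ∀ᵐ s ∂volume.restrict (Γ a).dom,
        (α ⟨a, s⟩ * jumpAt Γ (contourValue Γ F) (contourValue Γ G)
          (fun j => (P.1 j : ℂ)) P.2.1 P.2.2 ⟨a, s⟩) i k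
        = (Ring.inverse (1 - H) (toL2 Γ (fun u => ∑ l, ψ i l u * cubicF F c P u l)) : ℂ → ℂ)
          (contourPt Γ ⟨a, s⟩) * cubicG G c P (contourPt Γ ⟨a, s⟩) k := by
  set J := jumpAt Γ (contourValue Γ F) (contourValue Γ G) (fun j => (P.1 j : ℂ)) P.2.1 P.2.2
    with hJdef
  have hη : ∀ i, MemLp (fun u => ∑ l, ψ i l u * cubicF F c P u l) 2 (arcMeasure Γ) := fun i =>
    h.memLp_sum (hψm i) (hψB i)
  set v : Fin m ⊕ Unit → ContourL2 Γ := fun i =>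
    Ring.inverse (1 - H) (toL2 Γ (fun u => ∑ l, ψ i l u * cubicF F c P u l)) with hv
  have hv1 : ∀ i, v i = (hη i).toLp _ + H (v i) := fun i => by
    have h1 : (1 - H) (v i) = toL2 Γ (fun u => ∑ l, ψ i l u * cubicF F c P u l) := by
      change ((1 - H) * Ring.inverse (1 - H)) _ = _
      rw [Ring.mul_inverse_cancel _ hinv]
      rfl
    rw [toL2, dif_pos (hη i)] at h1
    rw [← h1]
    change v i = (v i - H (v i)) + H (v i)
    abel
  set α₀ : ContourPts ι → Matrix (Fin m ⊕ Unit) (Fin m ⊕ Unit) ℂ := fun q => β q +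
    Matrix.of fun i k => cauchyAt Γ (fun q => v i (contourPt Γ q) *
      cubicG G c P (contourPt Γ q) k) q with hα₀
  have hfv : ∀ i a, ∀ᵐ s ∂volume.restrict (Γ a).dom,
      ∑ l, α₀ ⟨a, s⟩ i l * cubicF F c P (contourPt Γ ⟨a, s⟩) l = v i (contourPt Γ ⟨a, s⟩) := by
    intro i a
    have h1 : (v i : ℂ → ℂ) =ᵐ[arcMeasure Γ] fun u =>
        (∑ l, ψ i l u * cubicF F c P u l) + H (v i) u := by
      have h2 := Lp.coeFn_add ((hη i).toLp _) (H (v i))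
      rw [← hv1 i] at h2
      filter_upwards [h2, (hη i).coeFn_toLp] with u h2 h3
      rw [h2, Pi.add_apply, h3]
    filter_upwards [ae_param_of_ae_arcMeasure h1 a, h.apply_ae hsep (v i) a,
      ae_restrict_mem (Γ a).measurableSet_dom] with s hs hs' hmem
    rw [hs, hs', ← Finset.sum_add_distrib]
    refine Finset.sum_congr rfl fun l _ => ?_
    simp only [hψ i l a s hmem, hα₀, Matrix.add_apply, Matrix.of_apply]
    ring
  have hαJ : ∀ i k a, ∀ᵐ s ∂volume.restrict (Γ a).dom, (α₀ ⟨a, s⟩ * J ⟨a, s⟩) i k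
      = v i (contourPt Γ ⟨a, s⟩) * cubicG G c P (contourPt Γ ⟨a, s⟩) k := fun i k a => by
    filter_upwards [hfv i a] with s hs
    rw [← hs, hJdef, h.sum_mul_eq]
  -- At first `α₀` is only known to grow polynomially, but the rapid integrability of `J`
  -- compensates for this.
  have hrapid : RapidlyIntegrable Γ fun q => α₀ q * J q := by
    choose B' hB' N' hle using fun i k => exists_norm_cauchyAt_le hsep (φ := fun q =>
      v i (contourPt Γ q) * cubicG G c P (contourPt Γ q) k) (h.integrableOn_mul (v i) k)
    set N₀ := ∑ i, ∑ k, N' i k with hN₀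
    have hbound : ∀ q, ‖α₀ q‖ ≤ (‖β‖ + ∑ i, ∑ k, B' i k) * (1 + ‖contourPt Γ q‖) ^ N₀ := by
      intro q
      have h1 : (1 : ℝ) ≤ 1 + ‖contourPt Γ q‖ := by linarith [norm_nonneg (contourPt Γ q)]
      rw [add_mul, Finset.sum_mul]
      refine (norm_add_le _ _).trans (add_le_add ?_ ((matrix_norm_le_sum _).trans ?_))
      · exact (β.norm_coe_le_norm q).trans
          (le_mul_of_one_le_right (norm_nonneg _) (one_le_pow₀ h1))
      · refine Finset.sum_le_sum fun i _ => ?_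
        rw [Finset.sum_mul]
        refine Finset.sum_le_sum fun k _ => (hle i k q).trans ?_
        have h2 : N' i k ≤ N₀ := (Finset.single_le_sum (f := fun k => N' i k)
          (fun _ _ => Nat.zero_le _) (Finset.mem_univ k)).trans
          (Finset.single_le_sum (f := fun i => ∑ k, N' i k) (fun _ _ => Nat.zero_le _)
            (Finset.mem_univ i))
        have := hB' i k
        gcongr
    refine hJ.of_norm_le_weight (fun a => aestronglyMeasurable_matrix fun i k => ?_)
      (fun q => (norm_mul_le _ _).trans (by gcongr; exact hbound q))
    refine (h.integrableOn_mul (v i) k a).aestronglyMeasurable.congr ?_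
    filter_upwards [hαJ i k a] with s hs
    rw [Matrix.smul_apply, hs]
  -- Rapid integrability now shows that the Cauchy integral in `α₀` is bounded and continuous.
  set α := β + hk.integral hrapid with hα
  have hαeq : ∀ q, α q = α₀ q := fun q => by
    change β q + hk.integral hrapid q = β q + _
    congr 1
    ext i k
    change cauchyAt Γ (fun q => α₀ q * J q) q i k = _
    rw [cauchyAt_entry hsep hrapid]
    exact cauchyAt_congr_ae (hαJ i k) q
  refine ⟨α, ?_, fun i k a => by simpa only [hαeq] using hαJ i k a⟩
  ext1 q
  change α q - kernelOp hk J α q = β q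
  rw [kernelOp_apply hk hJ]
  simp only [hαeq]
  rw [← hαeq, hα, BoundedContinuousFunction.add_apply]
  exact add_sub_cancel_right _ _

/-- Surjectivity is `exists_solution`. For injectivity, a solution of `α = C(α J)` gives rows `α f`
in `L²` fixed by `H`, hence zero, and then `α = C((α f) gᵀ) = 0`. In a Banach space a bijective
operator is a unit. -/
theorem isUnit_one_sub_kernelOp (hsep : SeparatedAtInfinity Γ)
    (hdisj : Pairwise fun a b => Disjoint (Γ a).trace (Γ b).trace) (hinv : IsUnit (1 - H))
    (hJ : RapidlyIntegrable Γ (jumpAt Γ (contourValue Γ F) (contourValue Γ G)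
      (fun j => (P.1 j : ℂ)) P.2.1 P.2.2)) :
    IsUnit (1 - kernelOp hk (jumpAt Γ (contourValue Γ F) (contourValue Γ G)
        (fun j => (P.1 j : ℂ)) P.2.1 P.2.2)) := by
  have : CompleteSpace (Matrix (Fin m ⊕ Unit) (Fin m ⊕ Unit) ℂ) := FiniteDimensional.complete ℂ _
  have hlift : ∀ β : ContourPts ι →ᵇ Matrix (Fin m ⊕ Unit) (Fin m ⊕ Unit) ℂ, ∃ ψ :
      Fin m ⊕ Unit → Fin m ⊕ Unit → ℂ → ℂ, (∀ i k, Measurable (ψ i k)) ∧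
      (∀ i k u, ‖ψ i k u‖ ≤ ‖β‖) ∧
      ∀ i k a, ∀ s ∈ (Γ a).dom, ψ i k (contourPt Γ ⟨a, s⟩) = β ⟨a, s⟩ i k := by
    intro β
    choose ψ h1 h2 h3 using fun i k => exists_measurable_lift hdisj (α := fun q => β q i k)
      ((LinearMap.toContinuousLinearMap (Matrix.entryLinearMap ℂ ℂ i k)).continuous.comp
        β.continuous) (C := ‖β‖) (norm_nonneg _) fun q => (norm_entry_le _ _ _).trans
        (β.norm_coe_le_norm q)
    exact ⟨ψ, h1, h2, h3⟩
  rw [ContinuousLinearMap.isUnit_iff_bijective]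
  refine ⟨(injective_iff_map_eq_zero _).2 fun α hα => ?_, fun β => ?_⟩
  · obtain ⟨ψ, hψm, hψB, hψ⟩ := hlift α
    set J := jumpAt Γ (contourValue Γ F) (contourValue Γ G) (fun j => (P.1 j : ℂ)) P.2.1 P.2.2
    with hJdef
    have hfix : ∀ q, α q = cauchyAt Γ (fun q => α q * J q) q := fun q => by
      have h1 := congrArg (fun β => β q) hα
      change α q - kernelOp hk J α q = 0 at h1
      rw [kernelOp_apply hk hJ] at h1
      exact sub_eq_zero.1 h1
    have hη : ∀ i, MemLp (fun u => ∑ l, ψ i l u * cubicF F c P u l) 2 (arcMeasure Γ) := fun i =>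
      h.memLp_sum (hψm i) (hψB i)
    set v : Fin m ⊕ Unit → ContourL2 Γ := fun i => (hη i).toLp _ with hv
    have hva : ∀ i a, ∀ᵐ s ∂volume.restrict (Γ a).dom, (v i : ℂ → ℂ) (contourPt Γ ⟨a, s⟩)
        = ∑ l, α ⟨a, s⟩ i l * cubicF F c P (contourPt Γ ⟨a, s⟩) l := fun i a => by
      filter_upwards [ae_param_of_ae_arcMeasure (hη i).coeFn_toLp a,
        ae_restrict_mem (Γ a).measurableSet_dom] with s hs hmem
      rw [hs]
      exact Finset.sum_congr rfl fun l _ => by rw [hψ i l a s hmem]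
    have hvJ : ∀ i k a, ∀ᵐ s ∂volume.restrict (Γ a).dom, (v i : ℂ → ℂ) (contourPt Γ ⟨a, s⟩) *
        cubicG G c P (contourPt Γ ⟨a, s⟩) k = (α ⟨a, s⟩ * J ⟨a, s⟩) i k := fun i k a => by
      filter_upwards [hva i a] with s hs
      rw [hs, hJdef, h.sum_mul_eq]
    have hv0 : ∀ i, v i = 0 := fun i => by
      have h1 : H (v i) = v i := by
        refine Lp.ext (ae_arcMeasure_of_ae_param (measurableSet_eq_fun
          (Lp.stronglyMeasurable _).measurable (Lp.stronglyMeasurable _).measurable) fun a => ?_)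
        filter_upwards [h.apply_ae hsep (v i) a, hva i a] with s hs hs'
        rw [hs, hs']
        refine Finset.sum_congr rfl fun l _ => ?_
        rw [mul_comm, cauchyAt_congr_ae (ψ := fun q => (α q * J q) i l) (hvJ i l), ← cauchyAt_entry hsep (hJ.bounded_mul α),
          ← hfix]
      have h2 : (1 - H) (v i) = 0 := by
        change v i - H (v i) = 0
        rw [h1, sub_self]
      have h3 : (Ring.inverse (1 - H) * (1 - H)) (v i) = 0 := by
        change Ring.inverse (1 - H) ((1 - H) (v i)) = 0
        rw [h2, map_zero]
      rwa [Ring.inverse_mul_cancel _ hinv] at h3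
    ext1 q
    rw [hfix q]
    ext i k
    rw [cauchyAt_entry hsep (hJ.bounded_mul α), ← cauchyAt_congr_ae (φ := fun q => (v i : ℂ → ℂ) (contourPt Γ q) *
        cubicG G c P (contourPt Γ q) k) (ψ := fun q => (α q * J q) i k) (hvJ i k)]
    have h0 : ∀ a, ∀ᵐ s ∂volume.restrict (Γ a).dom, (v i : ℂ → ℂ) (contourPt Γ ⟨a, s⟩) *
        cubicG G c P (contourPt Γ ⟨a, s⟩) k = (fun _ => (0 : ℂ)) (⟨a, s⟩ : ContourPts ι) :=
      fun a => by
        have h1 := Lp.coeFn_zero ℂ 2 (arcMeasure Γ)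
        filter_upwards [ae_param_of_ae_arcMeasure h1 a] with s hs
        rw [hv0 i, hs]
        simp
    rw [cauchyAt_congr_ae (φ := fun q => (v i : ℂ → ℂ) (contourPt Γ q) *
        cubicG G c P (contourPt Γ q) k) (ψ := fun _ => 0) h0]
    simp [cauchyAt, cauchyInt, totalInt, pathInt]
  · obtain ⟨ψ, hψm, hψB, hψ⟩ := hlift β
    obtain ⟨α, hα, -⟩ := h.exists_solution hk hsep hinv hJ β hψm hψB hψ
    exact ⟨α, hα⟩

/-- The case `β = 1` of `exists_solution`: `(1 - H)⁻¹ f = A f`, so the integrand is `A f gᵀ = A J`.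
-/
theorem phiOne_eq_moment (hsep : SeparatedAtInfinity Γ) (hinv : IsUnit (1 - H))
    (hJ : RapidlyIntegrable Γ (jumpAt Γ (contourValue Γ F) (contourValue Γ G)
      (fun j => (P.1 j : ℂ)) P.2.1 P.2.2))
    (hunit : IsUnit (1 - kernelOp hk (jumpAt Γ (contourValue Γ F) (contourValue Γ G)
        (fun j => (P.1 j : ℂ)) P.2.1 P.2.2))) :
    phiOne Γ F G c P H = moment Γ (Ring.inverse (1 - kernelOp hk (jumpAt Γ (contourValue Γ F)
      (contourValue Γ G) (fun j => (P.1 j : ℂ)) P.2.1 P.2.2))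
      (BoundedContinuousFunction.const _ 1)) (jumpAt Γ (contourValue Γ F) (contourValue Γ G)
        (fun j => (P.1 j : ℂ)) P.2.1 P.2.2) 0 := by
  set J := jumpAt Γ (contourValue Γ F) (contourValue Γ G) (fun j => (P.1 j : ℂ)) P.2.1 P.2.2
    with hJdef
  obtain ⟨α, hα, hα'⟩ := h.exists_solution hk hsep hinv hJ (BoundedContinuousFunction.const _ 1)
    (ψ := fun i k _ => (1 : Matrix (Fin m ⊕ Unit) (Fin m ⊕ Unit) ℂ) i k)
    (fun i k => measurable_const) (B := 1)
    (fun i k u => by rw [Matrix.one_apply]; split_ifs <;> simp) fun i k a s _ => rfl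
  have h1 : Ring.inverse (1 - kernelOp hk J) (BoundedContinuousFunction.const _ 1) = α := by
    rw [← hα]
    change (Ring.inverse (1 - kernelOp hk J) * (1 - kernelOp hk J)) α = α
    rw [Ring.inverse_mul_cancel _ hunit]
    rfl
  rw [h1]
  ext i j
  simp only [moment, pow_zero, one_smul]
  rw [totalInt_entry (hJ.bounded_mul α), phiOne, Matrix.of_apply, contourIntegral_eq_totalInt]
  refine totalInt_congr_ae fun a => ?_
  filter_upwards [hα' i j a] with s hs
  rw [hs]
  simp [Matrix.one_apply]

end IsStronglyCubicIntegrable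

end Solve
end

/-! ### Differentiation of the solution and of its moments. -/

noncomputable section

attribute [local instance] Matrix.linftyOpNormedRing Matrix.linftyOpNormedAlgebra

section Abstract

variable {m : ℕ} {B B' : Type*} [NormedAddCommGroup B] [NormedSpace ℂ B]
  [NormedAddCommGroup B'] [NormedSpace ℂ B'] {x₀ : Fin m → ℂ}

/-- Differentiation of the solution `a` of `a = b + T a` with respect to parameters. -/
theorem exists_hasFDerivAt_inverse_one_sub [CompleteSpace B] {T : (Fin m → ℂ) → B →L[ℂ] B}
    {T' : Fin m → B →L[ℂ] B}
    (hT : HasFDerivAt T (∑ j, (ContinuousLinearMap.proj (R := ℂ) j :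
      (Fin m → ℂ) →L[ℂ] ℂ).smulRight (T' j)) x₀) (hu : IsUnit (1 - T x₀)) (b : B) :
    ∃ a' : Fin m → B, HasFDerivAt (fun x => Ring.inverse (1 - T x) b)
        (∑ j, (ContinuousLinearMap.proj (R := ℂ) j : (Fin m → ℂ) →L[ℂ] ℂ).smulRight (a' j)) x₀ ∧
      ∀ j, a' j = T x₀ (a' j) + T' j (Ring.inverse (1 - T x₀) b) := by
  obtain ⟨u, hu⟩ := hu
  have hinv : Ring.inverse (1 - T x₀) = ↑u⁻¹ := by rw [← hu, Ring.inverse_unit]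
  have h1 := hT.const_sub 1
  have h2 := hasFDerivAt_ringInverse (𝕜 := ℂ) u
  rw [hu] at h2
  -- Inversion of operators is differentiable at a unit, with derivative `S ↦ -u⁻¹ S u⁻¹`; the sign
  -- is compensated by that of `1 - T`.
  have h4 := (h2.comp x₀ h1).clm_apply (hasFDerivAt_const b x₀)
  refine ⟨fun j => (↑u⁻¹ : B →L[ℂ] B) (T' j (Ring.inverse (1 - T x₀) b)),
    h4.congr_fderiv ?_, fun j => ?_⟩
  · ext1 h
    simp [hinv, sum_apply, map_sum]
  · rw [← sub_eq_iff_eq_add']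
    change (1 - T x₀) ((↑u⁻¹ : B →L[ℂ] B) _) = _
    rw [← hu]
    change (u.val * u.inv) _ = _
    rw [u.val_inv]
    rfl

theorem exists_hasFDerivAt_clm_apply {E : Type*} [NormedAddCommGroup E] [NormedSpace ℂ E]
    (e : B' →L[ℂ] E) {K : (Fin m → ℂ) → B →L[ℂ] B'} {K' : Fin m → B →L[ℂ] B'}
    (hK : HasFDerivAt K (∑ j, (ContinuousLinearMap.proj (R := ℂ) j :
      (Fin m → ℂ) →L[ℂ] ℂ).smulRight (K' j)) x₀) {a : (Fin m → ℂ) → B} {a' : Fin m → B}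
    (ha : HasFDerivAt a (∑ j, (ContinuousLinearMap.proj (R := ℂ) j :
      (Fin m → ℂ) →L[ℂ] ℂ).smulRight (a' j)) x₀) :
    HasFDerivAt (fun x => e (K x (a x))) (∑ j, (ContinuousLinearMap.proj (R := ℂ) j :
      (Fin m → ℂ) →L[ℂ] ℂ).smulRight (e (K x₀ (a' j)) + e (K' j (a x₀)))) x₀ := by
  refine (e.hasFDerivAt.comp x₀ (hK.clm_apply ha)).congr_fderiv ?_
  ext1 h
  simp [sum_apply, map_sum, Finset.sum_add_distrib]

end Abstract

section Resolvent

open scoped BoundedContinuousFunction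

variable {m : ℕ} {ι : Type*} [Fintype ι] {Γ : ι → SimpleContour} {F G : ι → Fin m ⊕ Unit → ℂ}
  {x₀ : Fin m → ℂ} {y t : Fin m → ℝ} {C : ℝ} {N : ℕ}
  (hk : IsModerateKernel Γ C N (fun x q : ContourPts ι => cauchyKer Γ x.1 (contourPt Γ x) q))

/-- The solution `A` of `A = 1 + C(A J)`, where `C` is the Cauchy integral over the other
contours. -/
def resolventOne (J : ContourPts ι → Matrix (Fin m ⊕ Unit) (Fin m ⊕ Unit) ℂ) :
    ContourPts ι →ᵇ Matrix (Fin m ⊕ Unit) (Fin m ⊕ Unit) ℂ :=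
  Ring.inverse (1 - kernelOp hk J) (BoundedContinuousFunction.const _ 1)

theorem resolventOne_apply {J : ContourPts ι → Matrix (Fin m ⊕ Unit) (Fin m ⊕ Unit) ℂ}
    (hJ : RapidlyIntegrable Γ J) (hu : IsUnit (1 - kernelOp hk J)) (q : ContourPts ι) :
    resolventOne hk J q = 1 + cauchyAt Γ (fun q => resolventOne hk J q * J q) q := by
  have h1 : (1 - kernelOp hk J) (resolventOne hk J) = BoundedContinuousFunction.const _ 1 := by
    change ((1 - kernelOp hk J) * Ring.inverse (1 - kernelOp hk J)) _ = _
    rw [Ring.mul_inverse_cancel _ hu]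
    rfl
  have h2 := congrArg (fun β => β q) h1
  change resolventOne hk J q - kernelOp hk J (resolventOne hk J) q = 1 at h2
  rw [kernelOp_apply hk hJ] at h2
  exact sub_eq_iff_eq_add.1 h2

variable {δ : ℝ} (hδ : 0 < δ) (hj : ExpDecaying Γ (2 * δ) (jumpSize Γ F G x₀ y t))
  (hu : IsUnit (1 - kernelOp hk (jumpAt Γ F G x₀ y t)))
include hδ hj

omit [Fintype ι] in
theorem ExpDecaying.rapidlyIntegrable_jumpAt_self : RapidlyIntegrable Γ (jumpAt Γ F G x₀ y t) :=
  rapidlyIntegrable_jumpAt hδ hj (by simpa using hδ.le)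

include hu

theorem exists_hasFDerivAt_resolventOne :
    ∃ A' : Fin m → (ContourPts ι →ᵇ Matrix (Fin m ⊕ Unit) (Fin m ⊕ Unit) ℂ),
      HasFDerivAt (𝕜 := ℂ) (fun x : Fin m → ℂ => resolventOne hk (jumpAt Γ F G x y t))
        (∑ j, (ContinuousLinearMap.proj (R := ℂ) j : (Fin m → ℂ) →L[ℂ] ℂ).smulRight (A' j)) x₀ ∧
      ∀ j, A' j = kernelOp hk (jumpAt Γ F G x₀ y t) (A' j)
        + kernelOp hk (jumpParamDeriv Γ F G x₀ y t j)
          (resolventOne hk (jumpAt Γ F G x₀ y t)) := by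
  have : CompleteSpace (Matrix (Fin m ⊕ Unit) (Fin m ⊕ Unit) ℂ) := FiniteDimensional.complete ℂ _
  exact exists_hasFDerivAt_inverse_one_sub (hasFDerivAt_kernelOp_jumpAt hk hδ hj) hu _

variable (hFG : ∀ a i, F a i * G a i = 0) (hsep : SeparatedAtInfinity Γ)
include hFG hsep

theorem hasFDerivAt_moment (n : ℕ) (i k : Fin m ⊕ Unit) :
    HasFDerivAt (𝕜 := ℂ) (fun x : Fin m → ℂ => moment Γ (resolventOne hk (jumpAt Γ F G x y t))
        (jumpAt Γ F G x y t) n i k) (∑ j, (ContinuousLinearMap.proj (R := ℂ) j :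
          (Fin m → ℂ) →L[ℂ] ℂ).smulRight
        ((padDiag (Pi.single j 1) * moment Γ (resolventOne hk (jumpAt Γ F G x₀ y t))
            (jumpAt Γ F G x₀ y t) (n + 1)
          - moment Γ (resolventOne hk (jumpAt Γ F G x₀ y t)) (jumpAt Γ F G x₀ y t) (n + 1)
            * padDiag (Pi.single j 1)
          + (moment Γ (resolventOne hk (jumpAt Γ F G x₀ y t)) (jumpAt Γ F G x₀ y t) 0
              * padDiag (Pi.single j 1)
            - padDiag (Pi.single j 1) *
              moment Γ (resolventOne hk (jumpAt Γ F G x₀ y t)) (jumpAt Γ F G x₀ y t) 0)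
            * moment Γ (resolventOne hk (jumpAt Γ F G x₀ y t)) (jumpAt Γ F G x₀ y t) n) i k))
      x₀ := by
  have : CompleteSpace (Matrix (Fin m ⊕ Unit) (Fin m ⊕ Unit) ℂ) := FiniteDimensional.complete ℂ _
  have hJ := hj.rapidlyIntegrable_jumpAt_self hδ
  have hJ' := rapidlyIntegrable_jumpParamDeriv hJ
  have h1 : SandwichZero (jumpAt Γ F G x₀ y t) 1 := by
    simpa using jumpAt_sandwichZero (x := x₀) (y := y) (t := t) (Γ := Γ) hFG 1
  -- The moment of order `n` is itself the value of an integral operator with kernel `zⁿ`,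
  -- independent of the evaluation point, so the same differentiation result applies to it.
  have hkn : IsModerateKernel Γ 1 n (fun (_ : Unit) q => contourPt Γ q ^ n) :=
    ⟨zero_le_one, fun q => continuous_const, fun _ => (continuous_contourPt Γ).pow n,
      fun _ q => by
        rw [norm_pow, one_mul]
        gcongr
        linarith⟩
  obtain ⟨A', hA', hA'eq⟩ := exists_hasFDerivAt_resolventOne hk hδ hj hu
  set e : (Unit →ᵇ Matrix (Fin m ⊕ Unit) (Fin m ⊕ Unit) ℂ) →L[ℂ] ℂ := LinearMap.mkContinuous
    { toFun := fun β => β () i k, map_add' := fun _ _ => rfl, map_smul' := fun _ _ => rfl } 1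
    fun β => by
      rw [one_mul]
      exact (norm_entry_le _ _ _).trans (β.norm_coe_le_norm _) with he
  have h2 := exists_hasFDerivAt_clm_apply e (hasFDerivAt_kernelOp_jumpAt hkn hδ hj) hA'
  have hnear : ∀ᶠ x in 𝓝 x₀, 2 * ‖x - x₀‖ < δ := by
    have : Tendsto (fun x => 2 * ‖x - x₀‖) (𝓝 x₀) (𝓝 0) := by
      have h : Continuous fun x => 2 * ‖x - x₀‖ := by fun_prop
      simpa using h.tendsto x₀
    exact this.eventually_lt_const hδ
  -- The two expressions are identified only near `x₀`, where `J` is rapidly integrable; elsewhere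
  -- `kernelOp` may have its default value zero.
  have h3 := h2.congr_of_eventuallyEq (f₁ := fun x : Fin m → ℂ =>
    moment Γ (resolventOne hk (jumpAt Γ F G x y t)) (jumpAt Γ F G x y t) n i k) (by
      filter_upwards [hnear] with x hx
      exact (congrFun (congrFun (kernelOp_apply hkn (rapidlyIntegrable_jumpAt hδ hj hx.le)
        (resolventOne hk (jumpAt Γ F G x y t)) ()) i) k).symm)
  have hval := fun j => moment_derivative hJ h1 hsep (resolventOne_apply hk hJ hu)
    (fun α => eq_zero_of_eq_cauchyAt hk hJ hu)
    (jumpAt_sandwichZero hFG (Sum.elim (Pi.single j 1) fun _ => 0)) (A' := A' j) (fun q => by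
      have h4 := congrArg (fun β => β q) (hA'eq j)
      change A' j q = kernelOp hk (jumpAt Γ F G x₀ y t) (A' j) q + kernelOp hk _ _ q at h4
      rwa [kernelOp_apply hk hJ, kernelOp_apply hk (hJ' j)] at h4) n
  have hval' := fun j => (congrArg₂ (· + ·) (kernelOp_apply hkn hJ (A' j) ())
    (kernelOp_apply hkn (hJ' j) (resolventOne hk (jumpAt Γ F G x₀ y t)) ())).trans (hval j)
  refine h3.congr_fderiv (Finset.sum_congr rfl fun j _ => ?_)
  exact congrArg _ (congrFun (congrFun (hval' j) i) k)

/-- The function `A J` is differentiated along the contours. Integration by parts identifies the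
derivative of `A` with the Cauchy integral of the derivative of `A J`, whose total integral is zero;
these are the two inputs of `moment_identity`. -/
theorem momentIdentity_moment {xr : Fin m → ℝ} (hx : x₀ = fun k => (xr k : ℂ)) :
    MomentIdentity (realDiag t) (realDiag y) (realDiag xr)
      (moment Γ (resolventOne hk (jumpAt Γ F G x₀ y t)) (jumpAt Γ F G x₀ y t) 0)
      (moment Γ (resolventOne hk (jumpAt Γ F G x₀ y t)) (jumpAt Γ F G x₀ y t) 1)
      (moment Γ (resolventOne hk (jumpAt Γ F G x₀ y t)) (jumpAt Γ F G x₀ y t) 2) := by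
  have : CompleteSpace (Matrix (Fin m ⊕ Unit) (Fin m ⊕ Unit) ℂ) := FiniteDimensional.complete ℂ _
  have hJ := hj.rapidlyIntegrable_jumpAt_self hδ
  have h1 : SandwichZero (jumpAt Γ F G x₀ y t) 1 := by
    simpa using jumpAt_sandwichZero (x := x₀) (y := y) (t := t) (Γ := Γ) hFG 1
  set J := jumpAt Γ F G x₀ y t with hJdef
  set A := resolventOne hk J with hAdef
  have hA := resolventOne_apply hk hJ hu
  have rA := hJ.bounded_mul A
  -- The derivative of `A` along its contour has kernel `-(u - v)⁻²`; a product of moderate kernels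
  -- is moderate, so it is bounded and continuous.
  set A' : ContourPts ι →ᵇ Matrix (Fin m ⊕ Unit) (Fin m ⊕ Unit) ℂ :=
    -(hk.mul hk).integral rA with hA'def
  have rJ' : RapidlyIntegrable Γ fun q => jumpDeriv F G x₀ y t q.1 (contourPt Γ q) := by
    have h2 : ∀ v : Fin m → ℂ, RapidlyIntegrable Γ fun q => padDiag v * J q - J q * padDiag v :=
      fun v => (hJ.const_mul _).sub (hJ.mul_const _)
    have h3 := (((h2 fun k => (t k : ℂ)).pt_smul.pt_smul.const_smul 3).add
      ((h2 fun k => (y k : ℂ)).pt_smul.const_smul 2)).add (h2 x₀)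
    have h4 : ∀ q, jumpDeriv F G x₀ y t q.1 (contourPt Γ q) = _ := fun q => by
      simp only [jumpDeriv, add_mul, mul_add, smul_mul_assoc, mul_smul_comm]
      rfl
    convert h3 using 2 with q
    rw [h4]
    simp only [hJdef, jumpAt]
    module
  -- For each contour `b`, a function on the plane that equals `A J` on `b` and has a complex
  -- derivative there, since the Cauchy integral leaves out `b`.
  set Φ : ι → ℂ → Matrix (Fin m ⊕ Unit) (Fin m ⊕ Unit) ℂ := fun b v =>
    (1 + cauchyInt Γ (fun q => A q * J q) b v) * jump F G x₀ y t b v with hΦ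
  set Φ' : ι → ℂ → Matrix (Fin m ⊕ Unit) (Fin m ⊕ Unit) ℂ := fun b v =>
    (-totalInt Γ (fun q => (cauchyKer Γ b v q * cauchyKer Γ b v q) • (A q * J q))) *
      jump F G x₀ y t b v + (1 + cauchyInt Γ (fun q => A q * J q) b v) *
      jumpDeriv F G x₀ y t b v with hΦ'
  have eΦ : ∀ q : ContourPts ι, Φ q.1 (contourPt Γ q) = A q * J q := fun q => by
    rw [hA q]
    rfl
  have eΦ' : ∀ q : ContourPts ι, Φ' q.1 (contourPt Γ q)
      = A' q * J q + A q * jumpDeriv F G x₀ y t q.1 (contourPt Γ q) := fun q => by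
    rw [hA q]
    rfl
  have hd : ∀ q : ContourPts ι, HasDerivAt (Φ q.1) (Φ' q.1 (contourPt Γ q)) (contourPt Γ q) :=
    fun q => ((hasDerivAt_cauchyInt hsep rA q).const_add 1).mul (hasDerivAt_jump q.1 _)
  have rΦ : RapidlyIntegrable Γ fun q => Φ q.1 (contourPt Γ q) := by
    simpa only [eΦ] using rA
  have rΦ' : RapidlyIntegrable Γ fun q => Φ' q.1 (contourPt Γ q) := by
    simp only [eΦ']
    exact (hJ.bounded_mul A').add (rJ'.bounded_mul A)
  have hlim : ∀ a, (Γ a).dom = Set.univ →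
      Tendsto (fun s => Φ a ((Γ a).param s)) (cocompact ℝ) (𝓝 0) := fun a ha => by
    refine hj.tendsto_zero (by positivity) ha (C := ‖A‖) (fun s => ?_) (norm_nonneg _)
    rw [show Φ a ((Γ a).param s) = A ⟨a, s⟩ * J ⟨a, s⟩ from eΦ ⟨a, s⟩]
    refine (norm_mul_le _ _).trans ?_
    gcongr
    · exact A.norm_coe_le_norm _
    · exact matrix_norm_le_sum _
  rw [MomentIdentity, padZero_realDiag, padZero_realDiag, padZero_realDiag, ← hx]
  refine moment_identity hJ h1 hsep hA (fun α => eq_zero_of_eq_cauchyAt hk hJ hu)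
    (jumpAt_sandwichZero hFG _) (jumpAt_sandwichZero hFG _)
    (J' := fun q => jumpDeriv F G x₀ y t q.1 (contourPt Γ q)) (A' := A') (fun q => rfl)
    (fun q => ?_) ?_
  · have h2 := cauchyAt_deriv hsep hd rΦ rΦ' hlim q
    simp only [eΦ, eΦ'] at h2
    rw [h2]
    rfl
  · have h2 : totalInt Γ (fun q => Φ' q.1 (contourPt Γ q)) = 0 :=
      Finset.sum_eq_zero fun a _ => (Γ a).integral_deriv_eq_zero (Φ := Φ a) (Φ' := Φ' a)
        (fun s => hd ⟨a, s⟩)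
        (rΦ'.integrableOn a) (hlim a)
    simpa only [eΦ'] using h2

end Resolvent
end

/-! ### Directional derivatives of matrices and the hierarchy of moments. -/

noncomputable section

section MatD

variable {m : ℕ} {I J K : Type*} {x : Fin m → ℝ}

theorem matD_eq_of_hasFDerivAt {A : (Fin m → ℝ) → Matrix I J ℂ}
    {L : I → J → (Fin m → ℝ) →L[ℝ] ℂ} (h : ∀ i j, HasFDerivAt (fun x' => A x' i j) (L i j) x)
    (w : Fin m → ℝ) : matD w A x = Matrix.of fun i j => L i j w := by
  ext i j
  simp only [matD, Matrix.of_apply, ((h i j).hasLineDerivAt _).lineDeriv]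
  conv_rhs => rw [← Finset.univ_sum_single w, map_sum]
  refine Finset.sum_congr rfl fun k _ => ?_
  have h1 : (Pi.single k (w k) : Fin m → ℝ) = w k • Pi.single k 1 := by
    rw [← Pi.single_smul, smul_eq_mul, mul_one]
  rw [h1, map_smul, Complex.real_smul]

theorem matD_congr {A B : (Fin m → ℝ) → Matrix I J ℂ} (h : A =ᶠ[𝓝 x] B) (w : Fin m → ℝ) :
    matD w A x = matD w B x := by
  ext i j
  have h1 : (fun x' => A x' i j) =ᶠ[𝓝 x] fun x' => B x' i j := h.mono fun x' hx => by
    simp only [hx]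
  simp only [matD, Matrix.of_apply, h1.lineDeriv_eq]

theorem matD_add {A B : (Fin m → ℝ) → Matrix I J ℂ}
    (hA : ∀ i j, DifferentiableAt ℝ (fun x' => A x' i j) x)
    (hB : ∀ i j, DifferentiableAt ℝ (fun x' => B x' i j) x) (w : Fin m → ℝ) :
    matD w (fun x' => A x' + B x') x = matD w A x + matD w B x := by
  rw [matD_eq_of_hasFDerivAt (fun i j => (hA i j).hasFDerivAt),
    matD_eq_of_hasFDerivAt (fun i j => (hB i j).hasFDerivAt),
    matD_eq_of_hasFDerivAt (A := fun x' => A x' + B x')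
      (fun i j => (hA i j).hasFDerivAt.add (hB i j).hasFDerivAt)]
  rfl

theorem matD_sub {A B : (Fin m → ℝ) → Matrix I J ℂ}
    (hA : ∀ i j, DifferentiableAt ℝ (fun x' => A x' i j) x)
    (hB : ∀ i j, DifferentiableAt ℝ (fun x' => B x' i j) x) (w : Fin m → ℝ) :
    matD w (fun x' => A x' - B x') x = matD w A x - matD w B x := by
  rw [matD_eq_of_hasFDerivAt (fun i j => (hA i j).hasFDerivAt),
    matD_eq_of_hasFDerivAt (fun i j => (hB i j).hasFDerivAt),
    matD_eq_of_hasFDerivAt (A := fun x' => A x' - B x')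
      (fun i j => (hA i j).hasFDerivAt.sub (hB i j).hasFDerivAt)]
  rfl

variable [Fintype J]

theorem differentiableAt_matrix_mul {A : (Fin m → ℝ) → Matrix I J ℂ}
    {B : (Fin m → ℝ) → Matrix J K ℂ} (hA : ∀ i j, DifferentiableAt ℝ (fun x' => A x' i j) x)
    (hB : ∀ i j, DifferentiableAt ℝ (fun x' => B x' i j) x) (i : I) (k : K) :
    DifferentiableAt ℝ (fun x' => (A x' * B x') i k) x := by
  simp only [Matrix.mul_apply]
  exact DifferentiableAt.fun_sum fun j _ => (hA i j).mul (hB j k)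

theorem matD_mul {A : (Fin m → ℝ) → Matrix I J ℂ}
    {B : (Fin m → ℝ) → Matrix J K ℂ} (hA : ∀ i j, DifferentiableAt ℝ (fun x' => A x' i j) x)
    (hB : ∀ i j, DifferentiableAt ℝ (fun x' => B x' i j) x) (w : Fin m → ℝ) :
    matD w (fun x' => A x' * B x') x = matD w A x * B x + A x * matD w B x := by
  rw [matD_eq_of_hasFDerivAt (fun i j => (hA i j).hasFDerivAt),
    matD_eq_of_hasFDerivAt (fun i j => (hB i j).hasFDerivAt),
    matD_eq_of_hasFDerivAt (A := fun x' => A x' * B x') (fun i k =>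
      HasFDerivAt.fun_sum fun j (_ : j ∈ Finset.univ) =>
        (hA i j).hasFDerivAt.mul (hB j k).hasFDerivAt)]
  ext i k
  simp only [Matrix.of_apply, Matrix.add_apply, Matrix.mul_apply, sum_apply, add_apply, smul_apply,
    smul_eq_mul, ← Finset.sum_add_distrib]
  exact Finset.sum_congr rfl fun j _ => by ring

omit [Fintype J] in
theorem matD_const (C : Matrix I J ℂ) (w : Fin m → ℝ) : matD w (fun _ => C) x = 0 := by
  rw [matD_eq_of_hasFDerivAt (A := fun _ => C) (fun i j => hasFDerivAt_const _ _)]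
  rfl

end MatD

section Hierarchy

variable {m : ℕ} {U : ℕ → (Fin m → ℝ) → Matrix (Fin m ⊕ Unit) (Fin m ⊕ Unit) ℂ}
  {S : Set (Fin m → ℝ)}

/-- The differential equations in `x` that couple the moments `U n`. -/
def IsMomentHierarchy (U : ℕ → (Fin m → ℝ) → Matrix (Fin m ⊕ Unit) (Fin m ⊕ Unit) ℂ)
    (S : Set (Fin m → ℝ)) : Prop :=
  ∀ x ∈ S, ∀ n i k, HasFDerivAt (fun x' => U n x' i k)
    (∑ j, (ContinuousLinearMap.proj (R := ℝ) j : (Fin m → ℝ) →L[ℝ] ℝ).smulRight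
      ((padDiag (Pi.single j 1) * U (n + 1) x - U (n + 1) x * padDiag (Pi.single j 1)
        + (U 0 x * padDiag (Pi.single j 1) - padDiag (Pi.single j 1) * U 0 x) * U n x) i k)) x

theorem padDiag_eq_sum (w : Fin m → ℂ) :
    padDiag w = ∑ j, w j • padDiag (Pi.single j (1 : ℂ)) := by
  ext i k
  rw [Matrix.sum_apply]
  rcases eq_or_ne i k with rfl | hik
  · rcases i with i | i <;> simp [padDiag, Pi.single_apply]
  · simp [padDiag, hik]

namespace IsMomentHierarchy

variable (h : IsMomentHierarchy U S)
include h

theorem differentiableAt {x : Fin m → ℝ} (hx : x ∈ S) (n : ℕ) (i k : Fin m ⊕ Unit) :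
    DifferentiableAt ℝ (fun x' => U n x' i k) x := (h x hx n i k).differentiableAt

theorem matD_eq {x : Fin m → ℝ} (hx : x ∈ S) (n : ℕ) (w : Fin m → ℝ) :
    matD w (U n) x = ⁅padZero (realDiag w), U (n + 1) x⁆
      + ⁅U 0 x, padZero (realDiag w)⁆ * U n x := by
  rw [matD_eq_of_hasFDerivAt (h x hx n), padZero_realDiag, padDiag_eq_sum, Ring.lie_def,
    Ring.lie_def]
  ext i k
  simp only [Matrix.of_apply, sum_apply, ContinuousLinearMap.smulRight_apply,
    ContinuousLinearMap.proj_apply, Finset.sum_mul, Finset.mul_sum, ← Finset.sum_sub_distrib,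
    ← Finset.sum_add_distrib, Matrix.sum_apply]
  refine Finset.sum_congr rfl fun j _ => ?_
  simp only [smul_mul_assoc, mul_smul_comm, ← smul_sub, ← smul_add, Matrix.smul_apply,
    Complex.real_smul, smul_eq_mul]

theorem matD_matD_eq (hS : IsOpen S) {x : Fin m → ℝ} (hx : x ∈ S) (w : Fin m → ℝ) :
    matD w (matD w (U 0)) x = ⁅padZero (realDiag w), matD w (U 1) x⁆
      + ⁅matD w (U 0) x, padZero (realDiag w)⁆ * U 0 x
      + ⁅U 0 x, padZero (realDiag w)⁆ * matD w (U 0) x := by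
  have hd := h.differentiableAt hx
  set T := padZero (realDiag w) with hT
  have hc : ∀ i k, DifferentiableAt ℝ (fun _ : Fin m → ℝ => T i k) x := fun i k =>
    differentiableAt_const _
  have h1 : ∀ n i k, DifferentiableAt ℝ (fun x' => (T * U n x') i k) x := fun n =>
    differentiableAt_matrix_mul hc (hd n)
  have h2 : ∀ n i k, DifferentiableAt ℝ (fun x' => (U n x' * T) i k) x := fun n =>
    differentiableAt_matrix_mul (hd n) hc
  have h3 : ∀ i k, DifferentiableAt ℝ (fun x' => (U 0 x' * T - T * U 0 x') i k) x := fun i k =>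
    (h2 0 i k).sub (h1 0 i k)
  rw [matD_congr (B := fun x' => (T * U 1 x' - U 1 x' * T) + (U 0 x' * T - T * U 0 x') * U 0 x')
    (by filter_upwards [hS.mem_nhds hx] with x' hx'; exact h.matD_eq hx' 0 w),
    matD_add (A := fun x' => T * U 1 x' - U 1 x' * T) (fun i k => (h1 1 i k).sub (h2 1 i k)) (differentiableAt_matrix_mul h3 (hd 0)),
    matD_mul h3 (hd 0), matD_sub (h1 1) (h2 1), matD_sub (h2 0) (h1 0), matD_mul hc (hd 1),
    matD_mul (hd 1) hc, matD_mul hc (hd 0), matD_mul (hd 0) hc, matD_const]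
  simp only [Ring.lie_def, Matrix.zero_mul, Matrix.mul_zero, add_zero, zero_add, add_assoc]

/-- The derivative of each `U n` is polynomial in the entries of `U n`, `U (n + 1)` and `U 0`. Hence
if all moments are `C^r`, all are `C^(r+1)`; the induction has to run over all `n` at once. -/
theorem contDiffOn (hS : IsOpen S) (r : ℕ) (n : ℕ) (i k : Fin m ⊕ Unit) :
    ContDiffOn ℝ r (fun x => U n x i k) S := by
  induction r generalizing n i k with
  | zero =>
    exact contDiffOn_zero.2 fun x hx => (h.differentiableAt hx n i k).continuousAt.continuousWithinAt
  | succ r ih =>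
    push_cast
    refine (contDiffOn_succ_iff_fderiv_of_isOpen hS).2
      ⟨fun x hx => (h.differentiableAt hx n i k).differentiableWithinAt, by simp, ?_⟩
    refine ContDiffOn.congr ?_ fun x hx => (h x hx n i k).fderiv
    refine ContDiffOn.sum fun j _ => ?_
    refine (ContinuousLinearMap.smulRightL ℝ (Fin m → ℝ) ℂ
      (ContinuousLinearMap.proj j)).contDiff.comp_contDiffOn ?_
    simp only [Matrix.add_apply, Matrix.sub_apply, Matrix.mul_apply]
    fun_prop (disch := assumption)

/-- The matrix ODE system for functions that agree with the blocks of `U 0`. -/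
theorem matrixODESystem (hS : IsOpen S) {y t : Fin m → ℝ}
    {Φ : (Fin m → ℝ) → Matrix (Fin m ⊕ Unit) (Fin m ⊕ Unit) ℂ} (hΦ : ∀ x ∈ S, Φ x = U 0 x)
    {x : Fin m → ℝ} (hx : x ∈ S)
    (key : MomentIdentity (realDiag t) (realDiag y) (realDiag x) (U 0 x) (U 1 x) (U 2 x)) :
    MatrixODESystem y t (fun x' => (Φ x').toBlocks₁₁) (fun x' => (Φ x').toBlocks₁₂)
      (fun x' => (Φ x').toBlocks₂₁) x := by
  have h1 : ∀ x ∈ S, matD t Φ x = matD t (U 0) x := fun x hx =>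
    matD_congr (Filter.mem_of_superset (hS.mem_nhds hx) hΦ) t
  have h2 : matD t (matD t Φ) x = matD t (matD t (U 0)) x :=
    matD_congr (Filter.mem_of_superset (hS.mem_nhds hx) h1) t
  have hcomm : ∀ v : Fin m → ℝ, realDiag t * realDiag v = realDiag v * realDiag t := fun v => by
    simp only [realDiag, Matrix.diagonal_mul_diagonal, mul_comm]
  exact odeSystem_of_momentIdentity (hcomm y) (hcomm x) (h.matD_eq hx 0 t) (h.matD_eq hx 1 t)
    (h.matD_matD_eq hS hx t) key
    (congrArg Matrix.toBlocks₁₁ (hΦ x hx)) (congrArg Matrix.toBlocks₁₂ (hΦ x hx))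
    (congrArg Matrix.toBlocks₂₁ (hΦ x hx)) (congrArg Matrix.toBlocks₁₁ (h1 x hx))
    (congrArg Matrix.toBlocks₁₂ (h1 x hx)) (congrArg Matrix.toBlocks₂₁ (h1 x hx))
    (congrArg Matrix.toBlocks₁₁ h2) (congrArg Matrix.toBlocks₁₂ h2)
    (congrArg Matrix.toBlocks₂₁ h2)

/-- The reduced system for functions that agree with the blocks of `U 0`. -/
theorem reducedODESystem (hS : IsOpen S) {y t : Fin m → ℝ} {τ : ℝ} (ht : ∀ k, t k = τ)
    {Φ : (Fin m → ℝ) → Matrix (Fin m ⊕ Unit) (Fin m ⊕ Unit) ℂ} (hΦ : ∀ x ∈ S, Φ x = U 0 x)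
    {x : Fin m → ℝ} (hx : x ∈ S)
    (key : MomentIdentity (realDiag t) (realDiag y) (realDiag x) (U 0 x) (U 1 x) (U 2 x)) :
    ReducedODESystem τ y (fun x' => (Φ x').toBlocks₁₁) (fun x' => (Φ x').toBlocks₁₂)
      (fun x' => (Φ x').toBlocks₂₁) x := by
  have h1 : ∀ x ∈ S, matD (fun _ => 1) Φ x = matD (fun _ => 1) (U 0) x := fun x hx =>
    matD_congr (Filter.mem_of_superset (hS.mem_nhds hx) hΦ) _
  have h2 : matD (fun _ => 1) (matD (fun _ => 1) Φ) x
      = matD (fun _ => 1) (matD (fun _ => 1) (U 0)) x :=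
    matD_congr (Filter.mem_of_superset (hS.mem_nhds hx) h1) _
  have e1 : realDiag (fun _ : Fin m => 1) = 1 := by simp [realDiag]
  have et : realDiag t = (τ : ℂ) • (1 : Matrix (Fin m) (Fin m) ℂ) := by
    rw [Matrix.smul_one_eq_diagonal, realDiag]
    simp only [ht]
  rw [et] at key
  have d0 := h.matD_eq hx 0 fun _ => 1
  have d1 := h.matD_eq hx 1 fun _ => 1
  have d2 := h.matD_matD_eq hS hx fun _ => 1
  rw [e1] at d0 d1 d2
  exact reducedSystem_of_momentIdentity (τ : ℂ) d0 d1 d2 key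
    (congrArg Matrix.toBlocks₁₁ (hΦ x hx)) (congrArg Matrix.toBlocks₁₂ (hΦ x hx))
    (congrArg Matrix.toBlocks₂₁ (hΦ x hx)) (congrArg Matrix.toBlocks₁₁ (h1 x hx))
    (congrArg Matrix.toBlocks₁₂ (h1 x hx)) (congrArg Matrix.toBlocks₂₁ (h1 x hx))
    (congrArg Matrix.toBlocks₁₂ h2) (congrArg Matrix.toBlocks₂₁ h2)

end IsMomentHierarchy

end Hierarchy

/-! ### From the operators to the hierarchy. -/

section Assembly

attribute [local instance] Matrix.linftyOpNormedRing Matrix.linftyOpNormedAlgebra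

variable {m : ℕ} {ι : Type*} [Fintype ι] {Γ : ι → SimpleContour}
  {F G : ℂ → Fin m ⊕ Unit → ℂ} {c : Params m → ℂ → ℂ}
  {H : Params m → (ContourL2 Γ →L[ℂ] ContourL2 Γ)} {U : Set (Params m)}

theorem hasFDerivAt_comp_ofReal {f : (Fin m → ℂ) → ℂ} {x : Fin m → ℝ} {a : Fin m → ℂ}
    (h : HasFDerivAt f (∑ j, (ContinuousLinearMap.proj (R := ℂ) j :
      (Fin m → ℂ) →L[ℂ] ℂ).smulRight (a j)) (fun k => (x k : ℂ))) :
    HasFDerivAt (fun x' : Fin m → ℝ => f fun k => (x' k : ℂ))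
      (∑ j, (ContinuousLinearMap.proj (R := ℝ) j : (Fin m → ℝ) →L[ℝ] ℝ).smulRight (a j)) x := by
  set e : (Fin m → ℝ) →L[ℝ] (Fin m → ℂ) := ContinuousLinearMap.pi fun k =>
    Complex.ofRealCLM.comp (ContinuousLinearMap.proj k) with he
  refine ((h.restrictScalars ℝ).comp x (f := fun x' : Fin m → ℝ => fun k => (x' k : ℂ))
    e.hasFDerivAt).congr_fderiv ?_
  ext1 v
  simp [he, sum_apply, Complex.real_smul]

/-- The moments attached to the operators of the family are solutions of the hierarchy. -/
theorem exists_momentHierarchy (hdisj : Pairwise fun a b => Disjoint (Γ a).trace (Γ b).trace)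
    (hsep : SeparatedAtInfinity Γ)
    (hU : ∀ t : Fin m → ℝ, IsOpen {w : (Fin m → ℝ) × (Fin m → ℝ) | (w.1, w.2, t) ∈ U})
    (hH : ∀ P ∈ U, IsStronglyCubicIntegrable Γ F G (c P) P (H P))
    (hinv : ∀ P ∈ U, IsUnit (1 - H P)) (y t : Fin m → ℝ) :
    ∃ M : ℕ → (Fin m → ℝ) → Matrix (Fin m ⊕ Unit) (Fin m ⊕ Unit) ℂ,
      IsMomentHierarchy M {x | (x, y, t) ∈ U} ∧ ∀ x, (x, y, t) ∈ U →
        phiOne Γ F G (c (x, y, t)) (x, y, t) (H (x, y, t)) = M 0 x ∧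
        MomentIdentity (realDiag t) (realDiag y) (realDiag x) (M 0 x) (M 1 x) (M 2 x) := by
  obtain ⟨C, N, hk⟩ := hsep.exists_isModerateKernel
  refine ⟨fun n x => moment Γ (resolventOne hk (jumpAt Γ (contourValue Γ F) (contourValue Γ G)
    (fun j => (x j : ℂ)) y t)) (jumpAt Γ (contourValue Γ F) (contourValue Γ G)
    (fun j => (x j : ℂ)) y t) n, fun x hx n i k => ?_, fun x hx => ?_⟩ <;>
  obtain ⟨δ, hδ, hj⟩ := exists_expDecaying hU hH hx <;>
  have hJ := hj.rapidlyIntegrable_jumpAt_self hδ <;>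
  have hu := (hH _ hx).isUnit_one_sub_kernelOp hk hsep hdisj (hinv _ hx) hJ
  · exact hasFDerivAt_comp_ofReal (hasFDerivAt_moment hk hδ hj hu
      (hH _ hx).contourValue_mul_eq_zero hsep n i k)
  · exact ⟨(hH _ hx).phiOne_eq_moment hk hsep (hinv _ hx) hJ hu,
      momentIdentity_moment hk hδ hj hu (hH _ hx).contourValue_mul_eq_zero hsep rfl⟩

end Assembly
end

/-! ### Rescaling to the Tracy–Widom system. -/

noncomputable section

section Rescaling

variable {m : ℕ}

theorem mul_mul_eq_zero_iff_of_inverse {J : Type*} {E E' : Matrix (Fin m) (Fin m) ℂ}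
    (h : E' * E = 1) (Z : Matrix (Fin m) J ℂ) : E * Z = 0 ↔ Z = 0 := by
  refine ⟨fun hZ => ?_, fun hZ => by rw [hZ, Matrix.mul_zero]⟩
  rw [← Matrix.one_mul Z, ← h, Matrix.mul_assoc, hZ, Matrix.mul_zero]

theorem mul_right_eq_zero_iff_of_inverse {I : Type*} {E E' : Matrix (Fin m) (Fin m) ℂ}
    (h : E' * E = 1) (Z : Matrix I (Fin m) ℂ) : Z * E' = 0 ↔ Z = 0 := by
  refine ⟨fun hZ => ?_, fun hZ => by rw [hZ, Matrix.zero_mul]⟩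
  rw [← Matrix.mul_one Z, ← h, ← Matrix.mul_assoc, hZ, Matrix.zero_mul]

/-- The algebraic part of the equivalence of the reduced system and the Tracy–Widom system: `E` and
`E'` are the gauge matrices, `a` and `c` the scaling constants. -/
theorem reduced_iff_tracyWidom_of_gauge {σ a c : ℂ} (hσ : σ * a ^ 3 = 1) (hc : c * c = -a ^ 2)
    {E E' Y X : Matrix (Fin m) (Fin m) ℂ} (hE : E' * E = 1) (hY : Y * E = E * Y)
    (hY' : E' * Y = Y * E') (hX : X * E = E * X) (hX' : E' * X = X * E')
    (Q dQ : Matrix (Fin m) (Fin m) ℂ) (P dP ddP : Matrix (Fin m) Unit ℂ)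
    (R dR ddR : Matrix Unit (Fin m) ℂ) {q Dq : Matrix (Fin m) (Fin m) ℂ}
    {p Dp DDp : Matrix (Fin m) Unit ℂ} {r Dr DDr : Matrix Unit (Fin m) ℂ}
    (hq : q = (-a) • (E * Q * E')) (hp : p = c • (E * P)) (hr : r = c • (R * E'))
    (hDq : Dq = (-a) • (E * (a • dQ + a ^ 3 • ⁅Y, Q⁆) * E'))
    (hDp : Dp = c • (E * (a • dP + a ^ 3 • (Y * P))))
    (hDr : Dr = c • ((a • dR - a ^ 3 • (R * Y)) * E'))
    (hDDp : DDp = c • (E * (a ^ 2 • ddP + (2 * a ^ 4) • (Y * dP) + a ^ 6 • (Y * (Y * P)))))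
    (hDDr : DDr = c • ((a ^ 2 • ddR - (2 * a ^ 4) • (dR * Y) + a ^ 6 • (R * Y * Y)) * E')) :
    ((Dq + p * r = 0) ∧
    ((-σ) • DDp + (2 : ℂ) • (Y * Dp) + (-2 * σ) • (p * r * p) - (2 : ℂ) • (⁅Y, q⁆ * p)
      + X * p = 0) ∧
    ((-σ) • DDr - (2 : ℂ) • (Dr * Y) + (-2 * σ) • (r * p * r) - (2 : ℂ) • (r * ⁅Y, q⁆)
      + r * X = 0)) ↔
    ((dQ = -⁅a ^ 2 • Y, Q⁆ - P * R) ∧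
    (ddP = (a • X + a ^ 4 • (Y * Y)) * P + (2 : ℂ) • (P * R * P)
      + (2 : ℂ) • (⁅a ^ 2 • Y, Q⁆ * P)) ∧
    (ddR = R * (a • X + a ^ 4 • (Y * Y)) + (2 : ℂ) • (R * P * R)
      + (2 : ℂ) • (R * ⁅a ^ 2 • Y, Q⁆))) := by
  have hσ0 : σ ≠ 0 := left_ne_zero_of_mul (hσ.trans_ne one_ne_zero)
  have ha : a ≠ 0 := fun h => by simp [h] at hσ
  have hc0 : c ≠ 0 := fun h => by simp [h, ha] at hc
  have k1 : σ * a ^ 3 - 1 = 0 := sub_eq_zero.2 hσ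
  have k2 : c * c + a ^ 2 = 0 := by rw [hc]; ring
  have rE : ∀ {k : Type} (Z : Matrix (Fin m) k ℂ), E' * (E * Z) = Z := fun Z => by
    rw [← Matrix.mul_assoc, hE, Matrix.one_mul]
  have rY : ∀ {k : Type} (Z : Matrix (Fin m) k ℂ), Y * (E * Z) = E * (Y * Z) := fun Z => by
    rw [← Matrix.mul_assoc, hY, Matrix.mul_assoc]
  have rX : ∀ {k : Type} (Z : Matrix (Fin m) k ℂ), X * (E * Z) = E * (X * Z) := fun Z => by
    rw [← Matrix.mul_assoc, hX, Matrix.mul_assoc]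
  refine and_congr ?_ (and_congr ?_ ?_)
  -- In each of the three cases the left side is an invertible multiple of the gauged Tracy–Widom
  -- equation plus multiples of `σ a³ - 1` and `c² + a²`, both of which are zero. The equivalence
  -- follows as the gauge matrices cancel.
  · have h : Dq + p * r = (-a ^ 2) • (E * ((dQ - (-⁅a ^ 2 • Y, Q⁆ - P * R)) * E'))
        + (c * c + a ^ 2) • (E * (P * (R * E'))) := by
      simp only [hp, hr, hDq, Ring.lie_def, Matrix.mul_add, Matrix.add_mul, Matrix.mul_sub,
        Matrix.sub_mul, Matrix.neg_mul, Matrix.mul_neg, Matrix.mul_assoc, Matrix.mul_smul,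
        Matrix.smul_mul]
      module
    rw [h, k2, zero_smul, add_zero, smul_eq_zero_iff_right (neg_ne_zero.2 (pow_ne_zero 2 ha)),
      mul_mul_eq_zero_iff_of_inverse hE, mul_right_eq_zero_iff_of_inverse hE,
      sub_eq_zero]
  · have h : (-σ) • DDp + (2 : ℂ) • (Y * Dp) + (-2 * σ) • (p * r * p) - (2 : ℂ) • (⁅Y, q⁆ * p)
        + X * p = (-σ * a ^ 2 * c) • (E * (ddP - ((a • X + a ^ 4 • (Y * Y)) * P
          + (2 : ℂ) • (P * R * P) + (2 : ℂ) • (⁅a ^ 2 • Y, Q⁆ * P))))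
        + (σ * a ^ 3 - 1) • (c • (E * (-(2 * a) • (Y * dP) - (2 * a ^ 3) • (Y * (Y * P)) - X * P
          - (2 * a) • (⁅Y, Q⁆ * P))))
        + (c * c + a ^ 2) • ((-2 * σ * c) • (E * (P * (R * P)))) := by
      simp only [hq, hp, hr, hDp, hDDp, Ring.lie_def, Matrix.mul_add, Matrix.add_mul,
        Matrix.mul_sub, Matrix.sub_mul, Matrix.mul_assoc,
        Matrix.mul_smul, Matrix.smul_mul, rE, rY, rX]
      module
    rw [h, k1, k2, zero_smul, zero_smul, add_zero, add_zero, smul_eq_zero_iff_right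
      (mul_ne_zero (mul_ne_zero (neg_ne_zero.2 hσ0) (pow_ne_zero 2 ha)) hc0),
      mul_mul_eq_zero_iff_of_inverse hE, sub_eq_zero]
  · have h : (-σ) • DDr - (2 : ℂ) • (Dr * Y) + (-2 * σ) • (r * p * r) - (2 : ℂ) • (r * ⁅Y, q⁆)
        + r * X = (-σ * a ^ 2 * c) • ((ddR - (R * (a • X + a ^ 4 • (Y * Y))
          + (2 : ℂ) • (R * P * R) + (2 : ℂ) • (R * ⁅a ^ 2 • Y, Q⁆))) * E')
        + (σ * a ^ 3 - 1) • (c • (((2 * a) • (dR * Y) - (2 * a ^ 3) • (R * Y * Y) - R * X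
          - (2 * a) • (R * ⁅Y, Q⁆)) * E'))
        + (c * c + a ^ 2) • ((-2 * σ * c) • (R * (P * (R * E')))) := by
      simp only [hq, hp, hr, hDr, hDDr, Ring.lie_def, Matrix.mul_add, Matrix.add_mul,
        Matrix.mul_sub, Matrix.sub_mul, Matrix.mul_assoc,
        Matrix.mul_smul, Matrix.smul_mul, rE, rY, hY', hX']
      module
    rw [h, k1, k2, zero_smul, zero_smul, add_zero, add_zero, smul_eq_zero_iff_right
      (mul_ne_zero (mul_ne_zero (neg_ne_zero.2 hσ0) (pow_ne_zero 2 ha)) hc0),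
      mul_right_eq_zero_iff_of_inverse hE, sub_eq_zero]

variable {I J : Type*} {x : Fin m → ℝ}

theorem matD_smul (c : ℂ) (A : (Fin m → ℝ) → Matrix I J ℂ) (w : Fin m → ℝ) (x : Fin m → ℝ) :
    matD w (fun x' => c • A x') x = c • matD w A x := by
  ext i j
  simp only [matD, Matrix.of_apply, Matrix.smul_apply, smul_eq_mul, lineDeriv,
    deriv_const_mul_field, Finset.mul_sum]
  exact Finset.sum_congr rfl fun k _ => mul_left_comm _ _ _

/-- Along a line the map `ξ` only rescales the parameter, and the chain rule for a scaling needs no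
differentiability. So it applies to `matD w A` as well, about which nothing is known beforehand. -/
theorem matD_comp_affine {ξ : (Fin m → ℝ) → Fin m → ℝ} {a : ℝ}
    (hξ : ∀ (x v : Fin m → ℝ) (s : ℝ), ξ (x + s • v) = ξ x + (a * s) • v)
    (A : (Fin m → ℝ) → Matrix I J ℂ) (w : Fin m → ℝ) (x : Fin m → ℝ) :
    matD w (fun x' => A (ξ x')) x = (a : ℂ) • matD w A (ξ x) := by
  ext i j
  simp only [matD, Matrix.of_apply, Matrix.smul_apply, smul_eq_mul, lineDeriv, hξ, Finset.mul_sum]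
  refine Finset.sum_congr rfl fun k _ => ?_
  have h := deriv_comp_mul_left a (fun s : ℝ => A (ξ x + s • Pi.single k 1) i j) 0
  rw [h, mul_zero, Complex.real_smul]
  ring

theorem differentiableAt_matD {V : Set (Fin m → ℝ)} (hV : IsOpen V)
    {A : (Fin m → ℝ) → Matrix I J ℂ} (hA : ∀ i j, ContDiffOn ℝ 2 (fun x => A x i j) V)
    (hx : x ∈ V) (w : Fin m → ℝ) (i : I) (j : J) :
    DifferentiableAt ℝ (fun x' => matD w A x' i j) x := by
  have h1 : (fun x' => matD w A x' i j) =ᶠ[𝓝 x] fun x' => fderiv ℝ (fun x => A x i j) x' w := by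
    filter_upwards [hV.mem_nhds hx] with x' hx'
    rw [matD_eq_of_hasFDerivAt fun i j => (((hA i j).contDiffAt (hV.mem_nhds hx')).differentiableAt
      two_ne_zero).hasFDerivAt]
    rfl
  refine DifferentiableAt.congr_of_eventuallyEq ?_ h1
  exact ((((hA i j).contDiffAt (hV.mem_nhds hx)).fderiv_right (m := 1)
    (by norm_num)).differentiableAt one_ne_zero).clm_apply (differentiableAt_const w)

theorem contDiff_gaugeExp (ε σ : ℝ) (y : Fin m → ℝ) (i j : Fin m) :
    ContDiff ℝ 2 fun x => gaugeExp ε σ y x i j := by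
  by_cases hij : i = j
  · subst hij
    simp only [gaugeExp, realDiag, Matrix.diagonal_apply_eq]
    exact Complex.ofRealCLM.contDiff.comp (Real.contDiff_exp.comp (by fun_prop))
  · simp only [gaugeExp, realDiag, Matrix.diagonal_apply_ne _ hij]
    exact contDiff_const

theorem differentiableAt_gaugeExp (ε σ : ℝ) (y : Fin m → ℝ) (i j : Fin m) :
    DifferentiableAt ℝ (fun x => gaugeExp ε σ y x i j) x :=
  (contDiff_gaugeExp ε σ y i j).differentiable two_ne_zero x

theorem matD_gaugeExp (ε σ : ℝ) (y : Fin m → ℝ) :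
    matD (fun _ => 1) (gaugeExp ε σ y) x
      = (ε / σ : ℂ) • (realDiag y * gaugeExp ε σ y x) := by
  have h : ∀ i j, HasFDerivAt (fun x => gaugeExp ε σ y x i j)
      ((ContinuousLinearMap.proj (R := ℝ) i : (Fin m → ℝ) →L[ℝ] ℝ).smulRight
        ((ε / σ * y i : ℂ) * gaugeExp ε σ y x i j)) x := by
    intro i j
    by_cases hij : i = j
    · subst hij
      simp only [gaugeExp, realDiag, Matrix.diagonal_apply_eq]
      have h1 := (((((ContinuousLinearMap.proj (R := ℝ) i : (Fin m → ℝ) →L[ℝ] ℝ).hasFDerivAt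
        (x := x)).mul_const (y i / σ)).add_const (2 * y i ^ 3 / (3 * σ ^ 2))).const_mul ε).exp
      refine ((Complex.ofRealCLM.hasFDerivAt.comp x h1).congr_fderiv ?_).congr_of_eventuallyEq
        (Eventually.of_forall fun x' => ?_)
      · ext1 v
        simp
        ring_nf
      · simp
        ring_nf
    · simp only [gaugeExp, realDiag, Matrix.diagonal_apply_ne _ hij, mul_zero]
      refine (hasFDerivAt_const _ _).congr_fderiv ?_
      ext1 v
      simp
  rw [matD_eq_of_hasFDerivAt h]
  ext i j
  rw [Matrix.smul_apply, realDiag, Matrix.diagonal_mul]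
  simp [mul_assoc]

theorem realDiag_commute (v w : Fin m → ℝ) : realDiag v * realDiag w = realDiag w * realDiag v := by
  simp only [realDiag, Matrix.diagonal_mul_diagonal, mul_comm]

theorem gaugeExp_mul_gaugeExp {ε ε' : ℝ} (h : ε + ε' = 0) (σ : ℝ) (y x : Fin m → ℝ) :
    gaugeExp ε σ y x * gaugeExp ε' σ y x = 1 := by
  rw [gaugeExp, gaugeExp, realDiag, realDiag, Matrix.diagonal_mul_diagonal,
    ← Matrix.diagonal_one]
  congr 1
  ext k
  rw [← Complex.ofReal_mul, ← Real.exp_add, ← add_mul, h, zero_mul, Real.exp_zero,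
    Complex.ofReal_one]

theorem matD_gaugeExp_mul (ε σ : ℝ) (y : Fin m → ℝ) {A : (Fin m → ℝ) → Matrix (Fin m) J ℂ}
    (hA : ∀ i j, DifferentiableAt ℝ (fun x' => A x' i j) x) :
    matD (fun _ => 1) (fun x' => gaugeExp ε σ y x' * A x') x = gaugeExp ε σ y x *
      (matD (fun _ => 1) A x + (ε / σ : ℂ) • (realDiag y * A x)) := by
  rw [matD_mul (differentiableAt_gaugeExp ε σ y) hA, matD_gaugeExp, gaugeExp, realDiag_commute]
  simp only [Matrix.smul_mul, Matrix.mul_add, Matrix.mul_smul, Matrix.mul_assoc]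
  exact add_comm _ _

theorem matD_mul_gaugeExp (ε σ : ℝ) (y : Fin m → ℝ) {A : (Fin m → ℝ) → Matrix I (Fin m) ℂ}
    (hA : ∀ i j, DifferentiableAt ℝ (fun x' => A x' i j) x) :
    matD (fun _ => 1) (fun x' => A x' * gaugeExp ε σ y x') x =
      (matD (fun _ => 1) A x + (ε / σ : ℂ) • (A x * realDiag y)) * gaugeExp ε σ y x := by
  rw [matD_mul hA (differentiableAt_gaugeExp ε σ y), matD_gaugeExp]
  simp only [Matrix.mul_smul, Matrix.add_mul, Matrix.smul_mul, Matrix.mul_assoc]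

end Rescaling
end

noncomputable section

section RescalingEquivalence

variable {m : ℕ}

theorem contDiffOn_matrix_mul {I J K : Type*} [Fintype J] {V : Set (Fin m → ℝ)}
    {A : (Fin m → ℝ) → Matrix I J ℂ} {B : (Fin m → ℝ) → Matrix J K ℂ}
    (hA : ∀ i j, ContDiffOn ℝ 2 (fun x => A x i j) V)
    (hB : ∀ i j, ContDiffOn ℝ 2 (fun x => B x i j) V) (i : I) (k : K) :
    ContDiffOn ℝ 2 (fun x => (A x * B x) i k) V := by
  simp only [Matrix.mul_apply]
  exact ContDiffOn.sum fun j _ => (hA i j).mul (hB j k)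

/-- Regularity is assumed for `q`, `p`, `r` only; after the gauge is undone, this carries it over to
the compositions of `Q`, `P`, `R` with `ξ`. -/
theorem contDiffOn_matrix_of_smul_eq {I J : Type*} {V : Set (Fin m → ℝ)} {c : ℂ} (hc : c ≠ 0)
    {A B : (Fin m → ℝ) → Matrix I J ℂ} (hA : ∀ i j, ContDiffOn ℝ 2 (fun x => A x i j) V)
    (h : ∀ x ∈ V, A x = c • B x) (i : I) (j : J) : ContDiffOn ℝ 2 (fun x => B x i j) V := by
  refine ((hA i j).const_smul c⁻¹).congr fun x hx => ?_
  rw [h x hx, Matrix.smul_apply, smul_smul, inv_mul_cancel₀ hc, one_smul]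

theorem xiMap_add_smul (σ : ℝ) (y x v : Fin m → ℝ) (s : ℝ) :
    xiMap σ y (x + s • v) = xiMap σ y x + ((σ ^ (1 / 3 : ℝ))⁻¹ * s) • v := by
  ext k
  simp only [xiMap, Pi.add_apply, Pi.smul_apply, smul_eq_mul]
  ring

section Differentiate

variable {J : Type*} {V : Set (Fin m → ℝ)} {σ : ℝ} {y : Fin m → ℝ} {x : Fin m → ℝ} {a c : ℂ}

/-- First and second derivatives of a function that is gauged from the left. -/
theorem matD_gauge_left (hV : IsOpen V) (ha : ((σ ^ (1 / 3 : ℝ))⁻¹ : ℝ) = a)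
    (hs : (1 / σ : ℂ) = a ^ 3)
    {p P : (Fin m → ℝ) → Matrix (Fin m) J ℂ} (hc : c ≠ 0)
    (hp : ∀ i j, ContDiffOn ℝ 2 (fun x => p x i j) V)
    (h : ∀ x ∈ V, p x = c • (gaugeExp 1 σ y x * P (xiMap σ y x))) (hx : x ∈ V) :
    matD (fun _ => 1) p x = c • (gaugeExp 1 σ y x * (a • matD (fun _ => 1) P (xiMap σ y x)
      + a ^ 3 • (realDiag y * P (xiMap σ y x)))) ∧
    matD (fun _ => 1) (matD (fun _ => 1) p) x = c • (gaugeExp 1 σ y x *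
      (a ^ 2 • matD (fun _ => 1) (matD (fun _ => 1) P) (xiMap σ y x)
      + (2 * a ^ 4) • (realDiag y * matD (fun _ => 1) P (xiMap σ y x))
      + a ^ 6 • (realDiag y * (realDiag y * P (xiMap σ y x))))) := by
  have hP : ∀ i j, ContDiffOn ℝ 2 (fun x => P (xiMap σ y x) i j) V := by
    have h1 : ∀ x ∈ V, gaugeExp (-1) σ y x * p x = c • P (xiMap σ y x) := fun x hx => by
      rw [h x hx, Matrix.mul_smul, ← Matrix.mul_assoc, gaugeExp_mul_gaugeExp (by norm_num),
        Matrix.one_mul]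
    exact contDiffOn_matrix_of_smul_eq hc (contDiffOn_matrix_mul
      (fun i j => (contDiff_gaugeExp (-1) σ y i j).contDiffOn) hp) h1
  have hcomp : ∀ (A : (Fin m → ℝ) → Matrix (Fin m) J ℂ) (x : Fin m → ℝ),
      matD (fun _ => 1) (fun x' => A (xiMap σ y x')) x = a • matD (fun _ => 1) A (xiMap σ y x) :=
    fun A x => by
      rw [← ha]
      exact matD_comp_affine (xiMap_add_smul σ y) A _ x
  have hs' : ((1 : ℝ) / σ : ℂ) = a ^ 3 := by rw [← hs, Complex.ofReal_one]
  have hd : ∀ x ∈ V, ∀ i j, DifferentiableAt ℝ (fun x => P (xiMap σ y x) i j) x := fun x hx i j =>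
    ((hP i j).contDiffAt (hV.mem_nhds hx)).differentiableAt two_ne_zero
  have h1 : ∀ x ∈ V, matD (fun _ => 1) p x = c • (gaugeExp 1 σ y x *
      (a • matD (fun _ => 1) P (xiMap σ y x) + a ^ 3 • (realDiag y * P (xiMap σ y x)))) :=
    fun x hx => by
      rw [matD_congr (Filter.mem_of_superset (hV.mem_nhds hx) h), matD_smul,
        matD_gaugeExp_mul 1 σ y (A := fun x => P (xiMap σ y x)) (hd x hx), hcomp, hs']
  refine ⟨h1 x hx, ?_⟩
  have hdY : ∀ i j, DifferentiableAt ℝ (fun x => (realDiag y * P (xiMap σ y x)) i j) x :=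
    differentiableAt_matrix_mul (fun i j => differentiableAt_const _) (hd x hx)
  -- `P` itself is not known to be differentiable at `ξ`, but `a` times its derivative there is the
  -- derivative of the `C²` function `P ∘ ξ`.
  have hd2 : ∀ i j, DifferentiableAt ℝ
      (fun x => (a • matD (fun _ => 1) P (xiMap σ y x)) i j) x := fun i j => by
    simp only [← hcomp]
    exact differentiableAt_matD hV hP hx _ i j
  have hd3 : ∀ i j, DifferentiableAt ℝ
      (fun x => (a ^ 3 • (realDiag y * P (xiMap σ y x))) i j) x := fun i j =>
    (hdY i j).const_smul (a ^ 3)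
  rw [matD_congr (Filter.mem_of_superset (hV.mem_nhds hx) h1), matD_smul,
    matD_gaugeExp_mul 1 σ y (A := fun x => a • matD (fun _ => 1) P (xiMap σ y x)
      + a ^ 3 • (realDiag y * P (xiMap σ y x))) (fun i j => (hd2 i j).add (hd3 i j)), hs',
    matD_add hd2 hd3, matD_smul, matD_smul, hcomp (matD (fun _ => 1) P),
    matD_mul (A := fun _ => realDiag y) (fun i j => differentiableAt_const _) (hd x hx), matD_const,
    hcomp]
  congr 2
  simp only [Matrix.zero_mul, zero_add, Matrix.mul_add, Matrix.mul_smul]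
  module

/-- First and second derivatives of a function that is gauged from the right. -/
theorem matD_gauge_right (hV : IsOpen V) (ha : ((σ ^ (1 / 3 : ℝ))⁻¹ : ℝ) = a)
    (hs : (1 / σ : ℂ) = a ^ 3)
    {r R : (Fin m → ℝ) → Matrix J (Fin m) ℂ} (hc : c ≠ 0)
    (hr : ∀ i j, ContDiffOn ℝ 2 (fun x => r x i j) V)
    (h : ∀ x ∈ V, r x = c • (R (xiMap σ y x) * gaugeExp (-1) σ y x)) (hx : x ∈ V) :
    matD (fun _ => 1) r x = c • ((a • matD (fun _ => 1) R (xiMap σ y x)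
      - a ^ 3 • (R (xiMap σ y x) * realDiag y)) * gaugeExp (-1) σ y x) ∧
    matD (fun _ => 1) (matD (fun _ => 1) r) x = c • (
      (a ^ 2 • matD (fun _ => 1) (matD (fun _ => 1) R) (xiMap σ y x)
      - (2 * a ^ 4) • (matD (fun _ => 1) R (xiMap σ y x) * realDiag y)
      + a ^ 6 • (R (xiMap σ y x) * realDiag y * realDiag y)) * gaugeExp (-1) σ y x) := by
  have hR : ∀ i j, ContDiffOn ℝ 2 (fun x => R (xiMap σ y x) i j) V := by
    have h1 : ∀ x ∈ V, r x * gaugeExp 1 σ y x = c • R (xiMap σ y x) := fun x hx => by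
      rw [h x hx, Matrix.smul_mul, Matrix.mul_assoc, gaugeExp_mul_gaugeExp (by norm_num),
        Matrix.mul_one]
    exact contDiffOn_matrix_of_smul_eq hc (contDiffOn_matrix_mul hr
      (fun i j => (contDiff_gaugeExp 1 σ y i j).contDiffOn)) h1
  have hcomp : ∀ (A : (Fin m → ℝ) → Matrix J (Fin m) ℂ) (x : Fin m → ℝ),
      matD (fun _ => 1) (fun x' => A (xiMap σ y x')) x = a • matD (fun _ => 1) A (xiMap σ y x) :=
    fun A x => by
      rw [← ha]
      exact matD_comp_affine (xiMap_add_smul σ y) A _ x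
  have hs' : ((-1 : ℝ) / σ : ℂ) = -a ^ 3 := by rw [← hs]; push_cast; ring
  have hd : ∀ x ∈ V, ∀ i j, DifferentiableAt ℝ (fun x => R (xiMap σ y x) i j) x := fun x hx i j =>
    ((hR i j).contDiffAt (hV.mem_nhds hx)).differentiableAt two_ne_zero
  have h1 : ∀ x ∈ V, matD (fun _ => 1) r x = c • ((a • matD (fun _ => 1) R (xiMap σ y x)
      - a ^ 3 • (R (xiMap σ y x) * realDiag y)) * gaugeExp (-1) σ y x) :=
    fun x hx => by
      rw [matD_congr (Filter.mem_of_superset (hV.mem_nhds hx) h), matD_smul,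
        matD_mul_gaugeExp (-1) σ y (A := fun x => R (xiMap σ y x)) (hd x hx), hcomp, hs', neg_smul,
        sub_eq_add_neg]
  refine ⟨h1 x hx, ?_⟩
  have hdY : ∀ i j, DifferentiableAt ℝ (fun x => (R (xiMap σ y x) * realDiag y) i j) x :=
    differentiableAt_matrix_mul (hd x hx) (fun i j => differentiableAt_const _)
  have hd2 : ∀ i j, DifferentiableAt ℝ
      (fun x => (a • matD (fun _ => 1) R (xiMap σ y x)) i j) x := fun i j => by
    simp only [← hcomp]
    exact differentiableAt_matD hV hR hx _ i j
  have hd3 : ∀ i j, DifferentiableAt ℝ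
      (fun x => (a ^ 3 • (R (xiMap σ y x) * realDiag y)) i j) x := fun i j =>
    (hdY i j).const_smul (a ^ 3)
  rw [matD_congr (Filter.mem_of_superset (hV.mem_nhds hx) h1), matD_smul,
    matD_mul_gaugeExp (-1) σ y (A := fun x => a • matD (fun _ => 1) R (xiMap σ y x)
      - a ^ 3 • (R (xiMap σ y x) * realDiag y)) (fun i j => (hd2 i j).sub (hd3 i j)), hs',
    matD_sub hd2 hd3, matD_smul, matD_smul, hcomp (matD (fun _ => 1) R),
    matD_mul (B := fun _ => realDiag y) (hd x hx) (fun i j => differentiableAt_const _),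
    matD_const, hcomp]
  congr 2
  simp only [Matrix.mul_zero, add_zero, Matrix.sub_mul, Matrix.smul_mul]
  module

/-- The derivative of a function that is gauged from both sides. -/
theorem matD_gauge_conj (hV : IsOpen V) (ha : ((σ ^ (1 / 3 : ℝ))⁻¹ : ℝ) = a)
    (hs : (1 / σ : ℂ) = a ^ 3)
    {q Q : (Fin m → ℝ) → Matrix (Fin m) (Fin m) ℂ} (hc : c ≠ 0)
    (hq : ∀ i j, ContDiffOn ℝ 2 (fun x => q x i j) V)
    (h : ∀ x ∈ V, q x = c • (gaugeExp 1 σ y x * Q (xiMap σ y x) * gaugeExp (-1) σ y x))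
    (hx : x ∈ V) :
    matD (fun _ => 1) q x = c • (gaugeExp 1 σ y x * (a • matD (fun _ => 1) Q (xiMap σ y x)
      + a ^ 3 • ⁅realDiag y, Q (xiMap σ y x)⁆) * gaugeExp (-1) σ y x) := by
  have hE : ∀ ε : ℝ, ∀ i j, ContDiffOn ℝ 2 (fun x => gaugeExp ε σ y x i j) V := fun ε i j =>
    (contDiff_gaugeExp ε σ y i j).contDiffOn
  have hQ : ∀ i j, ContDiffOn ℝ 2 (fun x => Q (xiMap σ y x) i j) V := by
    have h1 : ∀ x ∈ V, gaugeExp (-1) σ y x * q x * gaugeExp 1 σ y x = c • Q (xiMap σ y x) :=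
      fun x hx => by
        rw [h x hx, Matrix.mul_smul, Matrix.smul_mul, Matrix.mul_assoc, Matrix.mul_assoc,
          gaugeExp_mul_gaugeExp (by norm_num), Matrix.mul_one, ← Matrix.mul_assoc,
          gaugeExp_mul_gaugeExp (by norm_num), Matrix.one_mul]
    exact contDiffOn_matrix_of_smul_eq hc (contDiffOn_matrix_mul
      (contDiffOn_matrix_mul (hE (-1)) hq) (hE 1)) h1
  have hd : ∀ i j, DifferentiableAt ℝ (fun x => Q (xiMap σ y x) i j) x := fun i j =>
    ((hQ i j).contDiffAt (hV.mem_nhds hx)).differentiableAt two_ne_zero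
  have hs' : ((1 : ℝ) / σ : ℂ) = a ^ 3 := by rw [← hs, Complex.ofReal_one]
  have hs'' : ((-1 : ℝ) / σ : ℂ) = -a ^ 3 := by rw [← hs]; push_cast; ring
  have h1 := matD_comp_affine (xiMap_add_smul σ y) Q (fun _ => 1) x
  rw [ha] at h1
  simp only [Matrix.mul_assoc] at h
  rw [matD_congr (Filter.mem_of_superset (hV.mem_nhds hx) h), matD_smul,
    matD_gaugeExp_mul 1 σ y (A := fun x => Q (xiMap σ y x) * gaugeExp (-1) σ y x)
      (differentiableAt_matrix_mul hd (differentiableAt_gaugeExp (-1) σ y)),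
    matD_mul_gaugeExp (-1) σ y (A := fun x => Q (xiMap σ y x)) hd, h1, hs', hs'']
  congr 1
  rw [Matrix.mul_assoc]
  congr 1
  simp only [Ring.lie_def, Matrix.add_mul, Matrix.sub_mul, Matrix.smul_mul, smul_sub,
    Matrix.mul_assoc]
  module

end Differentiate

/-- The equivalence holds at each point of `V` separately; openness of `V` serves only to
differentiate the relation between the two sets of functions. Each derivative of `E P(ξ)` acts as `a
∂ + a³ 𝐲` on `P`, with `a = σ^(-1/3)`. -/
theorem reducedODESystem_iff_tracyWidomSystem {σ : ℝ} {y : Fin m → ℝ} {V : Set (Fin m → ℝ)}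
    {q Q : (Fin m → ℝ) → Matrix (Fin m) (Fin m) ℂ} {p P : (Fin m → ℝ) → Matrix (Fin m) Unit ℂ}
    {r R : (Fin m → ℝ) → Matrix Unit (Fin m) ℂ} (hσ : 0 < σ) (hV : IsOpen V)
    (hq : ∀ i j, ContDiffOn ℝ 2 (fun x => q x i j) V)
    (hp : ∀ i j, ContDiffOn ℝ 2 (fun x => p x i j) V)
    (hr : ∀ i j, ContDiffOn ℝ 2 (fun x => r x i j) V)
    (h : ∀ x ∈ V, IsRescaling σ y q p r Q P R x) {x : Fin m → ℝ} (hx : x ∈ V) :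
    ReducedODESystem (-σ / 3) y q p r x ↔
      TracyWidomSystem (fun k => σ ^ (-(2 / 3) : ℝ) * y k) Q P R (xiMap σ y x) := by
  set α : ℝ := σ ^ (-(1 / 3) : ℝ) with hα
  have hα0 : 0 < α := Real.rpow_pos_of_pos hσ _
  have e1 : (σ ^ (1 / 3 : ℝ))⁻¹ = α := (Real.rpow_neg hσ.le _).symm
  have e2 : σ ^ (-(2 / 3) : ℝ) = α ^ 2 := by
    rw [hα, ← Real.rpow_mul_natCast hσ.le]
    norm_num
  have e4 : (σ ^ (4 / 3 : ℝ))⁻¹ = α ^ 4 := by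
    rw [hα, ← Real.rpow_mul_natCast hσ.le, ← Real.rpow_neg hσ.le]
    norm_num
  have e3 : σ * α ^ 3 = 1 := by
    rw [hα, ← Real.rpow_mul_natCast hσ.le]
    norm_num [Real.rpow_neg_one, hσ.ne']
  set a : ℂ := (α : ℂ) with ha
  have ha0 : a ≠ 0 := Complex.ofReal_ne_zero.2 hα0.ne'
  have e3c : (σ : ℂ) * a ^ 3 = 1 := by
    rw [ha]
    exact_mod_cast e3
  have hs : (1 / σ : ℂ) = a ^ 3 := by
    rw [div_eq_iff (Complex.ofReal_ne_zero.2 hσ.ne'), mul_comm, e3c]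
  have e1c : (((σ ^ (1 / 3 : ℝ))⁻¹ : ℝ) : ℂ) = a := by rw [e1]
  have hc0 : Complex.I * a ≠ 0 := mul_ne_zero Complex.I_ne_zero ha0
  have dp := matD_gauge_left hV e1c hs hc0 hp (fun x hx => (h x hx).1) hx
  have dr := matD_gauge_right hV e1c hs hc0 hr (fun x hx => (h x hx).2.1) hx
  have dq := matD_gauge_conj hV e1c hs (neg_ne_zero.2 ha0) hq (fun x hx => (h x hx).2.2) hx
  -- The completed square: the terms quadratic in `𝐲` produced by differentiating the gauge combine
  -- with `𝐱` into `ξ`.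
  have hΞ : realDiag (xiMap σ y x) = a • realDiag x + a ^ 4 • (realDiag y * realDiag y) := by
    rw [realDiag, realDiag, realDiag, Matrix.diagonal_mul_diagonal, ← Matrix.diagonal_smul,
      ← Matrix.diagonal_smul, Matrix.diagonal_add]
    congr 1
    ext k
    have h1 : xiMap σ y x k = α * x k + α ^ 4 * (y k * y k) := by
      rw [← e4, ← e1]
      simp only [xiMap]
      ring
    rw [h1, ha]
    simp
  have hY : realDiag (fun k => σ ^ (-(2 / 3) : ℝ) * y k) = a ^ 2 • realDiag y := by
    rw [realDiag, realDiag, ← Matrix.diagonal_smul]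
    congr 1
    ext k
    simp only [e2, ha, Pi.smul_apply, smul_eq_mul]
    push_cast
    ring
  have key := reduced_iff_tracyWidom_of_gauge e3c
    (show Complex.I * a * (Complex.I * a) = -a ^ 2 by linear_combination a ^ 2 * Complex.I_mul_I)
    (gaugeExp_mul_gaugeExp (show (-1 : ℝ) + 1 = 0 by norm_num) σ y x)
    (realDiag_commute y _) (realDiag_commute _ y) (realDiag_commute x _) (realDiag_commute _ x)
    _ _ _ _ _ _ _ _ (h x hx).2.2 (h x hx).1 (h x hx).2.1 dq dp.1 dr.1 dp.2 dr.2
  have c1 : (3 * ((-σ / 3 : ℝ) : ℂ)) = -(σ : ℂ) := by push_cast; ring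
  have c2 : (6 * ((-σ / 3 : ℝ) : ℂ)) = -2 * (σ : ℂ) := by push_cast; ring
  simp only [ReducedODESystem, TracyWidomSystem, c1, c2, hΞ, hY]
  exact key

end RescalingEquivalence
end

/-! ### The main theorem. -/

theorem mainTheorem6 {m : ℕ} {ι : Type*} [Fintype ι] (Γ : ι → SimpleContour)
    (hdisj : Pairwise fun a b => Disjoint (Γ a).trace (Γ b).trace)
    (hsep : SeparatedAtInfinity Γ)
    (F G : ℂ → Fin m ⊕ Unit → ℂ) (c : Params m → ℂ → ℂ)
    (H : Params m → (ContourL2 Γ →L[ℂ] ContourL2 Γ))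
    (U : Set (Params m))
    (hU : ∀ t : Fin m → ℝ, IsOpen {w : (Fin m → ℝ) × (Fin m → ℝ) | (w.1, w.2, t) ∈ U})
    (hH : ∀ P ∈ U, IsStronglyCubicIntegrable Γ F G (c P) P (H P))
    (hinv : ∀ P ∈ U, IsUnit (1 - H P)) :
    -- regularity in `x` of the matrix `Φ₁`
    (∀ y t : Fin m → ℝ, ∀ i j : Fin m ⊕ Unit,
      ContDiffOn ℝ 2 (fun x => phiOne Γ F G (c (x, y, t)) (x, y, t) (H (x, y, t)) i j)
        {x | (x, y, t) ∈ U}) ∧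
    -- the matrix ODE system for the blocks of `Φ₁`
    (∀ x y t : Fin m → ℝ, (x, y, t) ∈ U →
      MatrixODESystem y t
        (fun x' => (phiOne Γ F G (c (x', y, t)) (x', y, t) (H (x', y, t))).toBlocks₁₁)
        (fun x' => (phiOne Γ F G (c (x', y, t)) (x', y, t) (H (x', y, t))).toBlocks₁₂)
        (fun x' => (phiOne Γ F G (c (x', y, t)) (x', y, t) (H (x', y, t))).toBlocks₂₁) x) ∧
    -- the reduced system in the case of equal times
    (∀ (x y t : Fin m → ℝ) (τ : ℝ), (x, y, t) ∈ U → (∀ k, t k = τ) →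
      ReducedODESystem τ y
        (fun x' => (phiOne Γ F G (c (x', y, t)) (x', y, t) (H (x', y, t))).toBlocks₁₁)
        (fun x' => (phiOne Γ F G (c (x', y, t)) (x', y, t) (H (x', y, t))).toBlocks₁₂)
        (fun x' => (phiOne Γ F G (c (x', y, t)) (x', y, t) (H (x', y, t))).toBlocks₂₁) x) ∧
    -- the equivalence of the reduced system with `τ = -σ/3` and the Tracy–Widom system
    (∀ (σ : ℝ) (y : Fin m → ℝ) (V : Set (Fin m → ℝ))
      (q Q : (Fin m → ℝ) → Matrix (Fin m) (Fin m) ℂ)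
      (p P : (Fin m → ℝ) → Matrix (Fin m) Unit ℂ)
      (r R : (Fin m → ℝ) → Matrix Unit (Fin m) ℂ),
      0 < σ → IsOpen V →
      (∀ i j, ContDiffOn ℝ 2 (fun x => q x i j) V) →
      (∀ i j, ContDiffOn ℝ 2 (fun x => p x i j) V) →
      (∀ i j, ContDiffOn ℝ 2 (fun x => r x i j) V) →
      (∀ x ∈ V, IsRescaling σ y q p r Q P R x) →
      ((∀ x ∈ V, ReducedODESystem (-σ / 3) y q p r x) ↔
        ∀ x ∈ V, TracyWidomSystem (fun k => σ ^ (-(2 / 3) : ℝ) * y k) Q P R (xiMap σ y x))) := by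
  -- Joint openness in `(x, y)` was needed for the decay; the differential equations need only the
  -- slices in `x`.
  have hopen : ∀ y t : Fin m → ℝ, IsOpen {x | (x, y, t) ∈ U} := fun y t =>
    (hU t).preimage (f := fun x => (x, y)) (by fun_prop)
  refine ⟨fun y t i j => ?_, fun x y t hx => ?_, fun x y t τ hx ht => ?_,
    fun σ y V q Q p P r R hσ hV hq hp hr h => forall₂_congr fun x hx =>
      reducedODESystem_iff_tracyWidomSystem hσ hV hq hp hr h hx⟩
  · obtain ⟨M, hM, hM'⟩ := exists_momentHierarchy hdisj hsep hU hH hinv y t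
    exact (hM.contDiffOn (hopen y t) 2 0 i j).congr fun x hx => by rw [(hM' x hx).1]
  · obtain ⟨M, hM, hM'⟩ := exists_momentHierarchy hdisj hsep hU hH hinv y t
    exact hM.matrixODESystem (hopen y t) (fun x hx => (hM' x hx).1) hx (hM' x hx).2
  · obtain ⟨M, hM, hM'⟩ := exists_momentHierarchy hdisj hsep hU hH hinv y t
    exact hM.reducedODESystem (hopen y t) ht (fun x hx => (hM' x hx).1) hx (hM' x hx).2
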